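/- Let $a\ge 1$ and $k$ be integers, and let $q$ be a prime power coprime to $a$, $\zeta$ a primitive $a$-th root of unity in $\overline{\mathbb F}_q$, and $j_{q,n,k}(a)$ the number of $t\in \mathrm{GL}_n(q)$ with $t^a=1$ and $\det t=\zeta^k$. Multiplication by $q$ permutes the index set $\mathbb Z/a\mathbb Z$; let $S$ be a set of representatives of its orbits (the Frobenius orbits) and $l_s$ the size of the orbit of $s\in S$. Let $M_n\subset\mathbb Z^{\mathbb Z/a\mathbb Z}$ be the set of integer vectors $m=(m_i)$ that are constant on Frobenius orbits and satisfy $\sum_i m_i=n$ and $\sum_i i\,m_i\equiv k \pmod a$ (a coset $\lambda_n+\Lambda$ of a fixed lattice $\Lambda$, or empty if $\zeta^k\notin\mathbb F_q$). Put $$\theta_{\lambda'_n}(z)=\sum_{m\in M_n} e^{2\pi i z\sum_i (m_i-n/a)^2},\qquad f_n(z)=\frac{\eta(z)\,\theta_{\lambda'_n}(z)}{\prod_{s\in S}\eta(l_s z)},$$ where $\eta$ is the Dedekind eta function. These functions depend on $q$ only through its class modulo $a$. By a modular form of weight $\kappa/2$ ($\kappa\in\mathbb Z$), meromorphic at the cusps,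 we mean a holomorphic function $f$ on the upper half plane such that, for some $N\ge1$ with $4\mid N$, $f(\gamma z)=\bigl(\vartheta(\gamma z)/\vartheta(z)\bigr)^{\kappa}f(z)$ for all $\gamma\in\Gamma(N)$, where $\vartheta(z)=\sum_{n\in\mathbb Z}e^{2\pi i n^2z}$, and which has at most poles at the cusps. It has integral Fourier coefficients if for some integers $N\ge 1$, $j_0$ and $c_j$ one has $f(z)=\sum_{j\ge j_0}c_j e^{2\pi i jz/N}$. (1) For each residue class of $q$ modulo $a$ coprime to $a$, the sequence $f_n$ satisfies $f_{n+2a}=f_n$, and each $f_n$ is a modular form, meromorphic at the cusps, of weight $\tfrac12(|S|-1)+\tfrac12-\tfrac12|S|=0\in\tfrac12\mathbb Z$ with integral Fourier coefficients. Moreover $$j_{q,n,k}(a)=\Bigl(f_n\bigl(\tfrac{i\log q}{2\pi}\bigr)+o(1)\Bigr)\,q^{(1-a)/24}\,q^{(1-1/a)n^2}\qquad(n\to\infty),$$ where for fixed $a,k$ the $o(1)$ is uniform in all prime powers $q$ coprime to $a$ and in $\zeta$. (2) Let $a_1,\dots,a_r\ge 1$ be integers with least common multiple $A$ ($A=1$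 if $r=0$), and let $J_{q,n}(a_1,\dots,a_r)$ be the number of $(t_1,\dots,t_r)\in \mathrm{GL}_n(q)^r$ with $t_i^{a_i}=1$ for all $i$ and $\prod_i\det t_i=1$. For each residue class $u$ modulo $A$ there is a sequence $f_{u,1},f_{u,2},\dots$, periodic in $n$ with period $2A$, of modular forms of weight $0$ with integral Fourier coefficients, holomorphic except possibly at the cusps, such that for all prime powers $q$ coprime to $A$, with $u=q \bmod A$, $$J_{q,n}(a_1,\dots,a_r)=\Bigl(f_{u,n}\bigl(\tfrac{i\log q}{2\pi}\bigr)+o(1)\Bigr)\,q^{(r-a_1-\cdots-a_r)/24}\,q^{(r-1/a_1-\cdots-1/a_r)n^2}\qquad(n\to\infty),$$ where for fixed $a_1,\dots,a_r$ the $o(1)$ is uniform in $q$. -/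

import Mathlib

open scoped Matrix MatrixGroups Manifold UpperHalfPlane

noncomputable section

namespace FuchsianCount

/-! ### Modular forms of half-integral weight -/

/-- The theta automorphy factor `j(γ, z) = ϑ(γ z) / ϑ(z)`, where `ϑ(z) = ∑_{n ∈ ℤ} exp(2 π i n² z)`
(Mathlib's `jacobiTheta τ` is `∑_{n ∈ ℤ} exp(π i n² τ)`, and it has no zeros in the upper half
plane).  For `γ ∈ Γ(4)` one has `j(γ, z)² = c z + d`. -/
def thetaFactor (γ : SL(2, ℤ)) (z : ℍ) : ℂ :=
  jacobiTheta (2 * ((γ • z : ℍ) : ℂ)) / jacobiTheta (2 * (z : ℂ))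

/-- `f` is a modular form of half-integral weight `κ / 2` (`κ ∈ ℤ`), holomorphic on the upper half
plane and meromorphic at the cusps, for some congruence subgroup `Γ(N)` with `4 ∣ N`:

* `f` is holomorphic on the upper half plane;
* `f(γ z) = j(γ, z)^κ f(z)` for `γ ∈ Γ(N)`;
* at every cusp `γ ∞` (`γ ∈ SL₂(ℤ)`) the function `|f(γ z)| |c z + d|^{-κ/2}` grows at most
  exponentially in `Im z`, i.e. `f` has at most a pole there. -/
structure IsHalfIntegralWeightForm (κ : ℤ) (f : ℍ → ℂ) : Prop where
  holo : MDifferentiable 𝓘(ℂ) 𝓘(ℂ) f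
  transform : ∃ N : ℕ, 0 < N ∧ 4 ∣ N ∧ ∀ γ ∈ CongruenceSubgroup.Gamma N, ∀ z : ℍ,
    f (γ • z) = thetaFactor γ z ^ κ * f z
  meromorphic_cusps : ∀ γ : SL(2, ℤ), ∃ B C : ℝ, ∀ z : ℍ, 1 ≤ z.im →
    ‖f (γ • z)‖ ≤
      C * Real.exp (B * z.im) * ‖((γ 1 0 : ℤ) : ℂ) * (z : ℂ) + ((γ 1 1 : ℤ) : ℂ)‖ ^ ((κ : ℝ) / 2)

/-- `f` has a Fourier expansion `f(z) = ∑_{j ≥ j₀} c_j exp(2 π i j z / N)` at `i∞` (a Laurent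
series in `exp(2 π i z / N)`, with finite principal part) whose coefficients `c_j` are integers. -/
def HasIntegralFourierExpansion (f : ℍ → ℂ) : Prop :=
  ∃ N : ℕ, 0 < N ∧ ∃ (j₀ : ℤ) (c : ℕ → ℤ), ∀ z : ℍ,
    HasSum (fun j : ℕ =>
      (c j : ℂ) * Complex.exp (2 * Real.pi * Complex.I * (((j₀ + j : ℤ) : ℂ) / N) * (z : ℂ))) (f z)

/-! ### The modular forms `f_n`

The indices `i ∈ {1, …, a}` of the `a`-th roots of unity `ζ^i` are taken in `ZMod a` (the index `a`
is `0`).  The parameter `u` is the class of `q` modulo `a`. -/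

/-- The Frobenius orbit of `i`: the indices of the roots of unity `(ζ^i)^{q^r}`, `r ≥ 0`. -/
def frobOrbit {a : ℕ} (u i : ZMod a) : Set (ZMod a) := {j | ∃ r : ℕ, j = u ^ r * i}

/-- The set of all Frobenius orbits on `ZMod a`. -/
def frobOrbits {a : ℕ} (u : ZMod a) : Set (Set (ZMod a)) := Set.range (frobOrbit u)

/-- The set `λ_n + Λ ⊆ ℤ^a` of vectors `m` with coordinate sum `n` that are constant on Frobenius
orbits and satisfy `∑ i m_i ≡ k (mod a)`.  It is a coset of the subgroup `Λ` obtained for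
`n = k = 0`, or empty (the latter when `ζ^k ∉ 𝔽_q`). -/
def latticeCoset {a : ℕ} [NeZero a] (u k : ZMod a) (n : ℕ) : Set (ZMod a → ℤ) :=
  {m | ∑ i, m i = n ∧ (∀ i, ∀ j ∈ frobOrbit u i, m j = m i) ∧ ∑ i, i * (m i : ZMod a) = k}

/-- The theta series `∑ exp(2 π i (λ' · λ') z)` over the vectors
`λ' = m - (n/a, …, n/a)`, `m ∈ λ_n + Λ`. -/
def cosetTheta {a : ℕ} [NeZero a] (u k : ZMod a) (n : ℕ) (z : ℂ) : ℂ :=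
  ∑' m : latticeCoset u k n,
    Complex.exp (2 * Real.pi * Complex.I * (∑ i, ((m.1 i : ℂ) - (n : ℂ) / (a : ℂ)) ^ 2) * z)

/-- `f_n(z) = η(z) θ_{λ'_n}(z) / ∏_s η(l_s z)`, the product being over the Frobenius orbits and
`l_s` the size of the orbit. -/
def fForm {a : ℕ} [NeZero a] (u k : ZMod a) (n : ℕ) (z : ℂ) : ℂ :=
  ModularForm.eta z * cosetTheta u k n z /
    ∏ᶠ O ∈ frobOrbits u, ModularForm.eta ((O.ncard : ℂ) * z)

/-! ### The counting functions -/

/-- `j_{q,n,k}(a)`: the number of `t ∈ GL_n(F)` with `t^a = 1` and `det t = ζ^k`, where `F` is a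
finite field with `q` elements and `ζ` lies in its algebraic closure. -/
def jCount (F : Type*) [Field F] (n a : ℕ) (ζ : AlgebraicClosure F) (k : ℤ) : ℕ :=
  Nat.card {t : GL (Fin n) F //
    t ^ a = 1 ∧ algebraMap F (AlgebraicClosure F) (t : Matrix (Fin n) (Fin n) F).det = ζ ^ k}

/-- `J_{q,n}(a_1, …, a_r)`: the number of `(t_1, …, t_r) ∈ GL_n(F)^r` with `t_i^{a_i} = 1` for all
`i` and `∏ det t_i = 1`. -/
def JCount (F : Type*) [Field F] (n : ℕ) {r : ℕ} (a : Fin r → ℕ) : ℕ :=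
  Nat.card {t : Fin r → GL (Fin n) F //
    (∀ i, t i ^ a i = 1) ∧ ∏ i, (t i : Matrix (Fin n) (Fin n) F).det = 1}

/-- The point `i log q / 2π` of the upper half plane (for `q > 1`). -/
def qPoint (q : ℕ) : ℂ := Complex.I * (Real.log q : ℂ) / (2 * Real.pi)

end FuchsianCount

end

open FuchsianCount

/-!
The modular form `fForm` is rewritten in terms of the Frobenius orbits `s`, with lengths `lₛ` and
index sums `cₛ`: it is `η(z) θ(z) / ∏ η(lₛ z)`, where `θ` is a theta series over the vectors `x ∈ ℤˢ`
with `∑ lₛ xₛ = n` and `∑ cₛ xₛ = k` (`fForm_eq_weightForm`).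

*Modularity.* The two conditions on `x` are detected by additive characters, the first one only
modulo `2a`. The vectors satisfying it modulo `2a` are the translates of the coset by multiples of
`(2, …, 2)`, so that `θ` times a one-variable theta function is a linear combination of products of
one-variable theta functions at torsion points (`weightTheta_mul_diagTheta`). Divided by eta
functions these are Siegel functions. `SL(2, ℤ)` permutes the Siegel functions up to the character of
`η²` (`siegelFn_smul`), so that those of rational characteristic are invariant under some `Γ(N)`. By
the Jacobi triple product, the quotients `η(lz)/η(z)` are products of Siegel functions as well. As
the numbers of theta and eta factors agree, `fForm` is invariant under some `Γ(N)`; this is weight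
zero.

For meromorphy at the cusps the crude bound `|f(z)| ≤ exp(C (Im z + 1 / Im z))` is enough, because
invariance allows one to bound `Re z` (`HasExpGrowth.isHalfIntegralWeightForm`). It holds for `θ`, `η`
and `1/η`. Fourier coefficients are integral because `∏ (1 - Qⁿ)` and its inverse have integer
coefficients, and those of `θ` count vectors. Periodicity in `n` is translation by `(2, …, 2)`.

*Counting.* If `q` is prime to `a`, then `X ^ a - 1` is the product of distinct irreducible
polynomials `Pₛ` over `𝔽_q`, one for each orbit, and an element `t` with `t ^ a = 1` is an
`𝔽_q[X]`-module `⨁ Kₛ ^ xₛ` with `Kₛ = 𝔽_q[X] / Pₛ`. Its determinant is `ζ ^ (∑ cₛ xₛ)`, and its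
conjugacy class has `|GL_n(q)| / ∏ |GL_{xₛ}(q ^ lₛ)|` elements (`jCount_eq_sum`). Up to the factor
`q ^ ((1 - 1/a) n²)` the class has size `q ^ (-∑ lₛ (xₛ - n/a)²)` times a ratio of partial Euler
products. Replacing these by infinite products and admitting vectors with negative coordinates turns
the sum over `x` into the value of the modular form at `i log q / 2π`. The error is
`O(q ^ (-n/2a))`, uniformly in `q` (`abs_scaledCount_sub_mainTerm_le`): vectors near the centre have
large coordinates and hence accurate Euler products, while the others are negligible.

*Several elements.* Sorting the tuples by the exponents of their determinants expresses the count as a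
sum of products of the previous ones (`JCount_eq_sum`). The required forms are the corresponding sums
of products of the `fForm`, and the error estimate carries over since the main terms are bounded.
-/

open scoped Topology

namespace FuchsianCount

/-! ### Theta functions with characteristics -/

/-- The normalized exponential `e(x) = exp (2 π i x)`. -/
noncomputable def expTwoPiI (x : ℂ) : ℂ := Complex.exp (2 * Real.pi * Complex.I * x)

lemma expTwoPiI_add (x y : ℂ) : expTwoPiI (x + y) = expTwoPiI x * expTwoPiI y := by
  simp [expTwoPiI, mul_add, Complex.exp_add]

lemma expTwoPiI_zero : expTwoPiI 0 = 1 := by simp [expTwoPiI]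

lemma expTwoPiI_ne_zero (x : ℂ) : expTwoPiI x ≠ 0 := Complex.exp_ne_zero _

lemma expTwoPiI_neg (x : ℂ) : expTwoPiI (-x) = (expTwoPiI x)⁻¹ := by
  simp [expTwoPiI, Complex.exp_neg]

lemma expTwoPiI_intCast (n : ℤ) : expTwoPiI n = 1 := by
  rw [expTwoPiI, mul_comm]
  exact Complex.exp_int_mul_two_pi_mul_I n

lemma expTwoPiI_add_intCast (x : ℂ) (n : ℤ) : expTwoPiI (x + n) = expTwoPiI x := by
  rw [expTwoPiI_add, expTwoPiI_intCast, mul_one]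

lemma expTwoPiI_pow (x : ℂ) (n : ℕ) : expTwoPiI x ^ n = expTwoPiI (n * x) := by
  rw [expTwoPiI, expTwoPiI, ← Complex.exp_nat_mul]; ring_nf

lemma norm_expTwoPiI (x : ℂ) : ‖expTwoPiI x‖ = Real.exp (-(2 * Real.pi * x.im)) := by
  rw [expTwoPiI, Complex.norm_exp]; simp

lemma expTwoPiI_neg_half : expTwoPiI (-(1 / 2)) = -1 := by
  rw [expTwoPiI, show 2 * (Real.pi : ℂ) * Complex.I * (-(1 / 2)) = -(Real.pi * Complex.I) by ring,
    Complex.exp_neg, Complex.exp_pi_mul_I]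
  norm_num

lemma jacobiTheta₂_term_eq (n : ℤ) (z τ : ℂ) :
    jacobiTheta₂_term n z τ = expTwoPiI (n * z + n ^ 2 * τ / 2) := by
  rw [jacobiTheta₂_term, expTwoPiI]; ring_nf

/-- The normalized theta function of characteristic `(r₁ + 1/2, r₂ + 1/2)`:
`e(-r₁(r₂ + 1)/2) ∑ₙ e(τ m² / 2 + m (r₂ + 1/2))`, where `m = n + r₁ + 1/2`.
The phase makes the index transform under `SL(2, ℤ)` as a row vector, without further factors
depending on it. -/
noncomputable def charTheta (r₁ r₂ τ : ℂ) : ℂ :=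
  expTwoPiI (-(r₁ * (r₂ + 1) / 2) + τ * (1 / 2 + r₁) ^ 2 / 2 + (1 / 2 + r₁) * (1 / 2 + r₂)) *
    jacobiTheta₂ (1 / 2 + r₂ + (1 / 2 + r₁) * τ) τ

lemma jacobiTheta₂_add_one_right (z τ : ℂ) :
    jacobiTheta₂ z (τ + 1) = jacobiTheta₂ (z + 1 / 2) τ := by
  refine tsum_congr fun n => ?_
  obtain ⟨k, hk⟩ : ∃ k : ℤ, n ^ 2 - n = 2 * k := by
    obtain ⟨k, hk⟩ := Int.even_mul_pred_self n
    exact ⟨k, by linarith⟩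
  have hk' : (n : ℂ) ^ 2 - n = 2 * k := by exact_mod_cast hk
  rw [jacobiTheta₂_term_eq, jacobiTheta₂_term_eq, ← expTwoPiI_add_intCast (n * (z + 1 / 2) + _) k]
  congr 1
  linear_combination hk' / 2

lemma charTheta_add_one (r₁ r₂ τ : ℂ) :
    charTheta r₁ r₂ (τ + 1) = expTwoPiI (1 / 8) * charTheta r₁ (r₁ + r₂) τ := by
  rw [charTheta, charTheta, ← mul_assoc, ← expTwoPiI_add, jacobiTheta₂_add_one_right,
    show 1 / 2 + r₂ + (1 / 2 + r₁) * (τ + 1) + 1 / 2 =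
      1 / 2 + (r₁ + r₂) + (1 / 2 + r₁) * τ + 1 by ring, jacobiTheta₂_add_left]
  congr 2
  ring

lemma charTheta_neg_inv (r₁ r₂ : ℂ) {τ : ℂ} (hτ : 0 < τ.im) :
    charTheta r₁ r₂ (-1 / τ) =
      expTwoPiI (-(1 / 4)) * (-Complex.I * τ) ^ (1 / 2 : ℂ) * charTheta r₂ (-r₁) τ := by
  have h0 : τ ≠ 0 := by rintro rfl; simp at hτ
  have hI : (-Complex.I * τ) ^ (1 / 2 : ℂ) ≠ 0 := by
    rw [Ne, Complex.cpow_eq_zero_iff]; simp [h0]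
  have hfe := jacobiTheta₂_functional_equation ((1 / 2 + r₂) * τ - (1 / 2 + r₁)) τ
  have hexp : Complex.exp (-Real.pi * Complex.I * ((1 / 2 + r₂) * τ - (1 / 2 + r₁)) ^ 2 / τ) =
      expTwoPiI (-(((1 / 2 + r₂) * τ - (1 / 2 + r₁)) ^ 2 / (2 * τ))) := by
    rw [expTwoPiI]; congr 1; field_simp
  rw [hexp, show ((1 / 2 + r₂) * τ - (1 / 2 + r₁)) / τ = 1 / 2 + r₂ + (1 / 2 + r₁) * (-1 / τ) by
    field_simp; ring] at hfe
  rw [charTheta, charTheta, show 1 / 2 + -r₁ + (1 / 2 + r₂) * τ =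
    (1 / 2 + r₂) * τ - (1 / 2 + r₁) + 1 by ring, jacobiTheta₂_add_left, hfe]
  rw [show ∀ a b c d f : ℂ, a * b * (c * (1 / b * d * f)) = a * c * d * f * (b / b) by
    intro a b c d f; ring, div_self hI, mul_one, ← expTwoPiI_add, ← expTwoPiI_add]
  congr 2
  field_simp
  ring

lemma jacobiTheta₂_add_int (z τ : ℂ) (u : ℤ) :
    jacobiTheta₂ (z + u) τ = jacobiTheta₂ z τ := by
  refine tsum_congr fun n => ?_
  rw [jacobiTheta₂_term_eq, jacobiTheta₂_term_eq,
    ← expTwoPiI_add_intCast (n * z + _) (n * u)]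
  congr 1
  push_cast
  ring

lemma jacobiTheta₂_add_int_mul (z τ : ℂ) (u : ℤ) :
    jacobiTheta₂ (z + u * τ) τ = expTwoPiI (-(u * z) - u ^ 2 * τ / 2) * jacobiTheta₂ z τ := by
  rw [jacobiTheta₂, jacobiTheta₂, ← tsum_mul_left,
    ← (Equiv.addRight u).tsum_eq fun n => _ * jacobiTheta₂_term n z τ]
  refine tsum_congr fun n => ?_
  rw [jacobiTheta₂_term_eq, jacobiTheta₂_term_eq, ← expTwoPiI_add]
  congr 1
  simp only [Equiv.coe_addRight, Int.cast_add]
  ring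

/-- Translating the characteristic by integers only changes the phase. For a translation by
multiples of `2 M` of a characteristic in `(1/M) ℤ²` the phase is trivial. -/
lemma charTheta_add_int (r₁ r₂ τ : ℂ) (u₁ u₂ : ℤ) :
    charTheta (r₁ + u₁) (r₂ + u₂) τ =
      expTwoPiI ((r₁ * u₂ - u₁ * r₂ + u₁ * u₂ - u₁ + u₂) / 2) * charTheta r₁ r₂ τ := by
  rw [charTheta, charTheta, show 1 / 2 + (r₂ + u₂) + (1 / 2 + (r₁ + u₁)) * τ =
    1 / 2 + r₂ + (1 / 2 + r₁) * τ + u₁ * τ + u₂ by ring, jacobiTheta₂_add_int,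
    jacobiTheta₂_add_int_mul, ← mul_assoc, ← mul_assoc, ← expTwoPiI_add, ← expTwoPiI_add]
  congr 2
  ring

/-- The quotient of `charTheta` by the Dedekind eta function (a Siegel function, up to a
constant). -/
noncomputable def siegelFn (r₁ r₂ τ : ℂ) : ℂ := charTheta r₁ r₂ τ / ModularForm.eta τ

lemma eta_add_one (τ : ℂ) :
    ModularForm.eta (τ + 1) = expTwoPiI (1 / 24) * ModularForm.eta τ := by
  have h : ∀ n, ModularForm.eta_q n (τ + 1) = ModularForm.eta_q n τ := by
    intro n
    have := expTwoPiI_add_intCast ((n + 1) * τ) (n + 1)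
    rw [ModularForm.eta_q_eq_cexp, ModularForm.eta_q_eq_cexp]
    rw [expTwoPiI, expTwoPiI] at this
    convert this using 2 <;> push_cast <;> ring
  simp only [ModularForm.eta, h]
  rw [← mul_assoc]
  congr 1
  rw [Function.Periodic.qParam, Function.Periodic.qParam, expTwoPiI, ← Complex.exp_add]
  congr 1
  push_cast
  ring

lemma eta_neg_inv {τ : ℂ} (hτ : 0 < τ.im) :
    ModularForm.eta (-1 / τ) = (-Complex.I * τ) ^ (1 / 2 : ℂ) * ModularForm.eta τ := by
  have h := ModularForm.eta_comp_eq_csqrt_I_inv (x := τ) hτ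
  simp only [Function.comp, Pi.smul_apply, Pi.mul_apply, smul_eq_mul] at h
  rw [h, ← mul_assoc]
  congr 1
  have h0 : τ ≠ 0 := by rintro rfl; simp at hτ
  have harg : 0 < τ.arg ∧ τ.arg < Real.pi :=
    ⟨lt_of_le_of_ne (Complex.arg_nonneg_iff.2 hτ.le) fun h => by
      have := Complex.arg_eq_zero_iff.1 h.symm
      exact hτ.ne' this.2, lt_of_le_of_ne (Complex.arg_le_pi _) fun h => by
      exact hτ.ne' (Complex.arg_eq_pi_iff.1 h).2⟩
  have hlog : Complex.log (-Complex.I * τ) = Complex.log (-Complex.I) + Complex.log τ := by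
    refine Complex.log_mul (by simp) h0 ?_
    rw [Complex.arg_neg_I]
    constructor <;> linarith [harg.1, harg.2, Real.pi_pos]
  rw [Complex.cpow_def_of_ne_zero (by simp [h0]), hlog, sqrt_eq_exp Complex.I_ne_zero,
    sqrt_eq_exp h0, ← Complex.exp_neg, ← Complex.exp_add, Complex.log_I, Complex.log_neg_I]
  congr 1
  ring

lemma siegelFn_add_one (r₁ r₂ τ : ℂ) :
    siegelFn r₁ r₂ (τ + 1) = expTwoPiI (1 / 12) * siegelFn r₁ (r₁ + r₂) τ := by
  rw [siegelFn, siegelFn, charTheta_add_one, eta_add_one, mul_div_mul_comm, div_eq_mul_inv,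
    ← expTwoPiI_neg, ← expTwoPiI_add]
  congr 2
  norm_num

lemma siegelFn_neg_inv (r₁ r₂ : ℂ) {τ : ℂ} (hτ : 0 < τ.im) :
    siegelFn r₁ r₂ (-1 / τ) = expTwoPiI (-(1 / 4)) * siegelFn r₂ (-r₁) τ := by
  have h0 : τ ≠ 0 := by rintro rfl; simp at hτ
  have hI : (-Complex.I * τ) ^ (1 / 2 : ℂ) ≠ 0 := by
    rw [Ne, Complex.cpow_eq_zero_iff]; simp [h0]
  rw [siegelFn, siegelFn, charTheta_neg_inv r₁ r₂ hτ, eta_neg_inv hτ]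
  field_simp

/-! ### Transformation under the modular group -/

/-- The exponent modulo `3` of the character of `SL(2, ℤ)` by which `η⁸` transforms. -/
def etaExpThree (a b c d : ZMod 3) : ZMod 3 := (a + d) * c - b * d * (c ^ 2 - 1)

/-- The exponent modulo `4` of the character of `SL(2, ℤ)` by which `η⁶` transforms. The two cases
are those of odd and even `d`. -/
def etaExpFour (a b c d : ZMod 4) : ZMod 4 :=
  if 2 * d = 2 then (a + d) * c - b * d * (c ^ 2 - 1) - d + 1 + c * d
  else (a + d) * c - b * d * (c ^ 2 - 1) + c

/-! The four identities below hold over all of `ZMod 3` and `ZMod 4`, given that the determinant is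
one, so that they are finite checks. -/

lemma etaExpThree_T : ∀ a b c d : ZMod 3, a * d - b * c = 1 →
    etaExpThree a (a + b) c (c + d) = etaExpThree a b c d + 1 := by decide

lemma etaExpThree_S : ∀ a b c d : ZMod 3, a * d - b * c = 1 →
    etaExpThree b (-a) d (-c) = etaExpThree a b c d := by decide

lemma etaExpFour_T : ∀ a b c d : ZMod 4, a * d - b * c = 1 →
    etaExpFour a (a + b) c (c + d) = etaExpFour a b c d + 1 := by decide

lemma etaExpFour_S : ∀ a b c d : ZMod 4, a * d - b * c = 1 →
    etaExpFour b (-a) d (-c) = etaExpFour a b c d + 1 := by decide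

/-- The character of `SL(2, ℤ)` by which `η²` transforms: it maps `T` to `e(1/12)` and `S` to
`e(-1/4)`. It is written as a product of characters of `SL(2, ℤ/3)` and `SL(2, ℤ/4)`, so that
it is visibly trivial on `Γ(12)`. -/
noncomputable def etaChar (γ : SL(2, ℤ)) : ℂ :=
  ZMod.stdAddChar (etaExpThree (γ 0 0 : ℤ) (γ 0 1 : ℤ) (γ 1 0 : ℤ) (γ 1 1 : ℤ)) *
    ZMod.stdAddChar (-etaExpFour (γ 0 0 : ℤ) (γ 0 1 : ℤ) (γ 1 0 : ℤ) (γ 1 1 : ℤ))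

lemma stdAddChar_three_one : (ZMod.stdAddChar (1 : ZMod 3) : ℂ) = expTwoPiI (1 / 3) := by
  have := ZMod.stdAddChar_coe (N := 3) 1
  rw [Int.cast_one] at this
  rw [this, expTwoPiI]; push_cast; ring_nf

lemma stdAddChar_four_neg_one :
    (ZMod.stdAddChar (-1 : ZMod 4) : ℂ) = expTwoPiI (-(1 / 4)) := by
  have := ZMod.stdAddChar_coe (N := 4) (-1)
  rw [Int.cast_neg, Int.cast_one] at this
  rw [this, expTwoPiI]; push_cast; ring_nf

lemma SL2_cast_det (γ : SL(2, ℤ)) (n : ℕ) :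
    ((γ 0 0 : ℤ) : ZMod n) * ((γ 1 1 : ℤ) : ZMod n) -
      ((γ 0 1 : ℤ) : ZMod n) * ((γ 1 0 : ℤ) : ZMod n) = 1 := by
  have h := γ.det_coe
  rw [Matrix.det_fin_two] at h
  exact_mod_cast congrArg (Int.cast : ℤ → ZMod n) h

lemma mul_T_apply (γ : SL(2, ℤ)) (i : Fin 2) :
    (γ * ModularGroup.T) i 0 = γ i 0 ∧ (γ * ModularGroup.T) i 1 = γ i 0 + γ i 1 := by
  constructor <;>
  rw [Matrix.SpecialLinearGroup.coe_mul, ModularGroup.coe_T, Matrix.mul_apply,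
    Fin.sum_univ_two] <;> simp

lemma mul_S_apply (γ : SL(2, ℤ)) (i : Fin 2) :
    (γ * ModularGroup.S) i 0 = γ i 1 ∧ (γ * ModularGroup.S) i 1 = -γ i 0 := by
  constructor <;>
  rw [Matrix.SpecialLinearGroup.coe_mul, ModularGroup.coe_S, Matrix.mul_apply,
    Fin.sum_univ_two] <;> simp

lemma etaChar_mul_T (γ : SL(2, ℤ)) :
    etaChar (γ * ModularGroup.T) = etaChar γ * expTwoPiI (1 / 12) := by
  have e : expTwoPiI (1 / 12) = expTwoPiI (1 / 3) * expTwoPiI (-(1 / 4)) := by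
    rw [← expTwoPiI_add]; norm_num
  have h3 := etaExpThree_T _ _ _ _ (SL2_cast_det γ 3)
  have h4 := etaExpFour_T _ _ _ _ (SL2_cast_det γ 4)
  rw [e, ← stdAddChar_three_one, ← stdAddChar_four_neg_one, etaChar, etaChar]
  rw [(mul_T_apply γ 0).1, (mul_T_apply γ 0).2, (mul_T_apply γ 1).1, (mul_T_apply γ 1).2]
  simp [h3, h4, AddChar.map_add_eq_mul]
  ring

lemma etaChar_mul_S (γ : SL(2, ℤ)) :
    etaChar (γ * ModularGroup.S) = etaChar γ * expTwoPiI (-(1 / 4)) := by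
  have h3 := etaExpThree_S _ _ _ _ (SL2_cast_det γ 3)
  have h4 := etaExpFour_S _ _ _ _ (SL2_cast_det γ 4)
  rw [← stdAddChar_four_neg_one, etaChar, etaChar]
  rw [(mul_S_apply γ 0).1, (mul_S_apply γ 0).2, (mul_S_apply γ 1).1, (mul_S_apply γ 1).2]
  simp [h3, h4, AddChar.map_add_eq_mul]
  ring

lemma coe_S_smul (z : ℍ) : ((ModularGroup.S • z : ℍ) : ℂ) = -1 / (z : ℂ) := by
  rw [UpperHalfPlane.modular_S_smul]; simp [neg_div, inv_neg]

lemma coe_T_smul (z : ℍ) : ((ModularGroup.T • z : ℍ) : ℂ) = z + 1 := by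
  rw [UpperHalfPlane.modular_T_smul]; simp [add_comm]

/-- Siegel functions are permuted by `SL(2, ℤ)`, up to the character of `η²`. -/
lemma siegelFn_smul (γ : SL(2, ℤ)) (r₁ r₂ : ℂ) (z : ℍ) :
    siegelFn r₁ r₂ ((γ • z : ℍ) : ℂ) = etaChar γ *
      siegelFn (r₁ * (γ 0 0 : ℤ) + r₂ * (γ 1 0 : ℤ)) (r₁ * (γ 0 1 : ℤ) + r₂ * (γ 1 1 : ℤ)) z := by
  -- The property passes from `x` to `x y` and back when `y` is a generator, hence also to the
  -- inverses of generators.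
  let P : SL(2, ℤ) → Prop := fun γ => ∀ z : ℍ, siegelFn r₁ r₂ ((γ • z : ℍ) : ℂ) = etaChar γ *
      siegelFn (r₁ * (γ 0 0 : ℤ) + r₂ * (γ 1 0 : ℤ)) (r₁ * (γ 0 1 : ℤ) + r₂ * (γ 1 1 : ℤ)) z
  have step : ∀ y ∈ ({ModularGroup.S, ModularGroup.T} : Set SL(2, ℤ)), ∀ x : SL(2, ℤ),
      P (x * y) ↔ P x := by
    intro y hy x
    have key : ∀ z : ℍ, etaChar (x * y) *
        siegelFn (r₁ * ((x * y) 0 0 : ℤ) + r₂ * ((x * y) 1 0 : ℤ))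
          (r₁ * ((x * y) 0 1 : ℤ) + r₂ * ((x * y) 1 1 : ℤ)) z = etaChar x *
        siegelFn (r₁ * (x 0 0 : ℤ) + r₂ * (x 1 0 : ℤ)) (r₁ * (x 0 1 : ℤ) + r₂ * (x 1 1 : ℤ))
          ((y • z : ℍ) : ℂ) := by
      intro z
      rcases hy with rfl | rfl
      · rw [coe_S_smul, siegelFn_neg_inv _ _ z.im_pos, etaChar_mul_S, mul_assoc]
        rw [(mul_S_apply x 0).1, (mul_S_apply x 0).2, (mul_S_apply x 1).1, (mul_S_apply x 1).2]
        congr 3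
        push_cast
        ring
      · rw [coe_T_smul, siegelFn_add_one, etaChar_mul_T, mul_assoc]
        rw [(mul_T_apply x 0).1, (mul_T_apply x 0).2, (mul_T_apply x 1).1, (mul_T_apply x 1).2]
        congr 3
        push_cast
        ring
    constructor
    · intro h z
      have := h (y⁻¹ • z)
      rw [key, mul_smul, smul_inv_smul] at this
      exact this
    · intro h z
      rw [key, mul_smul]
      exact h (y • z)
  have hγ : γ ∈ Subgroup.closure {ModularGroup.S, ModularGroup.T} := by
    rw [SpecialLinearGroup.SL2Z_generators]; trivial
  suffices P γ from this z
  induction hγ using Subgroup.closure_induction_right with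
  | one =>
    intro z
    simp [etaChar, etaExpThree, etaExpFour]
  | mul_right x hx y hy ih => exact (step y hy x).2 ih
  | mul_inv_cancel x hx y hy ih => exact (step y hy _).1 (by rwa [inv_mul_cancel_right])

/-- A function on the upper half plane that is invariant under some principal congruence
subgroup. -/
def IsLevelInvariant (f : ℂ → ℂ) : Prop :=
  ∃ N : ℕ, 0 < N ∧ ∀ γ ∈ CongruenceSubgroup.Gamma N, ∀ z : ℍ, f ((γ • z : ℍ) : ℂ) = f z

/-- Siegel functions of rational characteristic are invariant under a principal congruence
subgroup. -/
lemma isLevelInvariant_siegelFn (p₁ p₂ : ℤ) {M : ℕ} (hM : 0 < M) :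
    IsLevelInvariant (siegelFn (p₁ / M) (p₂ / M)) := by
  -- The factor `12` makes `etaChar` trivial, the factor `2 M²` the phase that arises from
  -- translating the characteristic back.
  refine ⟨12 * (2 * M ^ 2), by positivity, fun γ hγ z => ?_⟩
  rw [CongruenceSubgroup.Gamma_mem] at hγ
  have h12 : ∀ x y : ℤ, (x : ZMod (12 * (2 * M ^ 2))) = (y : ℤ) →
      (x : ZMod 3) = (y : ℤ) ∧ (x : ZMod 4) = (y : ℤ) ∧ ∃ k : ℤ, x = y + 2 * M ^ 2 * k := by
    intro x y h
    rw [eq_comm, ZMod.intCast_eq_intCast_iff_dvd_sub] at h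
    refine ⟨?_, ?_, ?_⟩
    · rw [eq_comm, ZMod.intCast_eq_intCast_iff_dvd_sub]
      exact Dvd.dvd.trans ⟨4 * (2 * M ^ 2), by push_cast; ring⟩ h
    · rw [eq_comm, ZMod.intCast_eq_intCast_iff_dvd_sub]
      exact Dvd.dvd.trans ⟨3 * (2 * M ^ 2), by push_cast; ring⟩ h
    · obtain ⟨k, hk⟩ := h
      exact ⟨12 * k, by push_cast at hk; linarith⟩
  obtain ⟨ha3, ha4, ka, hka⟩ := h12 (γ 0 0) 1 (by simpa using hγ.1)
  obtain ⟨hb3, hb4, kb, hkb⟩ := h12 (γ 0 1) 0 (by simpa using hγ.2.1)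
  obtain ⟨hc3, hc4, kc, hkc⟩ := h12 (γ 1 0) 0 (by simpa using hγ.2.2.1)
  obtain ⟨hd3, hd4, kd, hkd⟩ := h12 (γ 1 1) 1 (by simpa using hγ.2.2.2)
  have hchar : etaChar γ = 1 := by
    rw [etaChar, ha3, ha4, hb3, hb4, hc3, hc4, hd3, hd4]
    simp [etaExpThree, etaExpFour]
  have hM' : (M : ℂ) ≠ 0 := by exact_mod_cast hM.ne'
  rw [siegelFn_smul, hchar, one_mul, siegelFn, siegelFn]
  congr 1
  have e1 : (p₁ / M * (γ 0 0 : ℤ) + p₂ / M * (γ 1 0 : ℤ) : ℂ) =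
      p₁ / M + ((2 * M * (p₁ * ka + p₂ * kc) : ℤ) : ℂ) := by
    rw [hka, hkc]; push_cast; field_simp; ring
  have e2 : (p₁ / M * (γ 0 1 : ℤ) + p₂ / M * (γ 1 1 : ℤ) : ℂ) =
      p₂ / M + ((2 * M * (p₁ * kb + p₂ * kd) : ℤ) : ℂ) := by
    rw [hkb, hkd]; push_cast; field_simp; ring
  rw [e1, e2, charTheta_add_int]
  have : ((p₁ / M * ((2 * M * (p₁ * kb + p₂ * kd) : ℤ) : ℂ)
      - ((2 * M * (p₁ * ka + p₂ * kc) : ℤ) : ℂ) * (p₂ / M)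
      + ((2 * M * (p₁ * ka + p₂ * kc) : ℤ) : ℂ) * ((2 * M * (p₁ * kb + p₂ * kd) : ℤ) : ℂ)
      - ((2 * M * (p₁ * ka + p₂ * kc) : ℤ) : ℂ) + ((2 * M * (p₁ * kb + p₂ * kd) : ℤ) : ℂ)) / 2) =
      ((p₁ * (p₁ * kb + p₂ * kd) - (p₁ * ka + p₂ * kc) * p₂
        + 2 * M ^ 2 * (p₁ * ka + p₂ * kc) * (p₁ * kb + p₂ * kd)
        - M * (p₁ * ka + p₂ * kc) + M * (p₁ * kb + p₂ * kd) : ℤ) : ℂ) := by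
    push_cast; field_simp
  rw [this, expTwoPiI_intCast, one_mul]

/-! ### The Jacobi triple product -/

/-- The finite product `(1 - Q) (1 - Q²) ⋯ (1 - Qⁿ)`. -/
def qFactorial (Q : ℂ) (n : ℕ) : ℂ := ∏ i ∈ Finset.range n, (1 - Q ^ (i + 1))

lemma qFactorial_succ (Q : ℂ) (n : ℕ) :
    qFactorial Q (n + 1) = qFactorial Q n * (1 - Q ^ (n + 1)) := Finset.prod_range_succ _ _

lemma one_sub_pow_ne_zero {Q : ℂ} (hQ : ‖Q‖ < 1) (n : ℕ) : 1 - Q ^ (n + 1) ≠ 0 := by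
  intro h
  have h1 : ‖Q ^ (n + 1)‖ = 1 := by rw [← sub_eq_zero.1 h]; simp
  rw [norm_pow] at h1
  exact (pow_lt_one₀ (norm_nonneg _) hQ n.succ_ne_zero).ne h1

lemma qFactorial_ne_zero {Q : ℂ} (hQ : ‖Q‖ < 1) (n : ℕ) : qFactorial Q n ≠ 0 :=
  Finset.prod_ne_zero_iff.2 fun i _ => one_sub_pow_ne_zero hQ i

/-- The `q`-binomial theorem. -/
lemma prod_one_add_mul_pow {Q : ℂ} (hQ : ‖Q‖ < 1) (y : ℂ) (N : ℕ) :
    ∏ i ∈ Finset.range N, (1 + y * Q ^ i) = ∑ j ∈ Finset.range (N + 1),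
      qFactorial Q N / (qFactorial Q j * qFactorial Q (N - j)) * Q ^ (j.choose 2) * y ^ j := by
  have hne := qFactorial_ne_zero hQ
  induction N with
  | zero => simp [qFactorial]
  | succ N ih =>
    set c : ℕ → ℕ → ℂ := fun N j =>
      qFactorial Q N / (qFactorial Q j * qFactorial Q (N - j)) * Q ^ (j.choose 2) * y ^ j with hc
    -- Multiplying by `1 + y Q ^ N` amounts to Pascal's rule for the terms.
    have hmid : ∀ j ∈ Finset.range N, c (N + 1) (j + 1) = c N (j + 1) + c N j * (y * Q ^ N) := by
      intro j hj
      have hj' : j < N := Finset.mem_range.1 hj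
      obtain ⟨t, rfl⟩ : ∃ t, N = j + 1 + t := ⟨N - (j + 1), by omega⟩
      simp only [hc]
      rw [show j + 1 + t - (j + 1) = t by omega, show j + 1 + t - j = t + 1 by omega,
        show j + 1 + t + 1 - (j + 1) = t + 1 by omega, Nat.choose_succ_succ' j 1,
        Nat.choose_one_right, qFactorial_succ Q (j + 1 + t), qFactorial_succ Q t,
        qFactorial_succ Q j]
      have h1 := one_sub_pow_ne_zero hQ t
      have h2 := one_sub_pow_ne_zero hQ j
      have := hne t
      have := hne j
      field_simp
      ring
    have hbot : c (N + 1) 0 = c N 0 := by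
      simp only [hc, Nat.sub_zero]
      rw [mul_comm (qFactorial Q 0), mul_comm (qFactorial Q 0), ← div_div, ← div_div,
        div_self (hne _), div_self (hne _)]
    have htop : c (N + 1) (N + 1) = c N N * (y * Q ^ N) := by
      simp only [hc, Nat.sub_self]
      rw [← div_div, ← div_div, div_self (hne _), div_self (hne _), Nat.choose_succ_succ' N 1,
        Nat.choose_one_right]
      ring
    have e1 : ∑ j ∈ Finset.range (N + 1), c N j = ∑ j ∈ Finset.range N, c N (j + 1) + c N 0 :=
      Finset.sum_range_succ' _ _
    have e2 : ∑ j ∈ Finset.range (N + 1), c N j = ∑ j ∈ Finset.range N, c N j + c N N :=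
      Finset.sum_range_succ _ _
    have e3 : ∑ j ∈ Finset.range (N + 1 + 1), c (N + 1) j =
        ∑ j ∈ Finset.range N, c (N + 1) (j + 1) + c (N + 1) (N + 1) + c (N + 1) 0 := by
      rw [Finset.sum_range_succ', Finset.sum_range_succ]
    rw [Finset.sum_congr rfl hmid, Finset.sum_add_distrib, ← Finset.sum_mul, hbot, htop] at e3
    rw [Finset.prod_range_succ, ih, e3]
    linear_combination e1 + e2 * (y * Q ^ N)

/-- The symmetric form of the `q`-binomial theorem. -/
lemma prod_mul_prod_inv {p x : ℂ} (hp : ‖p‖ < 1) (hp0 : p ≠ 0) (hx : x ≠ 0) (n : ℕ) :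
    (∏ i ∈ Finset.range n, (1 + x * p ^ (2 * i + 1))) *
      ∏ i ∈ Finset.range n, (1 + x⁻¹ * p ^ (2 * i + 1)) =
    ∑ k ∈ Finset.Icc (-(n : ℤ)) n, qFactorial (p ^ 2) (2 * n) /
      (qFactorial (p ^ 2) (n + k).toNat * qFactorial (p ^ 2) (n - k).toNat) *
        (p ^ (k ^ 2) * x ^ k) := by
  have hQ : ‖p ^ 2‖ < 1 := by
    rw [norm_pow]; exact pow_lt_one₀ (norm_nonneg _) hp two_ne_zero
  -- Substituting `y = x p ^ (1 - 2 n)` and `Q = p²` makes the exponents of `p` run through the odd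
  -- numbers from `1 - 2 n` to `2 n - 1`.
  have h := prod_one_add_mul_pow hQ (x * p ^ (1 - 2 * (n : ℤ))) (2 * n)
  have hl : ∏ i ∈ Finset.range (2 * n), (1 + x * p ^ (1 - 2 * (n : ℤ)) * (p ^ 2) ^ i) =
      (x ^ n * p ^ (-(n : ℤ) ^ 2)) * ((∏ i ∈ Finset.range n, (1 + x * p ^ (2 * i + 1))) *
      ∏ i ∈ Finset.range n, (1 + x⁻¹ * p ^ (2 * i + 1))) := by
    have hpow : ∀ m : ℕ, ∏ i ∈ Finset.range m, (x * p ^ (-(2 * i + 1) : ℤ)) =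
        x ^ m * p ^ (-(m : ℤ) ^ 2) := by
      intro m
      induction m with
      | zero => simp
      | succ m ih =>
        rw [Finset.prod_range_succ, ih, mul_mul_mul_comm, ← pow_succ, ← zpow_add₀ hp0]
        congr 2
        push_cast
        ring
    have h1 : ∏ i ∈ Finset.range n, (1 + x * p ^ (1 - 2 * (n : ℤ)) * (p ^ 2) ^ i) =
        (x ^ n * p ^ (-(n : ℤ) ^ 2)) * ∏ i ∈ Finset.range n, (1 + x⁻¹ * p ^ (2 * i + 1)) := by
      rw [← hpow, ← Finset.prod_mul_distrib, ← Finset.prod_range_reflect]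
      refine Finset.prod_congr rfl fun i hi => ?_
      have hi' : i < n := Finset.mem_range.1 hi
      have e : ((n - 1 - i : ℕ) : ℤ) = n - 1 - i := by omega
      rw [← pow_mul, ← zpow_natCast p (2 * (n - 1 - i)), mul_assoc, ← zpow_add₀ hp0, mul_add,
        mul_one, show x * p ^ (-(2 * i + 1) : ℤ) * (x⁻¹ * p ^ (2 * i + 1)) =
          (x * x⁻¹) * (p ^ (-(2 * i + 1) : ℤ) * p ^ ((2 * i + 1 : ℕ) : ℤ)) by
          rw [zpow_natCast]; ring, mul_inv_cancel₀ hx, ← zpow_add₀ hp0]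
      push_cast [e]
      rw [add_comm, show -(2 * (i : ℤ) + 1) + (2 * i + 1) = 0 by ring]
      congr 1
      · congr 2; ring
      · simp
    have h2 : ∏ i ∈ Finset.range n, (1 + x * p ^ (1 - 2 * (n : ℤ)) * (p ^ 2) ^ (n + i)) =
        ∏ i ∈ Finset.range n, (1 + x * p ^ (2 * i + 1)) := by
      refine Finset.prod_congr rfl fun i hi => ?_
      rw [← pow_mul, mul_assoc, ← zpow_natCast p (2 * (n + i)), ← zpow_add₀ hp0, ← zpow_natCast]
      congr 3
      push_cast
      ring
    rw [two_mul, Finset.prod_range_add, h1, h2]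
    ring
  have hr : ∑ j ∈ Finset.range (2 * n + 1),
      qFactorial (p ^ 2) (2 * n) / (qFactorial (p ^ 2) j * qFactorial (p ^ 2) (2 * n - j)) *
        (p ^ 2) ^ (j.choose 2) * (x * p ^ (1 - 2 * (n : ℤ))) ^ j = (x ^ n * p ^ (-(n : ℤ) ^ 2)) *
      ∑ k ∈ Finset.Icc (-(n : ℤ)) n, qFactorial (p ^ 2) (2 * n) /
      (qFactorial (p ^ 2) (n + k).toNat * qFactorial (p ^ 2) (n - k).toNat) *
        (p ^ (k ^ 2) * x ^ k) := by
    rw [Finset.mul_sum]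
    refine Finset.sum_nbij' (fun j => (j : ℤ) - n) (fun k => (n + k).toNat) ?_ ?_ ?_ ?_ ?_
    · intro j hj
      simp only [Finset.mem_range, Finset.mem_Icc] at hj ⊢
      omega
    · intro k hk
      simp only [Finset.mem_range, Finset.mem_Icc] at hk ⊢
      omega
    · intro j hj
      simp
    · intro k hk
      simp only [Finset.mem_Icc] at hk
      omega
    · intro j hj
      simp only [Finset.mem_range] at hj
      have e : ((j.choose 2 : ℕ) : ℤ) * 2 = j * (j - 1) := by
        have := Nat.cast_choose_two ℚ j
        have h2 : ((j.choose 2 : ℕ) : ℚ) * 2 = j * (j - 1) := by rw [this]; ring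
        exact_mod_cast h2
      rw [show (n + ((j : ℤ) - n)).toNat = j by omega,
        show (n - ((j : ℤ) - n)).toNat = 2 * n - j by omega, mul_pow, ← pow_mul,
        ← zpow_natCast p (2 * j.choose 2), ← zpow_natCast (p ^ (1 - 2 * (n : ℤ))), ← zpow_mul,
        zpow_sub₀ hx, zpow_natCast x, zpow_natCast x]
      have hxn : x ^ n * (x ^ j / x ^ n) = x ^ j := mul_div_cancel₀ _ (pow_ne_zero _ hx)
      have e2 : p ^ ((2 * j.choose 2 : ℕ) : ℤ) * p ^ ((1 - 2 * (n : ℤ)) * j) =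
          p ^ (-(n : ℤ) ^ 2) * p ^ ((j - n : ℤ) ^ 2) := by
        rw [← zpow_add₀ hp0, ← zpow_add₀ hp0]
        congr 1
        push_cast
        linear_combination e
      set A := qFactorial (p ^ 2) (2 * n) / (qFactorial (p ^ 2) j * qFactorial (p ^ 2) (2 * n - j))
      linear_combination A * x ^ j * e2 - A * p ^ (-(n : ℤ) ^ 2) * p ^ ((j - n : ℤ) ^ 2) * hxn
  rw [hl, hr] at h
  exact mul_left_cancel₀ (mul_ne_zero (pow_ne_zero _ hx) (zpow_ne_zero _ hp0)) h

lemma tendsto_qFactorial {Q : ℂ} (hQ : ‖Q‖ < 1) :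
    Filter.Tendsto (qFactorial Q) Filter.atTop (𝓝 (∏' n : ℕ, (1 - Q ^ (n + 1)))) :=
  (ModularForm.multipliable_one_sub_pow hQ).hasProd.tendsto_prod_nat

lemma tprod_one_sub_pow_ne_zero {Q : ℂ} (hQ : ‖Q‖ < 1) : ∏' n : ℕ, (1 - Q ^ (n + 1)) ≠ 0 := by
  simp only [sub_eq_add_neg]
  refine tprod_one_add_ne_zero_of_summable (f := fun n => -Q ^ (n + 1)) (fun n => ?_) ?_
  · simpa [sub_eq_add_neg] using one_sub_pow_ne_zero hQ n
  · simpa using (summable_nat_add_iff 1).2 (summable_geometric_of_lt_one (norm_nonneg _) hQ)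

lemma multipliable_one_add_mul_odd_pow {p : ℂ} (hp : ‖p‖ < 1) (x : ℂ) :
    Multipliable fun n : ℕ => 1 + x * p ^ (2 * n + 1) := by
  apply multipliable_one_add_of_summable
  simp only [norm_mul, norm_pow]
  refine Summable.mul_left _ ?_
  have := summable_geometric_of_lt_one (norm_nonneg p) hp
  exact this.comp_injective (i := fun n : ℕ => 2 * n + 1) fun a b h => by simpa using h

/-- The Jacobi triple product identity. -/
theorem tsum_pow_sq_mul_zpow {p x : ℂ} (hp : ‖p‖ < 1) (hp0 : p ≠ 0) (hx : x ≠ 0)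
    (hs : Summable fun k : ℤ => p ^ (k ^ 2) * x ^ k) :
    ∑' k : ℤ, p ^ (k ^ 2) * x ^ k = (∏' n : ℕ, (1 - (p ^ 2) ^ (n + 1))) *
      ((∏' n : ℕ, (1 + x * p ^ (2 * n + 1))) * ∏' n : ℕ, (1 + x⁻¹ * p ^ (2 * n + 1))) := by
  have hQ : ‖p ^ 2‖ < 1 := by
    rw [norm_pow]; exact pow_lt_one₀ (norm_nonneg _) hp two_ne_zero
  have hG := tendsto_qFactorial hQ
  have hG0 := tprod_one_sub_pow_ne_zero hQ
  set G := ∏' n : ℕ, (1 - (p ^ 2) ^ (n + 1))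
  have hleft := ((multipliable_one_add_mul_odd_pow hp x).hasProd.tendsto_prod_nat).mul
    ((multipliable_one_add_mul_odd_pow hp x⁻¹).hasProd.tendsto_prod_nat)
  obtain ⟨B, hB⟩ := hG.norm.bddAbove_range
  obtain ⟨B', hB'⟩ := (hG.inv₀ hG0).norm.bddAbove_range
  have hB : ∀ n, ‖qFactorial (p ^ 2) n‖ ≤ B := fun n => hB ⟨n, rfl⟩
  have hB' : ∀ n, ‖(qFactorial (p ^ 2) n)⁻¹‖ ≤ B' := fun n => hB' ⟨n, rfl⟩
  have hB0 : 0 ≤ B := (norm_nonneg _).trans (hB 0)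
  have hB0' : 0 ≤ B' := (norm_nonneg _).trans (hB' 0)
  -- The identity is the limit of its finite form, by dominated convergence.
  let F : ℕ → ℤ → ℂ := fun n k => if k ∈ Finset.Icc (-(n : ℤ)) n then
    qFactorial (p ^ 2) (2 * n) /
      (qFactorial (p ^ 2) (n + k).toNat * qFactorial (p ^ 2) (n - k).toNat) *
        (p ^ (k ^ 2) * x ^ k) else 0
  have hright : Filter.Tendsto (fun n => ∑' k, F n k) Filter.atTop
      (𝓝 (∑' k : ℤ, G / (G * G) * (p ^ (k ^ 2) * x ^ k))) := by
    refine tendsto_tsum_of_dominated_convergence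
      (bound := fun k : ℤ => B * (B' * B') * ‖p ^ (k ^ 2) * x ^ k‖) (hs.norm.mul_left _) ?_ ?_
    · intro k
      have t1 : Filter.Tendsto (fun n : ℕ => 2 * n) Filter.atTop Filter.atTop :=
        Filter.tendsto_id.const_mul_atTop' (by norm_num)
      have t2 : ∀ k : ℤ, Filter.Tendsto (fun n : ℕ => (n + k).toNat) Filter.atTop Filter.atTop := by
        intro k
        refine Filter.tendsto_atTop.2 fun b => ?_
        filter_upwards [Filter.eventually_ge_atTop (b + k.natAbs)] with n hn
        omega
      have := ((hG.comp t1).div ((hG.comp (t2 k)).mul (hG.comp (t2 (-k))))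
        (mul_ne_zero hG0 hG0)).mul_const (p ^ (k ^ 2) * x ^ k)
      refine this.congr' ?_
      filter_upwards [Filter.eventually_ge_atTop k.natAbs] with n hn
      have : k ∈ Finset.Icc (-(n : ℤ)) n := by rw [Finset.mem_Icc]; omega
      simp only [F, if_pos this, sub_eq_add_neg]
      rfl
    · refine Filter.Eventually.of_forall fun n k => ?_
      simp only [F]
      split_ifs with h
      · rw [norm_mul, div_eq_mul_inv, mul_inv, norm_mul, norm_mul]
        gcongr
        exacts [hB _, hB' _, hB' _]
      · rw [norm_zero]; positivity
  have heq : ∀ n : ℕ, (∏ i ∈ Finset.range n, (1 + x * p ^ (2 * i + 1))) *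
      ∏ i ∈ Finset.range n, (1 + x⁻¹ * p ^ (2 * i + 1)) = ∑' k, F n k := by
    intro n
    rw [prod_mul_prod_inv hp hp0 hx, tsum_eq_sum (s := Finset.Icc (-(n : ℤ)) n)]
    · exact Finset.sum_congr rfl fun k hk => by simp only [F, if_pos hk]
    · intro k hk
      simp only [F, if_neg hk]
  have := tendsto_nhds_unique (hleft.congr heq) hright
  rw [this, tsum_mul_left, ← mul_assoc, div_mul_cancel_left₀ hG0, mul_inv_cancel₀ hG0, one_mul]

/-- The product expansion of the two-variable theta function. -/
lemma jacobiTheta₂_eq_tprod (z : ℂ) {τ : ℂ} (hτ : 0 < τ.im) :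
    jacobiTheta₂ z τ = (∏' n : ℕ, (1 - expTwoPiI τ ^ (n + 1))) *
      ((∏' n : ℕ, (1 + expTwoPiI z * expTwoPiI (τ / 2) ^ (2 * n + 1))) *
        ∏' n : ℕ, (1 + expTwoPiI (-z) * expTwoPiI (τ / 2) ^ (2 * n + 1))) := by
  have hp : ‖expTwoPiI (τ / 2)‖ < 1 := by
    rw [norm_expTwoPiI, Real.exp_lt_one_iff]
    have : (τ / 2).im = τ.im / 2 := by simp
    rw [this]
    have := Real.pi_pos
    have : 0 < 2 * Real.pi * (τ.im / 2) := by positivity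
    linarith
  have hz : ∀ (y : ℂ) (k : ℤ), expTwoPiI y ^ k = expTwoPiI (k * y) := by
    intro y k
    rw [expTwoPiI, expTwoPiI, ← Complex.exp_int_mul]; ring_nf
  have hterm : ∀ k : ℤ, expTwoPiI (τ / 2) ^ (k ^ 2) * expTwoPiI z ^ k =
      jacobiTheta₂_term k z τ := by
    intro k
    rw [jacobiTheta₂_term_eq, hz, hz, ← expTwoPiI_add]
    congr 1
    push_cast
    ring
  have h := tsum_pow_sq_mul_zpow hp (expTwoPiI_ne_zero _) (expTwoPiI_ne_zero z)
    (by simpa only [hterm] using (summable_jacobiTheta₂_term_iff z τ).2 hτ)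
  rw [jacobiTheta₂, ← tsum_congr hterm, h, expTwoPiI_neg, expTwoPiI_pow,
    show ((2 : ℕ) : ℂ) * (τ / 2) = τ by push_cast; ring]

/-! ### Functions invariant under a principal congruence subgroup -/

lemma Gamma_le_of_dvd {M N : ℕ} (h : M ∣ N) :
    CongruenceSubgroup.Gamma N ≤ CongruenceSubgroup.Gamma M := by
  intro γ hγ
  rw [CongruenceSubgroup.Gamma_mem] at hγ ⊢
  have key : ∀ x : ℤ, ∀ y : ℤ, (x : ZMod N) = y → (x : ZMod M) = y := by
    intro x y hxy
    rw [ZMod.intCast_eq_intCast_iff_dvd_sub] at hxy ⊢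
    exact (Int.natCast_dvd_natCast.2 h).trans hxy
  refine ⟨by simpa using key _ 1 (by simpa using hγ.1), by simpa using key _ 0 (by simpa using hγ.2.1),
    by simpa using key _ 0 (by simpa using hγ.2.2.1), by simpa using key _ 1 (by simpa using hγ.2.2.2)⟩

namespace IsLevelInvariant

variable {f g : ℂ → ℂ}

lemma congr (hf : IsLevelInvariant f) (h : ∀ z : ℂ, 0 < z.im → g z = f z) :
    IsLevelInvariant g := by
  obtain ⟨N, hN, hf⟩ := hf
  refine ⟨N, hN, fun γ hγ z => ?_⟩
  rw [h _ (γ • z).im_pos, h _ z.im_pos, hf γ hγ z]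

lemma const (c : ℂ) : IsLevelInvariant fun _ => c := ⟨1, one_pos, fun _ _ _ => rfl⟩

/-- Any pointwise operation preserves invariance, the levels being multiplied. -/
lemma map₂ (F : ℂ → ℂ → ℂ) (hf : IsLevelInvariant f) (hg : IsLevelInvariant g) :
    IsLevelInvariant fun z => F (f z) (g z) := by
  obtain ⟨M, hM, hf⟩ := hf
  obtain ⟨N, hN, hg⟩ := hg
  refine ⟨M * N, by positivity, fun γ hγ z => ?_⟩
  beta_reduce
  rw [hf γ (Gamma_le_of_dvd (dvd_mul_right _ _) hγ), hg γ (Gamma_le_of_dvd (dvd_mul_left _ _) hγ)]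

lemma mul (hf : IsLevelInvariant f) (hg : IsLevelInvariant g) :
    IsLevelInvariant fun z => f z * g z := hf.map₂ (· * ·) hg

lemma div (hf : IsLevelInvariant f) (hg : IsLevelInvariant g) :
    IsLevelInvariant fun z => f z / g z := hf.map₂ (· / ·) hg

lemma add (hf : IsLevelInvariant f) (hg : IsLevelInvariant g) :
    IsLevelInvariant fun z => f z + g z := hf.map₂ (· + ·) hg

lemma prod {ι : Type*} (s : Finset ι) {f : ι → ℂ → ℂ} (hf : ∀ i ∈ s, IsLevelInvariant (f i)) :
    IsLevelInvariant fun z => ∏ i ∈ s, f i z := by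
  classical
  induction s using Finset.induction_on with
  | empty => simpa using const 1
  | insert i s hi ih =>
    simp only [Finset.prod_insert hi]
    exact (hf i (Finset.mem_insert_self i s)).mul
      (ih fun j hj => hf j (Finset.mem_insert_of_mem hj))

lemma sum {ι : Type*} (s : Finset ι) {f : ι → ℂ → ℂ} (hf : ∀ i ∈ s, IsLevelInvariant (f i)) :
    IsLevelInvariant fun z => ∑ i ∈ s, f i z := by
  classical
  induction s using Finset.induction_on with
  | empty => simpa using const 0
  | insert i s hi ih =>
    simp only [Finset.sum_insert hi]
    exact (hf i (Finset.mem_insert_self i s)).add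
      (ih fun j hj => hf j (Finset.mem_insert_of_mem hj))

/-- Conjugation by `diag(l, 1)` maps `Γ(N l)` into `Γ(N)`. -/
lemma comp_mul (hf : IsLevelInvariant f) {l : ℕ} (hl : 0 < l) :
    IsLevelInvariant fun z => f (l * z) := by
  obtain ⟨N, hN, hf⟩ := hf
  refine ⟨N * l, by positivity, fun γ hγ z => ?_⟩
  have hlC : (l : ℂ) ≠ 0 := by exact_mod_cast hl.ne'
  have hγ' := Gamma_le_of_dvd (dvd_mul_right N l) hγ
  rw [CongruenceSubgroup.Gamma_mem] at hγ hγ'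
  obtain ⟨c', hc'⟩ : ((N * l : ℕ) : ℤ) ∣ γ 1 0 := by
    rw [← ZMod.intCast_zmod_eq_zero_iff_dvd]; exact hγ.2.2.1
  have hdet := γ.det_coe
  rw [Matrix.det_fin_two] at hdet
  push_cast at hc'
  let δ : SL(2, ℤ) := ⟨!![γ 0 0, l * γ 0 1; N * c', γ 1 1], by
    rw [Matrix.det_fin_two_of]; rw [hc'] at hdet; linear_combination hdet⟩
  have hδ : δ ∈ CongruenceSubgroup.Gamma N := by
    rw [CongruenceSubgroup.Gamma_mem]
    refine ⟨hγ'.1, ?_, ?_, hγ'.2.2.2⟩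
    · change ((l * γ 0 1 : ℤ) : ZMod N) = 0
      rw [Int.cast_mul, hγ'.2.1, mul_zero]
    · change ((N * c' : ℤ) : ZMod N) = 0
      simp
  let w : ℍ := ⟨l * z, by simpa using mul_pos (Nat.cast_pos.2 hl) z.im_pos⟩
  have hw : ((δ • w : ℍ) : ℂ) = l * ((γ • z : ℍ) : ℂ) := by
    rw [UpperHalfPlane.coe_specialLinearGroup_apply, UpperHalfPlane.coe_specialLinearGroup_apply]
    change (((γ 0 0 : ℤ) : ℝ) * (l * (z : ℂ)) + (((l * γ 0 1 : ℤ) : ℝ) : ℂ)) /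
      ((((N * c' : ℤ) : ℝ) : ℂ) * (l * (z : ℂ)) + (((γ 1 1 : ℤ) : ℝ) : ℂ)) = _
    rw [hc', ← mul_div_assoc]
    congr 1
    · push_cast; simp; ring
    · push_cast; simp; ring
  have := hf δ hδ w
  rw [hw] at this
  exact this

/-- Conjugation by `diag(1, l)` maps `Γ(N l)` into `Γ(N)`. -/
lemma comp_div (hf : IsLevelInvariant f) {l : ℕ} (hl : 0 < l) :
    IsLevelInvariant fun z => f (z / l) := by
  obtain ⟨N, hN, hf⟩ := hf
  refine ⟨N * l, by positivity, fun γ hγ z => ?_⟩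
  have hlC : (l : ℂ) ≠ 0 := by exact_mod_cast hl.ne'
  have hγ' := Gamma_le_of_dvd (dvd_mul_right N l) hγ
  rw [CongruenceSubgroup.Gamma_mem] at hγ hγ'
  obtain ⟨c', hc'⟩ : ((N * l : ℕ) : ℤ) ∣ γ 0 1 := by
    rw [← ZMod.intCast_zmod_eq_zero_iff_dvd]; exact hγ.2.1
  have hdet := γ.det_coe
  rw [Matrix.det_fin_two] at hdet
  push_cast at hc'
  let δ : SL(2, ℤ) := ⟨!![γ 0 0, N * c'; l * γ 1 0, γ 1 1], by
    rw [Matrix.det_fin_two_of]; rw [hc'] at hdet; linear_combination hdet⟩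
  have hδ : δ ∈ CongruenceSubgroup.Gamma N := by
    rw [CongruenceSubgroup.Gamma_mem]
    refine ⟨hγ'.1, ?_, ?_, hγ'.2.2.2⟩
    · change ((N * c' : ℤ) : ZMod N) = 0
      simp
    · change ((l * γ 1 0 : ℤ) : ZMod N) = 0
      rw [Int.cast_mul, hγ'.2.2.1, mul_zero]
  let w : ℍ := ⟨z / l, by
    rw [Complex.div_natCast_im]; exact div_pos z.im_pos (Nat.cast_pos.2 hl)⟩
  have hw : ((δ • w : ℍ) : ℂ) = ((γ • z : ℍ) : ℂ) / l := by
    rw [UpperHalfPlane.coe_specialLinearGroup_apply, UpperHalfPlane.coe_specialLinearGroup_apply]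
    change (((γ 0 0 : ℤ) : ℝ) * ((z : ℂ) / l) + (((N * c' : ℤ) : ℝ) : ℂ)) /
      ((((l * γ 1 0 : ℤ) : ℝ) : ℂ) * ((z : ℂ) / l) + (((γ 1 1 : ℤ) : ℝ) : ℂ)) = _
    rw [hc', div_right_comm]
    congr 1
    · push_cast; simp; field_simp
    · push_cast; simp; field_simp
  have := hf δ hδ w
  rw [hw] at this
  exact this

end IsLevelInvariant

/-! ### Quotients of eta functions -/

lemma norm_expTwoPiI_lt_one {z : ℂ} (hz : 0 < z.im) : ‖expTwoPiI z‖ < 1 := by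
  rw [norm_expTwoPiI, Real.exp_lt_one_iff]
  have : 0 < 2 * Real.pi * z.im := by positivity
  linarith

/-- The dehomogenized factorization of `Xⁿ - 1` in terms of a primitive root of unity. -/
lemma prod_one_sub_pow_mul {ξ : ℂ} {n : ℕ} (hξ : IsPrimitiveRoot ξ n) (hn : 0 < n) (X : ℂ) :
    ∏ j ∈ Finset.range n, (1 - ξ ^ j * X) = 1 - X ^ n := by
  have h := X_pow_sub_C_eq_prod hξ hn (α := X) (a := X ^ n) rfl
  have := congrArg (Polynomial.eval 1) h
  rw [Polynomial.eval_prod] at this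
  simpa using this.symm

/-- The roots of `X²ˡ - 1` other than `±1` come in pairs of inverses. -/
lemma prod_pairs_mul {ξ : ℂ} {l : ℕ} (hξ : IsPrimitiveRoot ξ (2 * l)) (hl : 0 < l) (X : ℂ) :
    (∏ j ∈ Finset.range (l - 1), (1 - ξ ^ (j + 1) * X) * (1 - (ξ ^ (j + 1))⁻¹ * X)) *
      (1 - X ^ 2) = 1 - X ^ (2 * l) := by
  obtain ⟨m, rfl⟩ : ∃ m, l = m + 1 := ⟨l - 1, by omega⟩
  have h := prod_one_sub_pow_mul hξ (by omega) X
  have hpow : ξ ^ (m + 1) = -1 := by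
    have h2 : (ξ ^ (m + 1)) ^ 2 = 1 := by rw [← pow_mul, mul_comm]; exact hξ.pow_eq_one
    rcases mul_self_eq_one_iff.1 ((sq _).symm.trans h2) with h | h
    · have := Nat.le_of_dvd (by omega) (hξ.dvd_of_pow_eq_one _ h)
      omega
    · exact h
  rw [← h, show 2 * (m + 1) = 1 + m + 1 + m by ring, Finset.prod_range_add, Finset.prod_range_succ,
    Finset.prod_range_add, Nat.add_sub_cancel, Finset.prod_mul_distrib]
  have e2 : ∏ x ∈ Finset.range m, (1 - ξ ^ (1 + m + 1 + x) * X) =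
      ∏ j ∈ Finset.range m, (1 - (ξ ^ (j + 1))⁻¹ * X) := by
    rw [← Finset.prod_range_reflect]
    refine Finset.prod_congr rfl fun j hj => ?_
    have hj' := Finset.mem_range.1 hj
    congr 2
    refine eq_inv_of_mul_eq_one_left ?_
    rw [← pow_add, show 1 + m + 1 + (m - 1 - j) + (j + 1) = 2 * (m + 1) by omega, hξ.pow_eq_one]
  have e1 : ∏ x ∈ Finset.range m, (1 - ξ ^ (1 + x) * X) =
      ∏ j ∈ Finset.range m, (1 - ξ ^ (j + 1) * X) :=
    Finset.prod_congr rfl fun j _ => by rw [add_comm]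
  rw [e1, e2, add_comm 1 m, hpow]
  simp
  ring

lemma eta_eq_tprod (τ : ℂ) : ModularForm.eta τ =
    expTwoPiI (τ / 24) * ∏' n : ℕ, (1 - expTwoPiI τ ^ (n + 1)) := by
  rw [ModularForm.eta]
  congr 1
  · rw [Function.Periodic.qParam, expTwoPiI]; push_cast; congr 1; ring
  · simp [ModularForm.eta_q_eq_pow, expTwoPiI]

lemma multipliable_one_sub_mul_pow {Q : ℂ} (hQ : ‖Q‖ < 1) (x : ℂ) :
    Multipliable fun n : ℕ => 1 - x * Q ^ (n + 1) := by
  simp only [sub_eq_add_neg]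
  apply multipliable_one_add_of_summable
  simp only [norm_neg, norm_mul, norm_pow]
  exact ((summable_nat_add_iff 1).2 (summable_geometric_of_lt_one (norm_nonneg _) hQ)).mul_left _

/-- The product expansion of the Siegel functions with `r₁ = 0`. -/
lemma siegelFn_zero_eq_tprod (r : ℂ) {τ : ℂ} (hτ : 0 < τ.im) :
    siegelFn 0 r τ = expTwoPiI (1 / 4 + r / 2) * (1 - (expTwoPiI r)⁻¹) * expTwoPiI (τ / 12) *
      ((∏' n : ℕ, (1 - expTwoPiI r * expTwoPiI τ ^ (n + 1))) *
        ∏' n : ℕ, (1 - (expTwoPiI r)⁻¹ * expTwoPiI τ ^ (n + 1))) := by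
  have hQ := norm_expTwoPiI_lt_one hτ
  have hG := tprod_one_sub_pow_ne_zero hQ
  have h1 : ∀ n : ℕ, 1 + expTwoPiI (1 / 2 + r + (1 / 2 + 0) * τ) * expTwoPiI (τ / 2) ^ (2 * n + 1) =
      1 - expTwoPiI r * expTwoPiI τ ^ (n + 1) := by
    intro n
    have e : expTwoPiI (1 / 2 + r + (1 / 2 + 0) * τ) * expTwoPiI (τ / 2) ^ (2 * n + 1) =
        expTwoPiI (-(1 / 2)) * (expTwoPiI r * expTwoPiI τ ^ (n + 1)) := by
      rw [expTwoPiI_pow, expTwoPiI_pow, ← expTwoPiI_add, ← expTwoPiI_add, ← expTwoPiI_add,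
        ← expTwoPiI_add_intCast (-(1 / 2) + _) 1]
      congr 1
      push_cast
      ring
    rw [e, expTwoPiI_neg_half]
    ring
  have h2 : ∀ n : ℕ, 1 + expTwoPiI (-(1 / 2 + r + (1 / 2 + 0) * τ)) *
      expTwoPiI (τ / 2) ^ (2 * n + 1) = 1 - (expTwoPiI r)⁻¹ * expTwoPiI τ ^ n := by
    intro n
    have e : expTwoPiI (-(1 / 2 + r + (1 / 2 + 0) * τ)) * expTwoPiI (τ / 2) ^ (2 * n + 1) =
        expTwoPiI (-(1 / 2)) * (expTwoPiI (-r) * expTwoPiI τ ^ n) := by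
      rw [expTwoPiI_pow, expTwoPiI_pow, ← expTwoPiI_add, ← expTwoPiI_add, ← expTwoPiI_add]
      congr 1
      push_cast
      ring
    rw [e, expTwoPiI_neg_half, expTwoPiI_neg]
    ring
  have h3 : ∏' n : ℕ, (1 - (expTwoPiI r)⁻¹ * expTwoPiI τ ^ n) = (1 - (expTwoPiI r)⁻¹) *
      ∏' n : ℕ, (1 - (expTwoPiI r)⁻¹ * expTwoPiI τ ^ (n + 1)) := by
    have := tprod_eq_zero_mul' (f := fun n : ℕ => 1 - (expTwoPiI r)⁻¹ * expTwoPiI τ ^ n)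
      (multipliable_one_sub_mul_pow hQ _)
    rwa [pow_zero, mul_one] at this
  rw [siegelFn, charTheta, jacobiTheta₂_eq_tprod _ hτ, tprod_congr h1, tprod_congr h2, h3,
    eta_eq_tprod, div_eq_iff (mul_ne_zero (expTwoPiI_ne_zero _) hG)]
  have e : expTwoPiI (-(0 * (r + 1) / 2) + τ * (1 / 2 + 0) ^ 2 / 2 + (1 / 2 + 0) * (1 / 2 + r)) =
      expTwoPiI (1 / 4 + r / 2) * expTwoPiI (τ / 12) * expTwoPiI (τ / 24) := by
    rw [← expTwoPiI_add, ← expTwoPiI_add]; congr 1; ring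
  rw [e]
  ring

/-- For `0 < j < l` the Siegel functions of characteristic `(0, j/2l)` multiply to a constant
multiple of `η(2lτ)/η(2τ)`. -/
lemma exists_prod_siegelFn_eq {l : ℕ} (hl : 0 < l) : ∃ c : ℂ, ∀ τ : ℂ, 0 < τ.im →
    ModularForm.eta (2 * l * τ) / ModularForm.eta (2 * τ) =
      c * ∏ j ∈ Finset.range (l - 1), siegelFn 0 ((j + 1 : ℕ) / (2 * l : ℕ)) τ := by
  have hξ : IsPrimitiveRoot (expTwoPiI (1 / (2 * l : ℕ))) (2 * l) := by
    have := Complex.isPrimitiveRoot_exp (2 * l) (by omega)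
    rwa [← mul_one_div] at this
  set ξ := expTwoPiI (1 / (2 * l : ℕ)) with hξdef
  have hξj : ∀ j : ℕ, expTwoPiI ((j + 1 : ℕ) / (2 * l : ℕ)) = ξ ^ (j + 1) := by
    intro j
    rw [hξdef, expTwoPiI_pow, mul_one_div]
  set k : ℕ → ℂ := fun j => expTwoPiI (1 / 4 + (j + 1 : ℕ) / (2 * l : ℕ) / 2) *
    (1 - (ξ ^ (j + 1))⁻¹) with hk
  have hk0 : ∏ j ∈ Finset.range (l - 1), k j ≠ 0 := by
    refine Finset.prod_ne_zero_iff.2 fun j hj => mul_ne_zero (expTwoPiI_ne_zero _) ?_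
    rw [sub_ne_zero, ne_comm, Ne, inv_eq_one]
    have := Finset.mem_range.1 hj
    exact hξ.pow_ne_one_of_pos_of_lt (by omega) (by omega)
  refine ⟨(∏ j ∈ Finset.range (l - 1), k j)⁻¹, fun τ hτ => ?_⟩
  have hQ := norm_expTwoPiI_lt_one hτ
  have h2τ : 0 < (2 * τ).im := by simpa using hτ
  have hm := multipliable_one_sub_mul_pow hQ
  have hmQ : ∀ m : ℕ, 0 < m → ‖expTwoPiI τ ^ m‖ < 1 := fun m hm => by
    rw [norm_pow]; exact pow_lt_one₀ (norm_nonneg _) hQ hm.ne'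
  have hmain : (∏ j ∈ Finset.range (l - 1),
      ((∏' n : ℕ, (1 - ξ ^ (j + 1) * expTwoPiI τ ^ (n + 1))) *
        ∏' n : ℕ, (1 - (ξ ^ (j + 1))⁻¹ * expTwoPiI τ ^ (n + 1)))) *
      ∏' n : ℕ, (1 - (expTwoPiI τ ^ 2) ^ (n + 1)) =
      ∏' n : ℕ, (1 - (expTwoPiI τ ^ (2 * l)) ^ (n + 1)) := by
    have hpair : ∀ j ∈ Finset.range (l - 1), Multipliable fun n : ℕ =>
        (1 - ξ ^ (j + 1) * expTwoPiI τ ^ (n + 1)) * (1 - (ξ ^ (j + 1))⁻¹ * expTwoPiI τ ^ (n + 1)) :=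
      fun j _ => (hm _).mul (hm _)
    simp only [← (hm _).tprod_mul (hm _)]
    rw [← Multipliable.tprod_finsetProd hpair, ← Multipliable.tprod_mul
      (multipliable_prod hpair) (ModularForm.multipliable_one_sub_pow (hmQ 2 two_pos))]
    refine tprod_congr fun n => ?_
    have := prod_pairs_mul hξ hl (expTwoPiI τ ^ (n + 1))
    rw [← pow_mul, ← pow_mul, mul_comm 2, mul_comm (2 * l), pow_mul, pow_mul]
    exact this
  have hs : ∏ j ∈ Finset.range (l - 1), siegelFn 0 ((j + 1 : ℕ) / (2 * l : ℕ)) τ =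
      (∏ j ∈ Finset.range (l - 1), k j) * expTwoPiI (τ / 12) ^ (l - 1) *
      ∏ j ∈ Finset.range (l - 1),
      ((∏' n : ℕ, (1 - ξ ^ (j + 1) * expTwoPiI τ ^ (n + 1))) *
        ∏' n : ℕ, (1 - (ξ ^ (j + 1))⁻¹ * expTwoPiI τ ^ (n + 1))) := by
    rw [Finset.prod_congr rfl fun j _ => siegelFn_zero_eq_tprod _ hτ]
    simp only [hξj]
    rw [Finset.prod_mul_distrib, Finset.prod_mul_distrib, Finset.prod_const, Finset.card_range]
  rw [hs, ← mul_assoc, ← mul_assoc, inv_mul_cancel₀ hk0, one_mul,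
    div_eq_iff (ModularForm.eta_ne_zero h2τ), eta_eq_tprod (2 * τ), eta_eq_tprod (2 * l * τ)]
  have e1 : expTwoPiI (2 * τ) = expTwoPiI τ ^ 2 := by rw [expTwoPiI_pow]; norm_num
  have e2 : expTwoPiI (2 * l * τ) = expTwoPiI τ ^ (2 * l) := by rw [expTwoPiI_pow]; push_cast; rfl
  have e3 : expTwoPiI (2 * l * τ / 24) = expTwoPiI (τ / 12) ^ (l - 1) * expTwoPiI (2 * τ / 24) := by
    rw [expTwoPiI_pow, ← expTwoPiI_add, Nat.cast_sub hl]; congr 1; push_cast; ring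
  rw [e1, e2, e3, ← hmain]
  ring

/-- Quotients of eta functions of equal weight are invariant under a principal congruence subgroup.
The argument is halved because the Siegel functions of characteristic `j / 2l` produce
`η(2lτ)/η(2τ)`. -/
lemma isLevelInvariant_eta_div {l : ℕ} (hl : 0 < l) :
    IsLevelInvariant fun z => ModularForm.eta (l * z) / ModularForm.eta z := by
  obtain ⟨c, h⟩ := exists_prod_siegelFn_eq hl
  have h1 : IsLevelInvariant fun z =>
      c * ∏ j ∈ Finset.range (l - 1), siegelFn 0 ((j + 1 : ℕ) / (2 * l : ℕ)) z := by
    refine (IsLevelInvariant.const c).mul (IsLevelInvariant.prod _ fun j _ => ?_)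
    have := isLevelInvariant_siegelFn 0 (j + 1 : ℕ) (M := 2 * l) (by omega)
    simpa using this
  refine (h1.comp_div (l := 2) two_pos).congr fun z hz => ?_
  have hz' : 0 < (z / (2 : ℕ)).im := by rw [Complex.div_natCast_im]; positivity
  rw [← h _ hz']
  congr 2 <;> push_cast <;> ring

/-! ### Sums over integer vectors -/

lemma summable_norm_prod_and_tsum_fin (n : ℕ) (g : Fin n → ℤ → ℂ)
    (hg : ∀ i, Summable fun m => ‖g i m‖) :
    (Summable fun x : Fin n → ℤ => ‖∏ i, g i (x i)‖) ∧
      ∑' x : Fin n → ℤ, ∏ i, g i (x i) = ∏ i, ∑' m, g i m := by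
  induction n with
  | zero => exact ⟨(hasSum_fintype _).summable, by simp⟩
  | succ n ih =>
    obtain ⟨h1, h2⟩ := ih (fun i => g i.succ) fun i => hg _
    have e : ∀ p : ℤ × (Fin n → ℤ),
        ∏ i, g i (Fin.consEquiv (fun _ => ℤ) p i) = g 0 p.1 * ∏ i, g i.succ (p.2 i) := by
      intro p
      rw [Fin.prod_univ_succ]
      simp [Fin.consEquiv]
    constructor
    · rw [← (Fin.consEquiv fun _ => ℤ).summable_iff]
      refine ((hg 0).mul_norm h1).congr fun p => ?_
      simp only [Function.comp]
      rw [e]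
    · rw [← (Fin.consEquiv fun _ => ℤ).tsum_eq, tsum_congr e, Fin.prod_univ_succ, ← h2,
        tsum_mul_tsum_of_summable_norm (hg 0) h1]

/-- A product of absolutely convergent series over `ℤ` is a series over integer vectors. -/
lemma summable_norm_prod_and_tsum {ι : Type*} [Fintype ι] (g : ι → ℤ → ℂ)
    (hg : ∀ i, Summable fun m => ‖g i m‖) :
    (Summable fun x : ι → ℤ => ‖∏ i, g i (x i)‖) ∧
      ∑' x : ι → ℤ, ∏ i, g i (x i) = ∏ i, ∑' m, g i m := by
  let e := Fintype.equivFin ι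
  obtain ⟨h1, h2⟩ := summable_norm_prod_and_tsum_fin _ (fun i => g (e.symm i)) fun i => hg _
  have key : ∀ x : Fin (Fintype.card ι) → ℤ,
      ∏ i, g i (e.symm.arrowCongr (Equiv.refl ℤ) x i) = ∏ i, g (e.symm i) (x i) := by
    intro x
    rw [← e.symm.prod_comp]
    simp [Equiv.arrowCongr]
  constructor
  · rw [← (e.symm.arrowCongr (Equiv.refl ℤ)).summable_iff]
    refine h1.congr fun x => ?_
    simp only [Function.comp]
    rw [key]
  · rw [← (e.symm.arrowCongr (Equiv.refl ℤ)).tsum_eq, tsum_congr key, h2, ← e.symm.prod_comp]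

/-! ### The theta series of a lattice coset -/

section OrbitTheta

variable {ι : Type*} {a : ℕ}

/-- The argument of the one-variable theta function that detects, by characters `h` modulo `a` and
`j` modulo `2a`, the conditions defining a weighted coset. -/
noncomputable def charPoint (l : ι → ℕ) (c : ι → ZMod a) (h : ZMod a) (j : ZMod (2 * a)) (s : ι) :
    ℂ := (2 * (h.val * (c s).val) + j.val * l s : ℕ) / (2 * a : ℕ)

lemma expTwoPiI_div_eq_stdAddChar (N : ℕ) [NeZero N] (m : ℤ) :
    expTwoPiI (m / N) = ZMod.stdAddChar (m : ZMod N) := by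
  rw [ZMod.stdAddChar_coe, expTwoPiI]; ring_nf

lemma stdAddChar_sum (N : ℕ) [NeZero N] {κ : Type*} (t : Finset κ) (f : κ → ZMod N) :
    (ZMod.stdAddChar (∑ s ∈ t, f s) : ℂ) = ∏ s ∈ t, ZMod.stdAddChar (f s) := by
  classical
  induction t using Finset.induction_on with
  | empty => simp
  | insert i t hi ih => rw [Finset.sum_insert hi, Finset.prod_insert hi, AddChar.map_add_eq_mul, ih]

lemma expTwoPiI_charPoint [NeZero a] (l : ι → ℕ) (c : ι → ZMod a) (h : ZMod a) (j : ZMod (2 * a)) (s : ι)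
    (x : ℤ) : expTwoPiI (x * charPoint l c h j s) =
      ZMod.stdAddChar (h * (c s * (x : ZMod a))) * ZMod.stdAddChar (j * ((l s * x : ℤ) : ZMod (2 * a))) := by
  have ha : (a : ℂ) ≠ 0 := by exact_mod_cast NeZero.ne a
  have e : (x * charPoint l c h j s : ℂ) = ((h.val * (c s).val * x : ℤ) : ℂ) / a +
      ((j.val * (l s * x) : ℤ) : ℂ) / (2 * a : ℕ) := by
    rw [charPoint]; push_cast; field_simp
  rw [e, expTwoPiI_add, expTwoPiI_div_eq_stdAddChar, expTwoPiI_div_eq_stdAddChar]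
  simp [mul_assoc]

variable [Fintype ι]

/-- The integer vectors `x` with weighted coordinate sum `∑ lₛ xₛ = n` and `∑ cₛ xₛ = k` modulo
`a`. -/
def weightCoset (l : ι → ℕ) (c : ι → ZMod a) (k : ZMod a) (n : ℕ) : Set (ι → ℤ) :=
  {x | ∑ s, l s * x s = n ∧ ∑ s, c s * (x s : ZMod a) = k}

/-- The weighted squared distance of `x` to `(b, …, b)`. -/
def weightNorm (l : ι → ℕ) (b : ℝ) (x : ι → ℤ) : ℝ := ∑ s, l s * ((x s : ℝ) - b) ^ 2

/-- The theta series `∑ e(z ∑ lₛ (xₛ - n/a)²)` over a weighted coset. -/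
noncomputable def weightTheta (l : ι → ℕ) (c : ι → ZMod a) (k : ZMod a) (n : ℕ) (z : ℂ) : ℂ :=
  ∑' x : weightCoset l c k n, expTwoPiI (z * (weightNorm l (n / a) x.1 : ℝ))

variable [NeZero a]

lemma sum_stdAddChar_mul (N : ℕ) [NeZero N] (t : ZMod N) :
    ∑ h : ZMod N, (ZMod.stdAddChar (h * t) : ℂ) = if t = 0 then (N : ℂ) else 0 := by
  rw [AddChar.sum_mulShift t (ZMod.isPrimitive_stdAddChar N), ZMod.card]
  split_ifs <;> simp

lemma two_mul_mul_im_pos {l : ℕ} (hl : 0 < l) {z : ℂ} (hz : 0 < z.im) :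
    0 < (2 * l * z : ℂ).im := by
  have : (2 * l * z : ℂ).im = 2 * l * z.im := by simp
  rw [this]; positivity

lemma summable_norm_term (y : ℂ) {l : ℕ} (hl : 0 < l) {z : ℂ} (hz : 0 < z.im) :
    Summable fun m : ℤ => ‖expTwoPiI (m * y + z * (l * m ^ 2))‖ := by
  have := ((summable_jacobiTheta₂_term_iff y (2 * l * z)).2 (two_mul_mul_im_pos hl hz)).norm
  refine this.congr fun m => ?_
  rw [jacobiTheta₂_term_eq]
  congr 2
  ring

/-- Products of theta functions at torsion points, expanded. -/
lemma prod_jacobiTheta₂_eq (l : ι → ℕ) (hl : ∀ s, 0 < l s) (c : ι → ZMod a) (h : ZMod a)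
    (j : ZMod (2 * a)) {z : ℂ} (hz : 0 < z.im) :
    HasSum (fun x : ι → ℤ => (ZMod.stdAddChar (h * ∑ s, c s * (x s : ZMod a)) *
      ZMod.stdAddChar (j * ((∑ s, l s * x s : ℤ) : ZMod (2 * a)))) *
        expTwoPiI (z * ∑ s, l s * (x s : ℂ) ^ 2))
      (∏ s, jacobiTheta₂ (charPoint l c h j s) (2 * l s * z)) := by
  obtain ⟨h1, h2⟩ := summable_norm_prod_and_tsum
    (fun s (m : ℤ) => expTwoPiI (m * charPoint l c h j s + z * (l s * m ^ 2)))
    fun s => summable_norm_term _ (hl s) hz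
  have h3 := h1.of_norm.hasSum
  rw [h2] at h3
  have e1 : ∀ s, jacobiTheta₂ (charPoint l c h j s) (2 * l s * z) =
      ∑' m : ℤ, expTwoPiI (m * charPoint l c h j s + z * (l s * m ^ 2)) := by
    intro s
    refine tsum_congr fun m => ?_
    rw [jacobiTheta₂_term_eq]
    congr 1
    ring
  have e2 : ∀ x : ι → ℤ, (ZMod.stdAddChar (h * ∑ s, c s * (x s : ZMod a)) *
      ZMod.stdAddChar (j * ((∑ s, l s * x s : ℤ) : ZMod (2 * a)))) *
        expTwoPiI (z * ∑ s, l s * (x s : ℂ) ^ 2) =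
      ∏ s, expTwoPiI (x s * charPoint l c h j s + z * (l s * (x s : ℂ) ^ 2)) := by
    intro x
    simp only [expTwoPiI_add, expTwoPiI_charPoint, Finset.prod_mul_distrib]
    congr 1
    · congr 1
      · rw [Finset.mul_sum, stdAddChar_sum]
      · rw [Int.cast_sum, Finset.mul_sum, stdAddChar_sum]
    · simp only [expTwoPiI]
      rw [← Complex.exp_sum, Finset.mul_sum, Finset.mul_sum]
  simp only [e1, e2]
  exact h3

/-- The theta function by which the theta series of the coset differs from a combination of
products of one-variable theta functions. -/
noncomputable def diagTheta (a n : ℕ) (z : ℂ) : ℂ :=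
  ∑' N : ℤ, expTwoPiI (z * ((n + 2 * a * N) ^ 2 / a))

lemma diagTheta_eq (n : ℕ) (z : ℂ) : diagTheta a n z =
    expTwoPiI (z * (n ^ 2 / a)) * jacobiTheta₂ (4 * n * z) (2 * (4 * a : ℕ) * z) := by
  have ha : (a : ℂ) ≠ 0 := by exact_mod_cast NeZero.ne a
  rw [diagTheta, jacobiTheta₂, ← tsum_mul_left]
  refine tsum_congr fun N => ?_
  rw [jacobiTheta₂_term_eq, ← expTwoPiI_add]
  congr 1
  push_cast
  field_simp
  ring

lemma diagTheta_ne_zero (n : ℕ) {z : ℂ} (hz : 0 < z.im) : diagTheta a n z ≠ 0 := by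
  have hτ := two_mul_mul_im_pos (l := 4 * a) (mul_pos four_pos (NeZero.pos a)) hz
  rw [diagTheta_eq, jacobiTheta₂_eq_tprod _ hτ]
  have key : ∀ ε : ℤ, ∏' m : ℕ, (1 + expTwoPiI (ε * (4 * n * z)) *
      expTwoPiI (2 * (4 * a : ℕ) * z / 2) ^ (2 * m + 1)) ≠ 0 := by
    intro ε
    refine tprod_one_add_ne_zero_of_summable (fun m h => ?_) ?_
    · have e : expTwoPiI (ε * (4 * n * z)) * expTwoPiI (2 * (4 * a : ℕ) * z / 2) ^ (2 * m + 1) =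
          expTwoPiI ((4 * (ε * n + a * (2 * m + 1)) : ℤ) * z) := by
        rw [expTwoPiI_pow, ← expTwoPiI_add]; congr 1; push_cast; ring
      rw [e] at h
      have hn : ‖expTwoPiI ((4 * (ε * n + a * (2 * m + 1)) : ℤ) * z)‖ = 1 := by
        rw [eq_neg_of_add_eq_zero_right h]; simp
      rw [norm_expTwoPiI, Real.exp_eq_one_iff] at hn
      have hi : ((4 * (ε * n + a * (2 * m + 1)) : ℤ) * z : ℂ).im =
          (4 * (ε * n + a * (2 * m + 1)) : ℤ) * z.im := by simp
      rw [hi] at hn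
      have h0 : ((4 * (ε * n + a * (2 * m + 1)) : ℤ) : ℝ) = 0 := by
        have := Real.pi_ne_zero
        have := hz.ne'
        simpa [*] using hn
      rw [Int.cast_eq_zero.1 h0, Int.cast_zero, zero_mul, expTwoPiI_zero] at h
      norm_num at h
    · have hp : ‖expTwoPiI (2 * (4 * a : ℕ) * z / 2)‖ < 1 := by
        refine norm_expTwoPiI_lt_one ?_
        have := hτ
        rw [Complex.div_ofNat_im]; positivity
      simp only [norm_mul, norm_pow]
      exact ((summable_geometric_of_lt_one (norm_nonneg _) hp).comp_injective
        (i := fun n : ℕ => 2 * n + 1) fun a b h => by simpa using h).mul_left _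
  refine mul_ne_zero (expTwoPiI_ne_zero _) (mul_ne_zero
    (tprod_one_sub_pow_ne_zero (norm_expTwoPiI_lt_one hτ)) (mul_ne_zero ?_ ?_))
  · simpa using key 1
  · simpa using key (-1)

/-- Vectors satisfying the conditions of a weighted coset with the sum only prescribed modulo `2a`
are translates of the coset by multiples of `(2, …, 2)`. -/
def weightCosetProdEquiv (l : ι → ℕ) (c : ι → ZMod a) (k : ZMod a) (n : ℕ) (hla : ∑ s, l s = a)
    (hc : 2 * ∑ s, c s = 0) :
    weightCoset l c k n × ℤ ≃ {x : ι → ℤ | ∑ s, c s * (x s : ZMod a) = k ∧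
      ((∑ s, l s * x s : ℤ) : ZMod (2 * a)) = n} where
  toFun p := ⟨fun s => p.1.1 s + 2 * p.2, by
    obtain ⟨⟨x, hx1, hx2⟩, N⟩ := p
    constructor
    · have : ∑ s, c s * ((x s + 2 * N : ℤ) : ZMod a) =
          ∑ s, c s * (x s : ZMod a) + N * (2 * ∑ s, c s) := by
        rw [Finset.mul_sum, Finset.mul_sum, ← Finset.sum_add_distrib]
        exact Finset.sum_congr rfl fun s _ => by push_cast; ring
      rw [this, hx2, hc, mul_zero, add_zero]
    · have : ∑ s, l s * (x s + 2 * N) = n + (2 * a : ℕ) * N := by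
        rw [← hx1, ← hla]
        push_cast
        rw [Finset.mul_sum, Finset.sum_mul, ← Finset.sum_add_distrib]
        exact Finset.sum_congr rfl fun s _ => by ring
      rw [this, Int.cast_add, Int.cast_mul, Int.cast_natCast, Int.cast_natCast, ZMod.natCast_self,
        zero_mul, add_zero]⟩
  invFun x := ⟨⟨fun s => x.1 s - 2 * ((∑ s, l s * x.1 s - n) / (2 * a : ℕ)), by
    obtain ⟨x, hx1, hx2⟩ := x
    simp only
    have hdvd : ((2 * a : ℕ) : ℤ) ∣ ∑ s, l s * x s - n := by
      rw [← ZMod.intCast_zmod_eq_zero_iff_dvd, Int.cast_sub, hx2]; simp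
    set t := (∑ s, l s * x s - n) / ((2 * a : ℕ) : ℤ) with ht
    have ht' : ((2 * a : ℕ) : ℤ) * t = ∑ s, l s * x s - n := Int.mul_ediv_cancel' hdvd
    constructor
    · have : ∑ s, l s * (x s - 2 * t) = ∑ s, l s * x s - (2 * a : ℕ) * t := by
        rw [← hla]
        push_cast
        rw [Finset.mul_sum, Finset.sum_mul, ← Finset.sum_sub_distrib]
        exact Finset.sum_congr rfl fun s _ => by ring
      rw [this, ht']
      ring
    · have : ∑ s, c s * ((x s - 2 * t : ℤ) : ZMod a) =
          ∑ s, c s * (x s : ZMod a) - t * (2 * ∑ s, c s) := by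
        rw [Finset.mul_sum, Finset.mul_sum, ← Finset.sum_sub_distrib]
        exact Finset.sum_congr rfl fun s _ => by push_cast; ring
      rw [this, hx1, hc, mul_zero, sub_zero]⟩, (∑ s, l s * x.1 s - n) / (2 * a : ℕ)⟩
  left_inv := by
    rintro ⟨⟨x, hx1, hx2⟩, N⟩
    have : (∑ s, l s * (x s + 2 * N) - n) / ((2 * a : ℕ) : ℤ) = N := by
      have : ∑ s, l s * (x s + 2 * N) = n + (2 * a : ℕ) * N := by
        rw [← hx1, ← hla]
        push_cast
        rw [Finset.mul_sum, Finset.sum_mul, ← Finset.sum_add_distrib]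
        exact Finset.sum_congr rfl fun s _ => by ring
      rw [this, add_sub_cancel_left, Int.mul_ediv_cancel_left]
      have := NeZero.pos a
      omega
    simp only [this]
    simp
  right_inv := by
    rintro ⟨x, hx1, hx2⟩
    simp

lemma weightNorm_eq (l : ι → ℕ) (c : ι → ZMod a) (k : ZMod a) (n : ℕ) (hla : ∑ s, l s = a)
    {x : ι → ℤ} (hx : x ∈ weightCoset l c k n) :
    weightNorm l (n / a) x = ∑ s, l s * (x s : ℝ) ^ 2 - n ^ 2 / a := by
  have ha : (a : ℝ) ≠ 0 := by exact_mod_cast NeZero.ne a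
  have h1 : ∑ s, (l s : ℝ) * x s = n := by exact_mod_cast hx.1
  have h2 : ∑ s, (l s : ℝ) = a := by exact_mod_cast hla
  have : weightNorm l (n / a) x = ∑ s, l s * (x s : ℝ) ^ 2 - 2 * (n / a) * ∑ s, (l s : ℝ) * x s +
      (n / a) ^ 2 * ∑ s, (l s : ℝ) := by
    rw [weightNorm, Finset.mul_sum, Finset.mul_sum, ← Finset.sum_sub_distrib,
      ← Finset.sum_add_distrib]
    exact Finset.sum_congr rfl fun s _ => by ring
  rw [this, h1, h2]
  field_simp
  ring

lemma summable_norm_quadratic (l : ι → ℕ) (hl : ∀ s, 0 < l s) {z : ℂ} (hz : 0 < z.im) :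
    Summable fun x : ι → ℤ => ‖expTwoPiI (z * ∑ s, l s * (x s : ℂ) ^ 2)‖ := by
  have := (prod_jacobiTheta₂_eq (a := 1) l hl 0 0 0 hz).summable.norm
  simpa using this

lemma summable_norm_weightTheta (l : ι → ℕ) (hl : ∀ s, 0 < l s) (c : ι → ZMod a) (k : ZMod a)
    (n : ℕ) (hla : ∑ s, l s = a) {z : ℂ} (hz : 0 < z.im) :
    Summable fun x : weightCoset l c k n => ‖expTwoPiI (z * (weightNorm l (n / a) x.1 : ℝ))‖ := by
  have := ((summable_norm_quadratic l hl hz).subtype (weightCoset l c k n)).mul_right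
    ‖expTwoPiI (z * (-(n ^ 2 / a)))‖
  refine this.congr fun x => ?_
  rw [weightNorm_eq l c k n hla x.2, Function.comp, ← norm_mul, ← expTwoPiI_add]
  congr 2
  push_cast
  ring

/-- The theta series of a weighted coset in terms of one-variable theta functions. -/
lemma weightTheta_mul_diagTheta (l : ι → ℕ) (hl : ∀ s, 0 < l s) (c : ι → ZMod a) (k : ZMod a)
    (n : ℕ) (hla : ∑ s, l s = a) (hc : 2 * ∑ s, c s = 0) {z : ℂ} (hz : 0 < z.im) :
    (a * (2 * a : ℕ) : ℂ) * (weightTheta l c k n z * diagTheta a n z) =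
      ∑ h : ZMod a, ∑ j : ZMod (2 * a), ZMod.stdAddChar (h * (-k)) *
        ZMod.stdAddChar (j * (-(n : ZMod (2 * a)))) *
          ∏ s, jacobiTheta₂ (charPoint l c h j s) (2 * l s * z) := by
  classical
  have hsum : HasSum (fun x : ι → ℤ => ∑ h : ZMod a, ∑ j : ZMod (2 * a),
      ZMod.stdAddChar (h * (-k)) * ZMod.stdAddChar (j * (-(n : ZMod (2 * a)))) *
      ((ZMod.stdAddChar (h * ∑ s, c s * (x s : ZMod a)) *
      ZMod.stdAddChar (j * ((∑ s, l s * x s : ℤ) : ZMod (2 * a)))) *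
        expTwoPiI (z * ∑ s, l s * (x s : ℂ) ^ 2))) _ :=
    hasSum_sum fun h _ => hasSum_sum fun j _ => (prod_jacobiTheta₂_eq l hl c h j hz).mul_left _
  rw [← hsum.tsum_eq]
  set Y := {x : ι → ℤ | ∑ s, c s * (x s : ZMod a) = k ∧
      ((∑ s, l s * x s : ℤ) : ZMod (2 * a)) = n} with hY
  have hterm : ∀ x : ι → ℤ, (∑ h : ZMod a, ∑ j : ZMod (2 * a),
      ZMod.stdAddChar (h * (-k)) * ZMod.stdAddChar (j * (-(n : ZMod (2 * a)))) *
      ((ZMod.stdAddChar (h * ∑ s, c s * (x s : ZMod a)) *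
      ZMod.stdAddChar (j * ((∑ s, l s * x s : ℤ) : ZMod (2 * a)))) *
        expTwoPiI (z * ∑ s, l s * (x s : ℂ) ^ 2)) : ℂ) = (a * (2 * a : ℕ) : ℂ) *
      Y.indicator (fun x => expTwoPiI (z * ∑ s, l s * (x s : ℂ) ^ 2)) x := by
    intro x
    have e : ∀ (h : ZMod a) (j : ZMod (2 * a)),
        (ZMod.stdAddChar (h * (-k)) * ZMod.stdAddChar (j * (-(n : ZMod (2 * a)))) *
      ((ZMod.stdAddChar (h * ∑ s, c s * (x s : ZMod a)) *
      ZMod.stdAddChar (j * ((∑ s, l s * x s : ℤ) : ZMod (2 * a)))) *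
        expTwoPiI (z * ∑ s, l s * (x s : ℂ) ^ 2)) : ℂ) =
        ZMod.stdAddChar (h * (∑ s, c s * (x s : ZMod a) - k)) *
          (ZMod.stdAddChar (j * (((∑ s, l s * x s : ℤ) : ZMod (2 * a)) - (n : ZMod (2 * a)))) *
          expTwoPiI (z * ∑ s, l s * (x s : ℂ) ^ 2)) := by
      intro h j
      rw [sub_eq_add_neg, sub_eq_add_neg, mul_add h, mul_add j, AddChar.map_add_eq_mul,
        AddChar.map_add_eq_mul]
      ring
    simp only [e]
    simp only [← Finset.mul_sum, ← Finset.sum_mul, sum_stdAddChar_mul, sub_eq_zero]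
    by_cases h1 : ∑ s, c s * (x s : ZMod a) = k
    · by_cases h2 : ((∑ s, l s * x s : ℤ) : ZMod (2 * a)) = n
      · rw [if_pos h1, if_pos h2, Set.indicator_of_mem (show x ∈ Y from ⟨h1, h2⟩)]
        ring
      · rw [if_neg h2, Set.indicator_of_notMem (fun h : x ∈ Y => h2 h.2)]
        ring
    · rw [if_neg h1, Set.indicator_of_notMem (fun h : x ∈ Y => h1 h.1)]
      ring
  rw [tsum_congr hterm, tsum_mul_left, ← tsum_subtype]
  congr 1
  have hdiag : Summable fun N : ℤ => ‖expTwoPiI (z * ((n + 2 * a * N) ^ 2 / a))‖ := by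
    have := (summable_norm_term (4 * n * z) (l := 4 * a) (mul_pos four_pos (NeZero.pos a))
      hz).mul_right ‖expTwoPiI (z * (n ^ 2 / a))‖
    refine this.congr fun N => ?_
    have ha : (a : ℂ) ≠ 0 := by exact_mod_cast NeZero.ne a
    rw [← norm_mul, ← expTwoPiI_add]
    congr 2
    push_cast
    field_simp
    ring
  rw [weightTheta, diagTheta, tsum_mul_tsum_of_summable_norm
    (summable_norm_weightTheta l hl c k n hla hz) hdiag,
    ← (weightCosetProdEquiv l c k n hla hc).tsum_eq]
  refine tsum_congr fun ⟨⟨x, hx⟩, N⟩ => ?_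
  rw [← expTwoPiI_add]
  congr 1
  rw [weightNorm_eq l c k n hla hx, ← mul_add]
  congr 1
  have ha : (a : ℂ) ≠ 0 := by exact_mod_cast NeZero.ne a
  have h1 : ∑ s, (l s : ℂ) * x s = n := by exact_mod_cast hx.1
  have h2 : ∑ s, (l s : ℂ) = a := by exact_mod_cast hla
  have : ∑ s, (l s : ℂ) * ((x s + 2 * N : ℤ) : ℂ) ^ 2 = ∑ s, (l s : ℂ) * (x s : ℂ) ^ 2 +
      4 * N * ∑ s, (l s : ℂ) * x s + 4 * N ^ 2 * ∑ s, (l s : ℂ) := by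
    rw [Finset.mul_sum, Finset.mul_sum, ← Finset.sum_add_distrib, ← Finset.sum_add_distrib]
    exact Finset.sum_congr rfl fun s _ => by push_cast; ring
  change _ = ∑ s, (l s : ℂ) * ((x s + 2 * N : ℤ) : ℂ) ^ 2
  rw [this, h1, h2]
  push_cast
  field_simp
  ring

end OrbitTheta

/-! ### Invariance of the eta-theta quotients -/

section WeightForm

variable {ι : Type*} [Fintype ι] {a : ℕ} [NeZero a]

/-- The quotient `η(z) θ(z) / ∏ η(lₛ z)`, where `θ` is the theta series of a weighted coset. -/
noncomputable def weightForm (l : ι → ℕ) (c : ι → ZMod a) (k : ZMod a) (n : ℕ) (z : ℂ) : ℂ :=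
  ModularForm.eta z * weightTheta l c k n z / ∏ s, ModularForm.eta (l s * z)

lemma nat_mul_im_pos {l : ℕ} (hl : 0 < l) {z : ℂ} (hz : 0 < z.im) : 0 < (l * z : ℂ).im := by
  simpa using mul_pos (Nat.cast_pos.2 hl) hz

/-- Theta functions at torsion points are Siegel functions times eta functions. The characteristic
`-1/2` removes the shift by `1/2` built into `charTheta`. -/
lemma isLevelInvariant_jacobiTheta₂_div_eta (m : ℤ) {l : ℕ} (hl : 0 < l) :
    IsLevelInvariant fun z => jacobiTheta₂ (m / (2 * a : ℕ)) (2 * l * z) /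
      ModularForm.eta (l * z) := by
  have ha : (a : ℂ) ≠ 0 := by exact_mod_cast NeZero.ne a
  have h1 := (isLevelInvariant_siegelFn (-a) (m - a) (M := 2 * a)
    (mul_pos two_pos (NeZero.pos a))).comp_mul (l := 2 * l) (by omega)
  have h2 := (isLevelInvariant_eta_div (l := 2) two_pos).comp_mul hl
  refine ((IsLevelInvariant.const (expTwoPiI (-((m / (2 * a : ℕ) + 1 / 2) / 4)))).mul
    (h1.mul h2)).congr fun z hz => ?_
  have hz1 := nat_mul_im_pos hl hz
  have hz2 : 0 < (2 * l * z : ℂ).im := two_mul_mul_im_pos hl hz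
  have hne := ModularForm.eta_ne_zero hz1
  have hne2 := ModularForm.eta_ne_zero hz2
  have e1 : (((-a : ℤ) : ℂ) / ((2 * a : ℕ) : ℂ)) = -1 / 2 := by push_cast; field_simp
  have e2 : (((m - a : ℤ) : ℂ) / ((2 * a : ℕ) : ℂ)) = m / (2 * a : ℕ) - 1 / 2 := by
    push_cast; field_simp
  have e3 : (((2 * l : ℕ) : ℂ) * z) = 2 * l * z := by push_cast; ring
  have e4 : (((2 : ℕ) : ℂ) * (l * z)) = 2 * l * z := by push_cast; ring
  rw [e1, e2, e3, e4, siegelFn, charTheta]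
  have e5 : (1 / 2 + (m / (2 * a : ℕ) - 1 / 2) + (1 / 2 + -1 / 2) * (2 * l * z) : ℂ) =
      m / (2 * a : ℕ) := by ring
  rw [e5]
  rw [show ∀ A B C D E : ℂ, A * (B * C / D * (D / E)) = (A * B) * C / E * (D / D) by
    intros; ring, div_self hne2, mul_one, ← expTwoPiI_add]
  have e6 : (-((m / (2 * a : ℕ) + 1 / 2) / 4) + (-(-1 / 2 * (m / (2 * a : ℕ) - 1 / 2 + 1) / 2) +
      2 * l * z * (1 / 2 + -1 / 2) ^ 2 / 2 +
      (1 / 2 + -1 / 2) * (1 / 2 + (m / (2 * a : ℕ) - 1 / 2))) : ℂ) = 0 := by ring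
  rw [e6, expTwoPiI_zero, one_mul]

/-- The function `diagTheta` is a Siegel function at `8az`, times an eta function. -/
lemma isLevelInvariant_diagTheta_div_eta (n : ℕ) :
    IsLevelInvariant fun z => diagTheta a n z / ModularForm.eta z := by
  have ha : (a : ℂ) ≠ 0 := by exact_mod_cast NeZero.ne a
  have h1 := (isLevelInvariant_siegelFn (n - a) (-a) (M := 2 * a)
    (mul_pos two_pos (NeZero.pos a))).comp_mul (l := 8 * a) (mul_pos (by norm_num) (NeZero.pos a))
  have h2 := isLevelInvariant_eta_div (l := 8 * a) (mul_pos (by norm_num) (NeZero.pos a))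
  refine ((IsLevelInvariant.const (expTwoPiI ((n - a) / (2 * a) / 4))).mul
    (h1.mul h2)).congr fun z hz => ?_
  have hz2 := nat_mul_im_pos (l := 8 * a) (mul_pos (by norm_num) (NeZero.pos a)) hz
  have hne2 := ModularForm.eta_ne_zero hz2
  have e1 : (((n - a : ℤ) : ℂ) / ((2 * a : ℕ) : ℂ)) = n / (2 * a) - 1 / 2 := by
    push_cast; field_simp
  have e2 : (((-a : ℤ) : ℂ) / ((2 * a : ℕ) : ℂ)) = -1 / 2 := by push_cast; field_simp
  rw [e1, e2, siegelFn, charTheta, diagTheta_eq]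
  rw [show ∀ A B C D E : ℂ, A * (B * C / D * (D / E)) = (A * B) * C / E * (D / D) by
    intros; ring, div_self hne2, mul_one, ← expTwoPiI_add]
  congr 2
  · congr 1
    push_cast; field_simp; ring
  · congr 1
    · push_cast; field_simp; ring
    · push_cast; ring

/-- The weights cancel: by `weightTheta_mul_diagTheta` the quotient is a combination of products of
level invariant quotients `ϑ / η`, with as many factors as there are `lₛ`, divided by `diagTheta /
η`. -/
lemma isLevelInvariant_weightForm (l : ι → ℕ) (hl : ∀ s, 0 < l s) (c : ι → ZMod a) (k : ZMod a)
    (n : ℕ) (hla : ∑ s, l s = a) (hc : 2 * ∑ s, c s = 0) :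
    IsLevelInvariant (weightForm l c k n) := by
  have ha : (a : ℂ) ≠ 0 := by exact_mod_cast NeZero.ne a
  have h : IsLevelInvariant fun z => ((a * (2 * a : ℕ) : ℂ)⁻¹ *
      ∑ h : ZMod a, ∑ j : ZMod (2 * a), ZMod.stdAddChar (h * (-k)) *
        ZMod.stdAddChar (j * (-(n : ZMod (2 * a)))) *
          ∏ s, (jacobiTheta₂ (charPoint l c h j s) (2 * l s * z) / ModularForm.eta (l s * z))) /
      (diagTheta a n z / ModularForm.eta z) := by
    refine ((IsLevelInvariant.const _).mul (IsLevelInvariant.sum _ fun h _ =>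
      IsLevelInvariant.sum _ fun j _ => (IsLevelInvariant.const _).mul
      (IsLevelInvariant.prod _ fun s _ => ?_))).div (isLevelInvariant_diagTheta_div_eta n)
    have := isLevelInvariant_jacobiTheta₂_div_eta (a := a)
      ((2 * (h.val * (c s).val) + j.val * l s : ℕ) : ℤ) (hl s)
    rwa [Int.cast_natCast] at this
  refine h.congr fun z hz => ?_
  have hη := ModularForm.eta_ne_zero hz
  have hD := diagTheta_ne_zero (a := a) n hz
  have hP : ∏ s, ModularForm.eta (l s * z) ≠ 0 :=
    Finset.prod_ne_zero_iff.2 fun s _ => ModularForm.eta_ne_zero (nat_mul_im_pos (hl s) hz)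
  have hmain := weightTheta_mul_diagTheta l hl c k n hla hc hz
  simp only [Finset.prod_div_distrib, ← mul_div_assoc]
  simp only [← Finset.sum_div]
  rw [← hmain, weightForm]
  generalize ∏ s, ModularForm.eta (l s * z) = P at hP ⊢
  have h2 : (((2 * a : ℕ) : ℂ)) ≠ 0 := by push_cast; exact mul_ne_zero two_ne_zero ha
  field_simp

/-- Holomorphy is inherited from the two-variable theta function through
`weightTheta_mul_diagTheta`, as `diagTheta` has no zeros. -/
lemma differentiableAt_weightTheta (l : ι → ℕ) (hl : ∀ s, 0 < l s) (c : ι → ZMod a) (k : ZMod a)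
    (n : ℕ) (hla : ∑ s, l s = a) (hc : 2 * ∑ s, c s = 0) {z : ℂ} (hz : 0 < z.im) :
    DifferentiableAt ℂ (weightTheta l c k n) z := by
  have ha : (a : ℂ) ≠ 0 := by exact_mod_cast NeZero.ne a
  have h2 : (((2 * a : ℕ) : ℂ)) ≠ 0 := by push_cast; exact mul_ne_zero two_ne_zero ha
  have hcomp : ∀ (y : ℂ) {m : ℕ}, 0 < m →
      DifferentiableAt ℂ (fun z => jacobiTheta₂ y (2 * m * z)) z := fun y m hm =>
    DifferentiableAt.comp z (differentiableAt_jacobiTheta₂_snd y (two_mul_mul_im_pos hm hz))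
      (by fun_prop)
  have hdiag : DifferentiableAt ℂ (fun z => diagTheta a n z) z := by
    have h8 := two_mul_mul_im_pos (l := 4 * a) (mul_pos four_pos (NeZero.pos a)) hz
    have : DifferentiableAt ℂ (fun z : ℂ => jacobiTheta₂ (4 * n * z) (2 * (4 * a : ℕ) * z)) z := by
      exact (hasFDerivAt_jacobiTheta₂ (4 * n * z) h8).differentiableAt.comp z
        (f := fun z : ℂ => (4 * n * z, 2 * ((4 * a : ℕ) : ℂ) * z)) (by fun_prop)
    simp only [diagTheta_eq]
    unfold expTwoPiI
    fun_prop
  have heq : weightTheta l c k n =ᶠ[𝓝 z] fun z => (a * (2 * a : ℕ) : ℂ)⁻¹ *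
      (∑ h : ZMod a, ∑ j : ZMod (2 * a), ZMod.stdAddChar (h * (-k)) *
        ZMod.stdAddChar (j * (-(n : ZMod (2 * a)))) *
          ∏ s, jacobiTheta₂ (charPoint l c h j s) (2 * l s * z)) / diagTheta a n z := by
    filter_upwards [(isOpen_lt continuous_const Complex.continuous_im).mem_nhds hz] with w hw
    have hD := diagTheta_ne_zero (a := a) n hw
    rw [← weightTheta_mul_diagTheta l hl c k n hla hc hw]
    field_simp
  refine DifferentiableAt.congr_of_eventuallyEq ?_ heq
  refine DifferentiableAt.div (DifferentiableAt.const_mul ?_ _) hdiag (diagTheta_ne_zero n hz)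
  refine DifferentiableAt.fun_sum fun h _ => DifferentiableAt.fun_sum fun j _ =>
    DifferentiableAt.const_mul ?_ _
  exact DifferentiableAt.fun_finsetProd fun s _ => hcomp _ (hl s)

lemma differentiableAt_weightForm (l : ι → ℕ) (hl : ∀ s, 0 < l s) (c : ι → ZMod a) (k : ZMod a)
    (n : ℕ) (hla : ∑ s, l s = a) (hc : 2 * ∑ s, c s = 0) {z : ℂ} (hz : 0 < z.im) :
    DifferentiableAt ℂ (weightForm l c k n) z := by
  have hη : ∀ m : ℕ, 0 < m → DifferentiableAt ℂ (fun z => ModularForm.eta (m * z)) z :=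
    fun m hm => (ModularForm.differentiableAt_eta_of_mem_upperHalfPlaneSet
      (nat_mul_im_pos hm hz)).comp z (by fun_prop)
  refine DifferentiableAt.div ((ModularForm.differentiableAt_eta_of_mem_upperHalfPlaneSet hz).mul
    (differentiableAt_weightTheta l hl c k n hla hc hz))
    (DifferentiableAt.fun_finsetProd fun s _ => hη _ (hl s))
    (Finset.prod_ne_zero_iff.2 fun s _ => ModularForm.eta_ne_zero (nat_mul_im_pos (hl s) hz))

/-- Translation by `(2, …, 2)` changes `n` by `2a`. The hypothesis `hc` ensures that it preserves
the condition modulo `a`. -/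
lemma weightForm_add_two_mul (l : ι → ℕ) (c : ι → ZMod a) (k : ZMod a)
    (n : ℕ) (hla : ∑ s, l s = a) (hc : 2 * ∑ s, c s = 0) :
    weightForm l c k (n + 2 * a) = weightForm l c k n := by
  have ha : (a : ℝ) ≠ 0 := by exact_mod_cast NeZero.ne a
  have hc' : ∀ x : ι → ℤ, ∑ s, c s * ((x s + 2 : ℤ) : ZMod a) = ∑ s, c s * (x s : ZMod a) := by
    intro x
    rw [← add_zero (∑ s, c s * (x s : ZMod a)), ← hc, Finset.mul_sum, ← Finset.sum_add_distrib]
    exact Finset.sum_congr rfl fun s _ => by push_cast; ring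
  have hl' : ∀ x : ι → ℤ, ∑ s, l s * (x s + 2) = ∑ s, l s * x s + 2 * a := by
    intro x
    rw [← hla]
    push_cast
    rw [Finset.mul_sum, ← Finset.sum_add_distrib]
    exact Finset.sum_congr rfl fun s _ => by ring
  let e : weightCoset l c k n ≃ weightCoset l c k (n + 2 * a) :=
    (Equiv.addRight (fun _ : ι => (2 : ℤ))).subtypeEquiv fun x => by
      change (_ ∧ _) ↔ (∑ s, l s * (x s + 2) = _ ∧ ∑ s, c s * ((x s + 2 : ℤ) : ZMod a) = _)
      rw [hc', hl']
      push_cast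
      rw [add_left_inj]
  funext z
  rw [weightForm, weightForm]
  congr 2
  rw [weightTheta, weightTheta, ← e.tsum_eq]
  refine tsum_congr fun x => ?_
  congr 3
  refine Finset.sum_congr rfl fun s _ => ?_
  change l s * (((x.1 s + 2 : ℤ) : ℝ) - _) ^ 2 = _
  congr 2
  push_cast
  field_simp
  ring

end WeightForm

/-! ### Frobenius orbits -/

section Orbits

variable {a : ℕ}

/-- For a unit `u` the orbits partition `ZMod a`, although they are defined by non-negative powers
of `u` only. -/
lemma mem_frobOrbit_iff {u : ZMod a} (hu : IsUnit u) (i j : ZMod a) :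
    j ∈ frobOrbit u i ↔ frobOrbit u j = frobOrbit u i := by
  obtain ⟨v, rfl⟩ := hu
  constructor
  · rintro ⟨r, rfl⟩
    ext t
    constructor
    · rintro ⟨r', rfl⟩
      exact ⟨r' + r, by rw [pow_add, mul_assoc]⟩
    · rintro ⟨r', rfl⟩
      obtain ⟨m, hm⟩ : ∃ m : ℕ, m + r = r' + r * orderOf v :=
        ⟨r' + r * orderOf v - r, Nat.sub_add_cancel
          (le_add_left (Nat.le_mul_of_pos_right _ (orderOf_pos v)))⟩
      refine ⟨m, ?_⟩
      rw [← mul_assoc, ← pow_add, hm, pow_add, mul_comm r, pow_mul, ← Units.val_pow_eq_pow_val v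
        (orderOf v), pow_orderOf_eq_one]
      simp
  · intro h
    rw [← h]
    exact ⟨0, by simp⟩

/-- The Frobenius orbit of an index, as an element of the set of orbits. -/
def toOrbit (u i : ZMod a) : frobOrbits u := ⟨frobOrbit u i, i, rfl⟩

lemma toOrbit_surjective (u : ZMod a) : Function.Surjective (toOrbit u) := by
  rintro ⟨_, i, rfl⟩
  exact ⟨i, rfl⟩

/-- The size `lₛ` of a Frobenius orbit. -/
noncomputable def orbitLen (u : ZMod a) (s : frobOrbits u) : ℕ := s.1.ncard

variable [NeZero a]

noncomputable instance (u : ZMod a) : Fintype (frobOrbits u) := (Set.finite_range _).fintype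

open Classical in
/-- The sum of the indices in a Frobenius orbit. -/
noncomputable def orbitSum (u : ZMod a) (s : frobOrbits u) : ZMod a :=
  ∑ i with toOrbit u i = s, i

open Classical in
lemma orbitLen_eq_card {u : ZMod a} (hu : IsUnit u) (s : frobOrbits u) :
    orbitLen u s = (Finset.univ.filter fun i => toOrbit u i = s).card := by
  obtain ⟨i, rfl⟩ := toOrbit_surjective u s
  rw [orbitLen, ← Set.ncard_coe_finset]
  congr 1
  ext j
  rw [Finset.mem_coe, Finset.mem_filter, Subtype.ext_iff]
  exact (mem_frobOrbit_iff hu i j).trans (by simp [toOrbit])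

lemma orbitLen_pos {u : ZMod a} (hu : IsUnit u) (s : frobOrbits u) : 0 < orbitLen u s := by
  classical
  rw [orbitLen_eq_card hu, Finset.card_pos]
  obtain ⟨i, rfl⟩ := toOrbit_surjective u s
  exact ⟨i, by simp⟩

lemma sum_comp_toOrbit {u : ZMod a} (hu : IsUnit u) {R : Type*} [Semiring R]
    (g : frobOrbits u → R) : ∑ i, g (toOrbit u i) = ∑ s, orbitLen u s * g s := by
  classical
  rw [← Finset.sum_fiberwise_of_maps_to (s := Finset.univ) (t := Finset.univ) (g := toOrbit u)
    fun _ _ => Finset.mem_univ _]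
  refine Finset.sum_congr rfl fun s _ => ?_
  rw [orbitLen_eq_card hu, Finset.sum_congr rfl fun i hi => by rw [(Finset.mem_filter.1 hi).2],
    Finset.sum_const, nsmul_eq_mul]

lemma sum_mul_comp_toOrbit (u : ZMod a) (g : frobOrbits u → ZMod a) :
    ∑ i, i * g (toOrbit u i) = ∑ s, orbitSum u s * g s := by
  classical
  rw [← Finset.sum_fiberwise_of_maps_to (s := Finset.univ) (t := Finset.univ) (g := toOrbit u)
    fun _ _ => Finset.mem_univ _]
  refine Finset.sum_congr rfl fun s _ => ?_
  rw [orbitSum, Finset.sum_mul]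
  exact Finset.sum_congr rfl fun i hi => by rw [(Finset.mem_filter.1 hi).2]

lemma sum_orbitLen {u : ZMod a} (hu : IsUnit u) : ∑ s, orbitLen u s = a := by
  have := sum_comp_toOrbit hu (fun _ => 1 : frobOrbits u → ℕ)
  simpa using this.symm

/-- The sum of all elements of `ZMod a` is invariant under negation. -/
lemma two_mul_sum_orbitSum (u : ZMod a) : 2 * ∑ s, orbitSum u s = 0 := by
  have h1 := sum_mul_comp_toOrbit u (fun _ => 1)
  simp only [mul_one] at h1
  have h2 : ∑ i : ZMod a, i = ∑ i : ZMod a, -i :=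
    (Equiv.sum_comp (Equiv.neg (ZMod a)) fun i => i).symm
  rw [Finset.sum_neg_distrib] at h2
  rw [← h1, two_mul]
  nth_rewrite 1 [h2]
  exact neg_add_cancel _

/-- Vectors that are constant on Frobenius orbits are vectors indexed by the orbits. -/
noncomputable def latticeCosetEquiv {u : ZMod a} (hu : IsUnit u) (k : ZMod a) (n : ℕ) :
    weightCoset (orbitLen u) (orbitSum u) k n ≃ latticeCoset u k n where
  toFun x := ⟨fun i => x.1 (toOrbit u i), by
    obtain ⟨x, hx1, hx2⟩ := x
    refine ⟨?_, ?_, ?_⟩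
    · exact (sum_comp_toOrbit hu x).trans hx1
    · intro i j hj
      have : toOrbit u j = toOrbit u i := Subtype.ext ((mem_frobOrbit_iff hu i j).1 hj)
      simp only [this]
    · exact (sum_mul_comp_toOrbit u fun s => (x s : ZMod a)).trans hx2⟩
  invFun m := ⟨fun s => m.1 (toOrbit_surjective u s).choose, by
    obtain ⟨m, hm1, hm2, hm3⟩ := m
    set x : frobOrbits u → ℤ := fun s => m (toOrbit_surjective u s).choose with hx
    have h : ∀ i, m i = x (toOrbit u i) := fun i => hm2 _ _ <| (mem_frobOrbit_iff hu _ _).2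
      (congrArg Subtype.val (toOrbit_surjective u (toOrbit u i)).choose_spec).symm
    refine ⟨?_, ?_⟩
    · exact (sum_comp_toOrbit hu x).symm.trans
        ((Finset.sum_congr rfl fun i _ => (h i).symm).trans hm1)
    · exact (sum_mul_comp_toOrbit u fun s => (x s : ZMod a)).symm.trans
        ((Finset.sum_congr rfl fun i _ => by rw [← h i]).trans hm3)⟩
  left_inv x := by
    ext s
    change x.1 (toOrbit u (toOrbit_surjective u s).choose) = x.1 s
    rw [(toOrbit_surjective u s).choose_spec]
  right_inv m := by
    ext i
    exact (m.2.2.1 _ _ <| (mem_frobOrbit_iff hu _ _).2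
      (congrArg Subtype.val (toOrbit_surjective u (toOrbit u i)).choose_spec).symm).symm

/-- In the coordinates indexed by the orbits, `fForm` becomes `weightForm`. -/
lemma fForm_eq_weightForm {u : ZMod a} (hu : IsUnit u) (k : ZMod a) (n : ℕ) :
    fForm u k n = weightForm (orbitLen u) (orbitSum u) k n := by
  funext z
  rw [fForm, weightForm]
  congr 1
  · congr 1
    rw [cosetTheta, weightTheta, ← (latticeCosetEquiv hu k n).tsum_eq]
    refine tsum_congr fun x => ?_
    rw [expTwoPiI]
    have : (∑ i : ZMod a, (((x.1 (toOrbit u i) : ℤ) : ℂ) - n / a) ^ 2) =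
        (weightNorm (orbitLen u) (n / a) x.1 : ℝ) := by
      rw [sum_comp_toOrbit hu (fun s => ((x.1 s : ℂ) - n / a) ^ 2), weightNorm]
      push_cast
      rfl
    rw [← this]
    congr 1
    change _ * (∑ i : ZMod a, (((x.1 (toOrbit u i) : ℤ) : ℂ) - n / a) ^ 2) * z = _
    ring
  · rw [← finprod_set_coe_eq_finprod_mem, finprod_eq_prod_of_fintype]
    rfl

end Orbits

/-! ### Gaussian sums over the integers -/

lemma one_div_one_sub_exp_neg_le {t : ℝ} (ht : 0 < t) : (1 - Real.exp (-t))⁻¹ ≤ 1 + 1 / t := by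
  have h1 : Real.exp (-t) ≤ 1 / (1 + t) := by
    rw [Real.exp_neg, ← one_div]
    exact one_div_le_one_div_of_le (by linarith) (by linarith [Real.add_one_le_exp t])
  have h2 : t / (1 + t) ≤ 1 - Real.exp (-t) := by
    have : t / (1 + t) = 1 - 1 / (1 + t) := by field_simp; ring
    linarith
  calc (1 - Real.exp (-t))⁻¹ ≤ (t / (1 + t))⁻¹ := inv_anti₀ (by positivity) h2
    _ = 1 + 1 / t := by field_simp; ring

/-- An upper bound, uniform in `b`, for `∑ₓ exp(-t (x - b)²)`. -/
noncomputable def gaussBound (t : ℝ) : ℝ := Real.exp t * (2 * (1 + 2 / t))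

lemma gaussBound_pos {t : ℝ} (ht : 0 < t) : 0 < gaussBound t := by
  rw [gaussBound]; positivity

/-- Shifting by the integer part of `b` and using `(x - β)² ≥ |x| / 2 - 1` for `β ∈ [0, 1)`, the sum
is dominated by a geometric series. -/
lemma summable_gauss_and_le {t : ℝ} (ht : 0 < t) (b : ℝ) :
    (Summable fun x : ℤ => Real.exp (-t * (x - b) ^ 2)) ∧
      ∑' x : ℤ, Real.exp (-t * (x - b) ^ 2) ≤ gaussBound t := by
  set ρ := Real.exp (-(t / 2)) with hρ
  have hρ0 : 0 ≤ ρ := (Real.exp_pos _).le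
  have hρ1 : ρ < 1 := by rw [hρ, Real.exp_lt_one_iff]; linarith
  have hgeo : HasSum (fun x : ℤ => ρ ^ x.natAbs) ((1 - ρ)⁻¹ + (1 - ρ)⁻¹ * ρ) := by
    refine HasSum.of_nat_of_neg_add_one ?_ ?_
    · simpa using hasSum_geometric_of_lt_one hρ0 hρ1
    · have := (hasSum_geometric_of_lt_one hρ0 hρ1).mul_right ρ
      have e : (fun n : ℕ => ρ ^ (-((n : ℤ) + 1)).natAbs) = fun n => ρ ^ n * ρ := by
        funext n
        rw [show (-((n : ℤ) + 1)).natAbs = n + 1 by omega, pow_succ]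
      rw [e]
      exact this
  have hle : ∀ x : ℤ, Real.exp (-t * ((x + ⌊b⌋ : ℤ) - b) ^ 2) ≤ Real.exp t * ρ ^ x.natAbs := by
    intro x
    have hβ0 := Int.fract_nonneg b
    have hβ1 := Int.fract_lt_one b
    have e : (((x + ⌊b⌋ : ℤ) : ℝ) - b) = x - Int.fract b := by
      rw [← Int.self_sub_floor]; push_cast; ring
    have hx : (x.natAbs : ℝ) ≤ (x : ℝ) ^ 2 := by
      have : (x.natAbs : ℤ) ≤ x ^ 2 := by
        exact Int.natAbs_le_self_sq x
      calc (x.natAbs : ℝ) = ((x.natAbs : ℤ) : ℝ) := (Int.cast_natCast _).symm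
        _ ≤ ((x ^ 2 : ℤ) : ℝ) := Int.cast_le.2 this
        _ = (x : ℝ) ^ 2 := by push_cast; ring
    rw [e, hρ, ← Real.exp_nat_mul, ← Real.exp_add]
    refine Real.exp_le_exp.2 ?_
    have h1 : (x : ℝ) ^ 2 / 2 - 1 ≤ (x - Int.fract b) ^ 2 := by
      nlinarith [sq_nonneg ((x : ℝ) - 2 * Int.fract b)]
    nlinarith
  have hs : Summable fun x : ℤ => Real.exp (-t * ((x + ⌊b⌋ : ℤ) - b) ^ 2) :=
    Summable.of_nonneg_of_le (fun _ => (Real.exp_pos _).le) hle (hgeo.summable.mul_left _)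
  refine ⟨(Equiv.addRight ⌊b⌋).summable_iff.1 hs, ?_⟩
  rw [← (Equiv.addRight ⌊b⌋).tsum_eq]
  refine (hs.tsum_le_tsum hle (hgeo.summable.mul_left _)).trans ?_
  rw [tsum_mul_left, hgeo.tsum_eq, gaussBound]
  have := one_div_one_sub_exp_neg_le (half_pos ht)
  rw [← hρ, show 1 / (t / 2) = 2 / t by field_simp] at this
  have h3 : 0 ≤ (1 - ρ)⁻¹ := inv_nonneg.2 (by linarith)
  gcongr
  nlinarith

section

variable {ι : Type*} [Fintype ι]

lemma summable_exp_weightNorm_and_le (l : ι → ℕ) (hl : ∀ s, 0 < l s) {t : ℝ} (ht : 0 < t) (b : ℝ) :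
    (Summable fun x : ι → ℤ => Real.exp (-t * weightNorm l b x)) ∧
      ∑' x : ι → ℤ, Real.exp (-t * weightNorm l b x) ≤ ∏ s, gaussBound (t * l s) := by
  have htl : ∀ s, 0 < t * l s := fun s => mul_pos ht (Nat.cast_pos.2 (hl s))
  obtain ⟨h1, h2⟩ := summable_norm_prod_and_tsum
    (fun s (m : ℤ) => ((Real.exp (-(t * l s) * (m - b) ^ 2) : ℝ) : ℂ))
    fun s => by
      simp only [Complex.norm_real]
      exact (summable_gauss_and_le (htl s) b).1.norm
  have e : ∀ x : ι → ℤ, ∏ s, ((Real.exp (-(t * l s) * (x s - b) ^ 2) : ℝ) : ℂ) =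
      (Real.exp (-t * weightNorm l b x) : ℝ) := by
    intro x
    rw [← Complex.ofReal_prod, ← Real.exp_sum, weightNorm, Finset.mul_sum]
    congr 2
    exact Finset.sum_congr rfl fun s _ => by ring
  simp only [e] at h1 h2
  simp only [← Complex.ofReal_tsum, ← Complex.ofReal_prod] at h2
  refine ⟨?_, ?_⟩
  · simpa only [Complex.norm_real, Real.norm_of_nonneg (Real.exp_pos _).le] using h1
  · rw [Complex.ofReal_inj.1 h2]
    exact Finset.prod_le_prod (fun s _ => tsum_nonneg fun _ => (Real.exp_pos _).le)
      fun s _ => (summable_gauss_and_le (htl s) b).2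

lemma summable_exp_weightNorm_subtype_and_le (l : ι → ℕ) (hl : ∀ s, 0 < l s) {t : ℝ} (ht : 0 < t)
    (b : ℝ) (X : Set (ι → ℤ)) :
    (Summable fun x : X => Real.exp (-t * weightNorm l b x.1)) ∧
      ∑' x : X, Real.exp (-t * weightNorm l b x.1) ≤ ∏ s, gaussBound (t * l s) := by
  obtain ⟨h1, h2⟩ := summable_exp_weightNorm_and_le l hl ht b
  exact ⟨h1.subtype X, (Summable.tsum_subtype_le _ X (fun _ => (Real.exp_pos _).le) h1).trans h2⟩

end

/-! ### Growth at the cusps -/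

/-- Functions on the upper half plane bounded by `exp(C (Im z + 1 / Im z))`. -/
def HasExpGrowth (f : ℂ → ℂ) : Prop :=
  ∃ C : ℝ, 0 ≤ C ∧ ∀ z : ℂ, 0 < z.im → ‖f z‖ ≤ Real.exp (C * (z.im + 1 / z.im))

namespace HasExpGrowth

variable {f g : ℂ → ℂ}

lemma mul (hf : HasExpGrowth f) (hg : HasExpGrowth g) : HasExpGrowth fun z => f z * g z := by
  obtain ⟨C, hC, hf⟩ := hf
  obtain ⟨D, hD, hg⟩ := hg
  refine ⟨C + D, by positivity, fun z hz => ?_⟩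
  rw [norm_mul, add_mul, Real.exp_add]
  exact mul_le_mul (hf z hz) (hg z hz) (norm_nonneg _) (Real.exp_pos _).le

lemma prod {ι : Type*} (s : Finset ι) {f : ι → ℂ → ℂ} (hf : ∀ i ∈ s, HasExpGrowth (f i)) :
    HasExpGrowth fun z => ∏ i ∈ s, f i z := by
  classical
  induction s using Finset.induction_on with
  | empty => exact ⟨0, le_rfl, fun z _ => by simp⟩
  | insert i s hi ih =>
    simp only [Finset.prod_insert hi]
    exact (hf i (Finset.mem_insert_self i s)).mul
      (ih fun j hj => hf j (Finset.mem_insert_of_mem hj))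

lemma two_le_exp {y : ℝ} (hy : 0 < y) : 2 ≤ Real.exp (y + 1 / y) := by
  have h : 2 ≤ y + 1 / y := by
    have : y + 1 / y - 2 = (y - 1) ^ 2 / y := by field_simp; ring
    have : 0 ≤ (y - 1) ^ 2 / y := by positivity
    linarith
  linarith [Real.add_one_le_exp (y + 1 / y)]

lemma add (hf : HasExpGrowth f) (hg : HasExpGrowth g) : HasExpGrowth fun z => f z + g z := by
  obtain ⟨C, hC, hf⟩ := hf
  obtain ⟨D, hD, hg⟩ := hg
  refine ⟨1 + (C + D), by positivity, fun z hz => ?_⟩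
  have hy : 0 < z.im + 1 / z.im := by positivity
  have h1 : ‖f z‖ ≤ Real.exp ((C + D) * (z.im + 1 / z.im)) :=
    (hf z hz).trans (Real.exp_le_exp.2 (by gcongr; linarith))
  have h2 : ‖g z‖ ≤ Real.exp ((C + D) * (z.im + 1 / z.im)) :=
    (hg z hz).trans (Real.exp_le_exp.2 (by gcongr; linarith))
  rw [add_mul, one_mul, Real.exp_add]
  refine (norm_add_le _ _).trans ?_
  nlinarith [two_le_exp hz, Real.exp_pos ((C + D) * (z.im + 1 / z.im))]

lemma sum {ι : Type*} (s : Finset ι) {f : ι → ℂ → ℂ} (hf : ∀ i ∈ s, HasExpGrowth (f i)) :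
    HasExpGrowth fun z => ∑ i ∈ s, f i z := by
  classical
  induction s using Finset.induction_on with
  | empty => exact ⟨0, le_rfl, fun z _ => by simp⟩
  | insert i s hi ih =>
    simp only [Finset.sum_insert hi]
    exact (hf i (Finset.mem_insert_self i s)).add
      (ih fun j hj => hf j (Finset.mem_insert_of_mem hj))

lemma comp_mul (hf : HasExpGrowth f) {l : ℕ} (hl : 0 < l) : HasExpGrowth fun z => f (l * z) := by
  obtain ⟨C, hC, hf⟩ := hf
  refine ⟨C * l, by positivity, fun z hz => ?_⟩
  refine (hf _ (nat_mul_im_pos hl hz)).trans (Real.exp_le_exp.2 ?_)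
  have e : (l * z : ℂ).im = l * z.im := by simp
  have hl1 : (1 : ℝ) ≤ l := by exact_mod_cast hl
  rw [e, mul_assoc, mul_add (l : ℝ)]
  gcongr
  calc 1 / (l * z.im) ≤ 1 / (1 * z.im) := by gcongr
    _ = 1 * (1 / z.im) := by ring
    _ ≤ l * (1 / z.im) := by gcongr

/-- Invariance under a principal congruence subgroup turns crude growth into meromorphy at all
cusps: one may assume that `Re z` is bounded, and then `1 / Im (γ z)` is bounded by a multiple of
`Im z`. -/
lemma isHalfIntegralWeightForm (hf : HasExpGrowth f) (hinv : IsLevelInvariant f)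
    (hd : ∀ z : ℂ, 0 < z.im → DifferentiableAt ℂ f z) :
    IsHalfIntegralWeightForm 0 fun z : ℍ => f z := by
  refine ⟨?_, ?_, ?_⟩
  · rw [UpperHalfPlane.mdifferentiable_iff]
    have : DifferentiableOn ℂ f {z : ℂ | 0 < z.im} :=
      fun z hz => (hd z hz).differentiableWithinAt
    refine this.congr fun z hz => ?_
    simp [UpperHalfPlane.ofComplex_apply_of_im_pos hz]
  · obtain ⟨N, hN, h⟩ := hinv
    refine ⟨N * 4, by positivity, dvd_mul_left _ _, fun γ hγ z => ?_⟩
    rw [zpow_zero, one_mul]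
    exact h γ (Gamma_le_of_dvd (dvd_mul_right _ _) hγ) z
  · intro γ
    obtain ⟨N, hN, h⟩ := hinv
    obtain ⟨C, hC, hg⟩ := hf
    set K : ℝ := |((γ 1 0 : ℤ) : ℝ)| * (N + 1) + |((γ 1 1 : ℤ) : ℝ)| with hK
    refine ⟨C * (1 + K ^ 2), 1, fun z hz => ?_⟩
    simp only [Int.cast_zero, zero_div, Real.rpow_zero, mul_one, one_mul]
    -- A translation `T ^ (m N)`, whose conjugate by `γ` lies in `Γ(N)`, moves `Re z` into `[0, N]`.
    obtain ⟨m, hm0, hm1⟩ : ∃ m : ℤ, 0 ≤ z.re + (m * N : ℤ) ∧ z.re + (m * N : ℤ) ≤ N := by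
      have hN' : (0 : ℝ) < N := Nat.cast_pos.2 hN
      refine ⟨-⌊z.re / N⌋, ?_, ?_⟩
      · have := Int.floor_le (z.re / N)
        rw [le_div_iff₀ hN'] at this
        push_cast; linarith
      · have := (Int.lt_floor_add_one (z.re / N)).le
        rw [div_le_iff₀ hN'] at this
        push_cast; linarith
    set w : ℍ := ModularGroup.T ^ (m * N) • z with hw
    have hwre : w.re = z.re + (m * N : ℤ) := ModularGroup.re_T_zpow_smul z _
    have hwim : w.im = z.im := ModularGroup.im_T_zpow_smul z _
    have hTmem : ModularGroup.T ^ (m * N) ∈ CongruenceSubgroup.Gamma N := by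
      rw [CongruenceSubgroup.Gamma_mem, ModularGroup.coe_T_zpow]
      simp
    have hfw : f ((γ • z : ℍ) : ℂ) = f ((γ • w : ℍ) : ℂ) := by
      have := h _ ((CongruenceSubgroup.Gamma_normal N).conj_mem _ hTmem γ) (γ • z)
      rw [← this, hw, ← mul_smul, ← mul_smul, inv_mul_cancel_right]
    rw [hfw]
    refine (hg _ (γ • w).im_pos).trans (Real.exp_le_exp.2 ?_)
    rw [mul_assoc]
    refine mul_le_mul_of_nonneg_left ?_ hC
    have him : (γ • w).im = w.im / Complex.normSq (((γ 1 0 : ℤ) : ℂ) * w + ((γ 1 1 : ℤ) : ℂ)) := by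
      rw [ModularGroup.im_smul_eq_div_normSq, ModularGroup.denom_apply]
    have hns : Complex.normSq (((γ 1 0 : ℤ) : ℂ) * w + ((γ 1 1 : ℤ) : ℂ)) =
        (((γ 1 0 : ℤ) : ℝ) * w.re + ((γ 1 1 : ℤ) : ℝ)) ^ 2 + (((γ 1 0 : ℤ) : ℝ) * w.im) ^ 2 := by
      rw [Complex.normSq_apply]
      simp
      ring
    rw [hns] at him
    change (γ • w).im + 1 / (γ • w).im ≤ _
    rw [him, hwim]
    set c : ℝ := ((γ 1 0 : ℤ) : ℝ) with hcdef
    set d : ℝ := ((γ 1 1 : ℤ) : ℝ) with hddef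
    set y := z.im
    have hx0 : 0 ≤ w.re := hwre ▸ hm0
    have hx1 : w.re ≤ N := hwre ▸ hm1
    -- Bounds for `|c w + d|²`: below by `1` since `Im z ≥ 1`, above by a multiple of `(Im z)²`.
    have hD1 : 1 ≤ (c * w.re + d) ^ 2 + (c * y) ^ 2 := by
      by_cases hc : γ 1 0 = 0
      · have hdet := γ.det_coe
        rw [Matrix.det_fin_two, hc, mul_zero, sub_zero] at hdet
        have hd2 : (γ 1 1) ^ 2 = 1 := by
          rcases Int.isUnit_iff.1 (IsUnit.of_mul_eq_one _ ((mul_comm _ _).trans hdet)) with h | h <;>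
            rw [h] <;> norm_num
        have hd2' : d ^ 2 = 1 := by rw [hddef]; exact_mod_cast hd2
        have hc' : c = 0 := by rw [hcdef, hc]; simp
        rw [hc']; nlinarith
      · have hc1 : 1 ≤ c ^ 2 := by
          have : 1 ≤ (γ 1 0) ^ 2 := by
            have := sq_nonneg (γ 1 0)
            have : (γ 1 0) ^ 2 ≠ 0 := pow_ne_zero 2 hc
            omega
          rw [hcdef]; exact_mod_cast this
        nlinarith [sq_nonneg (c * w.re + d), mul_pow c y 2]
    have hD2 : (c * w.re + d) ^ 2 + (c * y) ^ 2 ≤ (K * y) ^ 2 := by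
      have hN0 : (0 : ℝ) ≤ N := Nat.cast_nonneg N
      have h1 : |c * w.re + d| ≤ (|c| * N + |d|) * y := by
        calc |c * w.re + d| ≤ |c| * w.re + |d| := by
              refine (abs_add_le _ _).trans ?_
              rw [abs_mul, abs_of_nonneg hx0]
          _ ≤ (|c| * N + |d|) * 1 := by rw [mul_one]; gcongr
          _ ≤ _ := by gcongr
      have h2 : |c * y| = |c| * y := by rw [abs_mul, abs_of_pos z.im_pos]
      have h3 : (c * w.re + d) ^ 2 ≤ ((|c| * N + |d|) * y) ^ 2 := sq_le_sq' (abs_le.1 h1).1 (abs_le.1 h1).2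
      have h4 : (c * y) ^ 2 = (|c| * y) ^ 2 := by rw [← sq_abs, h2]
      rw [h4, hK]
      have h5 : 0 ≤ (|c| * N + |d|) * y := by have := z.im_pos; positivity
      have h6 : 0 ≤ |c| * y := by have := z.im_pos; positivity
      nlinarith
    have h1 : y / ((c * w.re + d) ^ 2 + (c * y) ^ 2) ≤ y := div_le_self (by linarith) hD1
    have h2 : 1 / (y / ((c * w.re + d) ^ 2 + (c * y) ^ 2)) ≤ K ^ 2 * y := by
      rw [one_div_div, div_le_iff₀ (by linarith)]
      linarith
    linarith

end HasExpGrowth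

/-! ### Bounds for the eta function -/

lemma sum_pow_succ_le {x : ℝ} (h0 : 0 ≤ x) (h1 : x < 1) (n : ℕ) :
    ∑ i ∈ Finset.range n, x ^ (i + 1) ≤ x / (1 - x) := by
  simp only [pow_succ]
  rw [← Finset.sum_mul, mul_comm, div_eq_mul_inv]
  refine mul_le_mul_of_nonneg_left ?_ h0
  rw [← tsum_geometric_of_lt_one h0 h1]
  exact (summable_geometric_of_lt_one h0 h1).sum_le_tsum _ fun i _ => pow_nonneg h0 i

lemma norm_qFactorial_le {Q : ℂ} (hQ : ‖Q‖ < 1) (n : ℕ) :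
    ‖qFactorial Q n‖ ≤ Real.exp (‖Q‖ / (1 - ‖Q‖)) := by
  rw [qFactorial, norm_prod]
  calc ∏ i ∈ Finset.range n, ‖1 - Q ^ (i + 1)‖
      ≤ ∏ i ∈ Finset.range n, Real.exp (‖Q‖ ^ (i + 1)) := by
        refine Finset.prod_le_prod (fun _ _ => norm_nonneg _) fun i _ => ?_
        have := Real.add_one_le_exp (‖Q‖ ^ (i + 1))
        have h2 := norm_sub_le 1 (Q ^ (i + 1))
        rw [norm_one, norm_pow] at h2
        linarith
    _ = Real.exp (∑ i ∈ Finset.range n, ‖Q‖ ^ (i + 1)) := (Real.exp_sum _ _).symm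
    _ ≤ _ := Real.exp_le_exp.2 (sum_pow_succ_le (norm_nonneg _) hQ n)

/-- Among the points of given absolute value the product is smallest at the positive real one. -/
lemma norm_qFactorial_ofReal_norm_le {Q : ℂ} (hQ : ‖Q‖ < 1) (n : ℕ) :
    ‖qFactorial (‖Q‖ : ℂ) n‖ ≤ ‖qFactorial Q n‖ := by
  rw [qFactorial, qFactorial, norm_prod, norm_prod]
  refine Finset.prod_le_prod (fun _ _ => norm_nonneg _) fun i _ => ?_
  have h1 : ‖Q‖ ^ (i + 1) < 1 := pow_lt_one₀ (norm_nonneg _) hQ i.succ_ne_zero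
  have h2 := norm_sub_norm_le 1 (Q ^ (i + 1))
  rw [norm_one, norm_pow] at h2
  have h3 : ‖(1 : ℂ) - (‖Q‖ : ℂ) ^ (i + 1)‖ = 1 - ‖Q‖ ^ (i + 1) := by
    rw [← Complex.ofReal_pow, ← Complex.ofReal_one, ← Complex.ofReal_sub, Complex.norm_real,
      Real.norm_of_nonneg (by linarith)]
  linarith

/-- The logarithm of `1 - t` is at least `-2 t` on `[0, 1/2]`. -/
lemma exp_neg_two_mul_le {t : ℝ} (h0 : 0 ≤ t) (h1 : t ≤ 1 / 2) : Real.exp (-(2 * t)) ≤ 1 - t := by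
  rw [Real.exp_neg, inv_le_comm₀ (Real.exp_pos _) (by linarith)]
  calc (1 - t)⁻¹ ≤ 2 * t + 1 := by
        rw [inv_le_iff_one_le_mul₀ (by linarith)]
        nlinarith
    _ ≤ _ := Real.add_one_le_exp _

lemma exp_neg_two_le_norm_qFactorial {Q : ℂ} (hQ : ‖Q‖ ≤ 1 / 2) (n : ℕ) :
    Real.exp (-2) ≤ ‖qFactorial Q n‖ := by
  rw [qFactorial, norm_prod]
  have hle : ∀ i, ‖Q‖ ^ (i + 1) ≤ ‖Q‖ := fun i => by
    simpa using pow_le_pow_of_le_one (norm_nonneg Q) (by linarith) (Nat.le_add_left 1 i)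
  calc Real.exp (-2) ≤ Real.exp (∑ i ∈ Finset.range n, -(2 * ‖Q‖ ^ (i + 1))) := by
        refine Real.exp_le_exp.2 ?_
        rw [Finset.sum_neg_distrib, ← Finset.mul_sum]
        have h := sum_pow_succ_le (norm_nonneg Q) (by linarith) n
        have : ‖Q‖ / (1 - ‖Q‖) ≤ 1 := by
          rw [div_le_one (by linarith)]; linarith
        linarith
    _ = ∏ i ∈ Finset.range n, Real.exp (-(2 * ‖Q‖ ^ (i + 1))) := Real.exp_sum _ _
    _ ≤ _ := by
        refine Finset.prod_le_prod (fun _ _ => (Real.exp_pos _).le) fun i _ => ?_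
        have h2 := norm_sub_norm_le 1 (Q ^ (i + 1))
        rw [norm_one, norm_pow] at h2
        exact (exp_neg_two_mul_le (by positivity) ((hle i).trans hQ)).trans h2

lemma norm_tprod_le {Q : ℂ} (hQ : ‖Q‖ < 1) :
    ‖∏' n : ℕ, (1 - Q ^ (n + 1))‖ ≤ Real.exp (‖Q‖ / (1 - ‖Q‖)) :=
  le_of_tendsto (tendsto_qFactorial hQ).norm (Filter.Eventually.of_forall (norm_qFactorial_le hQ))

lemma norm_tprod_ofReal_norm_le {Q : ℂ} (hQ : ‖Q‖ < 1) :
    ‖∏' n : ℕ, (1 - (‖Q‖ : ℂ) ^ (n + 1))‖ ≤ ‖∏' n : ℕ, (1 - Q ^ (n + 1))‖ :=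
  le_of_tendsto_of_tendsto' (tendsto_qFactorial (by simpa using hQ)).norm
    (tendsto_qFactorial hQ).norm (norm_qFactorial_ofReal_norm_le hQ)

lemma exp_neg_two_le_norm_tprod {Q : ℂ} (hQ : ‖Q‖ ≤ 1 / 2) :
    Real.exp (-2) ≤ ‖∏' n : ℕ, (1 - Q ^ (n + 1))‖ :=
  ge_of_tendsto (tendsto_qFactorial (by linarith)).norm
    (Filter.Eventually.of_forall (exp_neg_two_le_norm_qFactorial hQ))

lemma norm_eta (τ : ℂ) : ‖ModularForm.eta τ‖ =
    Real.exp (-(Real.pi * τ.im / 12)) * ‖∏' n : ℕ, (1 - expTwoPiI τ ^ (n + 1))‖ := by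
  rw [eta_eq_tprod, norm_mul, norm_expTwoPiI]
  congr 2
  have : (τ / 24).im = τ.im / 24 := by
    rw [show (24 : ℂ) = ((24 : ℝ) : ℂ) by norm_num, Complex.div_ofReal_im]
  rw [this]; ring

lemma hasExpGrowth_eta : HasExpGrowth ModularForm.eta := by
  refine ⟨1, zero_le_one, fun z hz => ?_⟩
  have hpi := Real.pi_gt_three
  have hQ := norm_expTwoPiI_lt_one hz
  rw [norm_eta]
  have h1 : Real.exp (-(Real.pi * z.im / 12)) ≤ 1 := Real.exp_le_one_iff.2 (by
    have : 0 ≤ Real.pi * z.im / 12 := by positivity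
    linarith)
  have h2 : ‖expTwoPiI z‖ / (1 - ‖expTwoPiI z‖) ≤ 1 / z.im := by
    rw [div_le_div_iff₀ (by linarith) hz]
    have h3 : ‖expTwoPiI z‖ * Real.exp (2 * Real.pi * z.im) = 1 := by
      rw [norm_expTwoPiI, ← Real.exp_add]; simp
    have h4 := Real.add_one_le_exp (2 * Real.pi * z.im)
    have h5 : ‖expTwoPiI z‖ * (2 * Real.pi * z.im + 1) ≤ 1 :=
      (mul_le_mul_of_nonneg_left h4 (norm_nonneg _)).trans_eq h3
    have h6 : 0 ≤ ‖expTwoPiI z‖ * z.im := by positivity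
    nlinarith
  calc _ ≤ 1 * Real.exp (1 / z.im) := by
        refine mul_le_mul h1 ((norm_tprod_le hQ).trans (Real.exp_le_exp.2 h2)) (norm_nonneg _)
          zero_le_one
    _ ≤ _ := by
        rw [one_mul, one_mul]
        exact Real.exp_le_exp.2 (by linarith)

/-- Along the imaginary axis, the product of `η` is bounded below for `y ≥ 1`; for `y ≤ 1` use the
functional equation. -/
lemma exp_le_norm_eta_I {y : ℝ} (hy : 0 < y) :
    Real.exp (-(3 * (y + 1 / y))) ≤ ‖ModularForm.eta (Complex.I * y)‖ := by
  have key : ∀ y : ℝ, 1 ≤ y → Real.exp (-(3 * y)) ≤ ‖ModularForm.eta (Complex.I * y)‖ := by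
    intro y hy
    have him : (Complex.I * y).im = y := by simp
    have hpi := Real.pi_gt_three
    have hpi' := Real.pi_lt_four
    rw [norm_eta, him]
    have hQ : ‖expTwoPiI (Complex.I * y)‖ ≤ 1 / 2 := by
      rw [norm_expTwoPiI, him, Real.exp_neg, ← one_div]
      refine one_div_le_one_div_of_le two_pos ?_
      nlinarith [Real.add_one_le_exp (2 * Real.pi * y)]
    calc Real.exp (-(3 * y)) ≤ Real.exp (-(Real.pi * y / 12)) * Real.exp (-2) := by
          rw [← Real.exp_add]
          refine Real.exp_le_exp.2 ?_
          nlinarith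
      _ ≤ _ := by
          gcongr
          exact exp_neg_two_le_norm_tprod hQ
  rcases le_total 1 y with h | h
  · refine le_trans (Real.exp_le_exp.2 ?_) (key y h)
    have : 0 < 1 / y := by positivity
    linarith
  · have hy' : 1 ≤ 1 / y := by rw [le_div_iff₀ hy]; linarith
    have hτ : 0 < (Complex.I * (1 / y : ℝ)).im := by simp [hy]
    have e := eta_neg_inv hτ
    have e1 : -1 / (Complex.I * (1 / y : ℝ)) = Complex.I * y := by
      have : (y : ℂ) ≠ 0 := by exact_mod_cast hy.ne'
      push_cast
      field_simp
      simp
    have e2 : -Complex.I * (Complex.I * (1 / y : ℝ)) = ((1 / y : ℝ) : ℂ) := by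
      rw [← mul_assoc, neg_mul, Complex.I_mul_I, neg_neg, one_mul]
    have e3 : ((1 / 2 : ℂ)) = ((1 / 2 : ℝ) : ℂ) := by norm_num
    rw [e1, e2, e3, ← Complex.ofReal_cpow (by positivity)] at e
    rw [e, norm_mul, Complex.norm_real, Real.norm_of_nonneg (by positivity)]
    calc Real.exp (-(3 * (y + 1 / y))) ≤ 1 * Real.exp (-(3 * (1 / y))) := by
          rw [one_mul]
          exact Real.exp_le_exp.2 (by linarith)
      _ ≤ _ := by
          gcongr
          · exact Real.one_le_rpow hy' (by norm_num)
          · exact key _ hy'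

/-- The absolute value of `η` on a horizontal line is smallest on the imaginary axis, where
`exp_le_norm_eta_I` bounds it. -/
lemma hasExpGrowth_inv_eta : HasExpGrowth fun z => (ModularForm.eta z)⁻¹ := by
  refine ⟨3, by norm_num, fun z hz => ?_⟩
  have h := exp_le_norm_eta_I hz
  have him : (Complex.I * z.im).im = z.im := by simp
  have hQ := norm_expTwoPiI_lt_one hz
  have e : expTwoPiI (Complex.I * z.im) = (‖expTwoPiI z‖ : ℂ) := by
    rw [norm_expTwoPiI, expTwoPiI, Complex.ofReal_exp]
    congr 1
    push_cast
    linear_combination (2 * Real.pi * z.im : ℂ) * Complex.I_mul_I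
  have hle : Real.exp (-(3 * (z.im + 1 / z.im))) ≤ ‖ModularForm.eta z‖ := by
    refine h.trans ?_
    rw [norm_eta, norm_eta, him, e]
    gcongr
    exact norm_tprod_ofReal_norm_le hQ
  rw [norm_inv, inv_le_comm₀ ((Real.exp_pos _).trans_le hle) (Real.exp_pos _), ← Real.exp_neg]
  exact hle

/-! ### The quotients are modular forms -/

section

variable {ι : Type*} [Fintype ι] {a : ℕ}

lemma gaussBound_le_exp {y : ℝ} (hy : 0 < y) {l : ℕ} (hl : 0 < l) :
    gaussBound (2 * Real.pi * y * l) ≤ Real.exp ((2 * Real.pi * l + 5) * (y + 1 / y)) := by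
  have hl1 : (1 : ℝ) ≤ l := by exact_mod_cast hl
  have hpi := Real.pi_gt_three
  have h1 : 2 ≤ y + 1 / y := by
    have : y + 1 / y - 2 = (y - 1) ^ 2 / y := by field_simp; ring
    have : 0 ≤ (y - 1) ^ 2 / y := by positivity
    linarith
  set t := 2 * Real.pi * y * l with ht
  have htpos : 0 < t := by positivity
  have h3 : 4 / t ≤ 4 * (1 / y) := by
    rw [div_le_iff₀ htpos, ht]
    have : 4 * (1 / y) * (2 * Real.pi * y * l) = 4 * (2 * Real.pi * l) := by field_simp
    rw [this]; nlinarith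
  rw [gaussBound]
  calc Real.exp t * (2 * (1 + 2 / t)) ≤ Real.exp t * Real.exp (1 + 4 / t) := by
        gcongr
        have := Real.add_one_le_exp (1 + 4 / t)
        have e : 2 * (1 + 2 / t) = 1 + 4 / t + 1 := by ring
        linarith
    _ = Real.exp (t + (1 + 4 / t)) := (Real.exp_add _ _).symm
    _ ≤ _ := by
        refine Real.exp_le_exp.2 ?_
        have h4 : 0 < 1 / y := by positivity
        have h5 : t ≤ 2 * Real.pi * l * (y + 1 / y) := by
          have : 0 ≤ 2 * Real.pi * l * (1 / y) := by positivity
          rw [ht]; linarith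
        linarith

/-- The theta series is bounded uniformly in `n`, the centre of the Gaussian being irrelevant. -/
lemma norm_weightTheta_le (l : ι → ℕ) (hl : ∀ s, 0 < l s) (c : ι → ZMod a) (k : ZMod a) (n : ℕ)
    {z : ℂ} (hz : 0 < z.im) :
    ‖weightTheta l c k n z‖ ≤ ∏ s, gaussBound (2 * Real.pi * z.im * l s) := by
  have hpi := Real.pi_pos
  obtain ⟨h1, h2⟩ := summable_exp_weightNorm_subtype_and_le l hl
    (t := 2 * Real.pi * z.im) (by positivity) (n / a) (weightCoset l c k n)
  have e : ∀ x : weightCoset l c k n, ‖expTwoPiI (z * (weightNorm l (n / a) x.1 : ℝ))‖ =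
      Real.exp (-(2 * Real.pi * z.im) * weightNorm l (n / a) x.1) := by
    intro x
    rw [norm_expTwoPiI, Complex.im_mul_ofReal]
    congr 1; ring
  refine le_trans ?_ h2
  rw [weightTheta]
  simp only [← e] at h1 ⊢
  exact norm_tsum_le_tsum_norm h1

lemma hasExpGrowth_weightTheta (l : ι → ℕ) (hl : ∀ s, 0 < l s) (c : ι → ZMod a) (k : ZMod a)
    (n : ℕ) : HasExpGrowth (weightTheta l c k n) := by
  refine ⟨∑ s, (2 * Real.pi * l s + 5), by positivity, fun z hz => ?_⟩
  refine (norm_weightTheta_le l hl c k n hz).trans ?_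
  rw [Finset.sum_mul, Real.exp_sum]
  exact Finset.prod_le_prod (fun s _ => (gaussBound_pos (by
    have := Nat.cast_pos (α := ℝ).2 (hl s); positivity)).le) fun s _ => gaussBound_le_exp hz (hl s)

lemma hasExpGrowth_weightForm (l : ι → ℕ) (hl : ∀ s, 0 < l s) (c : ι → ZMod a) (k : ZMod a)
    (n : ℕ) : HasExpGrowth (weightForm l c k n) := by
  have h := (hasExpGrowth_eta.mul (hasExpGrowth_weightTheta l hl c k n)).mul
    (HasExpGrowth.prod Finset.univ fun s _ => hasExpGrowth_inv_eta.comp_mul (hl s))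
  simp only [Finset.prod_inv_distrib, ← div_eq_mul_inv] at h
  exact h

end

/-! ### Power series with integer coefficients -/

/-- In a summable family of monomials with non-zero integer coefficients, every exponent occurs
finitely often. -/
lemma finite_fiber_of_summable {X : Type*} (w : X → ℤ) (hw : ∀ x, w x ≠ 0) (e : X → ℕ) {Q : ℂ}
    (hQ : Q ≠ 0) (h : Summable fun x => (w x : ℂ) * Q ^ e x) (j : ℕ) : (e ⁻¹' {j}).Finite := by
  have h1 := (h.norm.subtype (e ⁻¹' {j}))
  by_contra hinf
  have : Infinite (e ⁻¹' {j}) := Set.infinite_coe_iff.2 hinf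
  have h2 : Summable fun _ : e ⁻¹' {j} => ‖Q‖ ^ j := by
    refine Summable.of_nonneg_of_le (fun _ => by positivity) (fun x => ?_) h1
    have hx : e x.1 = j := x.2
    have hwx : (1 : ℝ) ≤ ‖(w x.1 : ℂ)‖ := by
      rw [Complex.norm_intCast]
      exact_mod_cast Int.one_le_abs (hw x.1)
    simp only [Function.comp, norm_mul, norm_pow, hx]
    nlinarith [pow_nonneg (norm_nonneg Q) j]
  rw [summable_const_iff] at h2
  exact (pow_pos (norm_pos_iff.2 hQ) j).ne' h2

/-- Collecting the terms with equal exponents. -/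
lemma hasSum_collect {X : Type*} (w : X → ℤ) (e : X → ℕ) (hfin : ∀ j, (e ⁻¹' {j}).Finite) {Q v : ℂ}
    (h : HasSum (fun x => (w x : ℂ) * Q ^ e x) v) :
    HasSum (fun j => ((∑' x : e ⁻¹' {j}, w x.1 : ℤ) : ℂ) * Q ^ j) v := by
  have h1 := h.tsum_fiberwise e
  have e1 : (fun j => ∑' x : e ⁻¹' {j}, (w x.1 : ℂ) * Q ^ e x.1) =
      fun j => ((∑' x : e ⁻¹' {j}, w x.1 : ℤ) : ℂ) * Q ^ j := by
    funext j
    have := (hfin j).fintype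
    rw [tsum_fintype, tsum_fintype, Int.cast_sum, Finset.sum_mul]
    refine Finset.sum_congr rfl fun x _ => ?_
    rw [show e x.1 = j from x.2]
  rw [e1] at h1
  exact h1

/-- Substituting a higher power for the variable, with zeros as the remaining coefficients. -/
lemma hasSum_pow_extend {p : ℕ → ℤ} {g : ℕ → ℕ} (hg : Function.Injective g) {w v : ℂ}
    (h : HasSum (fun j => (p j : ℂ) * w ^ g j) v) :
    HasSum (fun i => ((Function.extend g p 0 i : ℤ) : ℂ) * w ^ i) v := by
  rw [← hg.hasSum_iff]
  · have : (fun i => ((Function.extend g p 0 i : ℤ) : ℂ) * w ^ i) ∘ g =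
        fun j => (p j : ℂ) * w ^ g j := by
      funext j
      simp [hg.extend_apply]
    rw [this]
    exact h
  · intro i hi
    rw [Function.extend_apply' _ _ _ hi]
    simp

lemma hasSum_mul_antidiagonal {p r : ℕ → ℤ} {w v v' : ℂ}
    (h : HasSum (fun j => (p j : ℂ) * w ^ j) v) (h' : HasSum (fun j => (r j : ℂ) * w ^ j) v') :
    HasSum (fun n => ((∑ x ∈ Finset.HasAntidiagonal.antidiagonal n, p x.1 * r x.2 : ℤ) : ℂ) * w ^ n) (v * v') := by
  have h1 := tsum_mul_tsum_eq_tsum_sum_antidiagonal_of_summable_norm h.summable.norm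
    h'.summable.norm
  have h2 := (summable_norm_sum_mul_antidiagonal_of_summable_norm h.summable.norm
    h'.summable.norm).of_norm.hasSum
  rw [← h1, h.tsum_eq, h'.tsum_eq] at h2
  have e : (fun n => ∑ x ∈ Finset.HasAntidiagonal.antidiagonal n, (p x.1 : ℂ) * w ^ x.1 * ((r x.2 : ℂ) * w ^ x.2)) =
      fun n => ((∑ x ∈ Finset.HasAntidiagonal.antidiagonal n, p x.1 * r x.2 : ℤ) : ℂ) * w ^ n := by
    funext n
    push_cast
    rw [Finset.sum_mul]
    refine Finset.sum_congr rfl fun x hx => ?_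
    rw [← Finset.HasAntidiagonal.mem_antidiagonal.1 hx, pow_add]
    ring
  rw [e] at h2
  exact h2

lemma hasFPowerSeriesOnBall_of_hasSum {c : ℕ → ℂ} {G : ℂ → ℂ}
    (h : ∀ w : ℂ, ‖w‖ < 1 → HasSum (fun j => c j * w ^ j) (G w)) :
    HasFPowerSeriesOnBall G (FormalMultilinearSeries.ofScalars ℂ c) 0 1 where
  r_le := by
    refine ENNReal.le_of_forall_nnreal_lt fun r hr => ?_
    have hr' : (r : ℝ) < 1 := by exact_mod_cast hr
    refine FormalMultilinearSeries.le_radius_of_summable_norm _ ?_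
    have := (h (r : ℝ) (by simpa using hr')).summable.norm
    refine this.congr fun n => ?_
    simp
  r_pos := one_pos
  hasSum := by
    intro y hy
    have hy' : ‖y‖ < 1 := by simpa [← ENNReal.ofReal_one, ← ofReal_norm, ENNReal.ofReal_lt_ofReal_iff] using hy
    simp only [FormalMultilinearSeries.ofScalars_apply_eq, smul_eq_mul, zero_add]
    exact h y hy'

/-- The inverse of a non-vanishing power series with integer coefficients and constant term `1`
again has integer coefficients. -/
lemma exists_hasSum_inv {p : ℕ → ℤ} (hp : p 0 = 1) {G : ℂ → ℂ}
    (h : ∀ w : ℂ, ‖w‖ < 1 → HasSum (fun j => (p j : ℂ) * w ^ j) (G w))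
    (hG : ∀ w : ℂ, ‖w‖ < 1 → G w ≠ 0) :
    ∃ d : ℕ → ℤ, ∀ w : ℂ, ‖w‖ < 1 → HasSum (fun j => (d j : ℂ) * w ^ j) (G w)⁻¹ := by
  have hG1 := hasFPowerSeriesOnBall_of_hasSum h
  have hd : DifferentiableOn ℂ (fun w => (G w)⁻¹) (Metric.ball 0 1) := by
    have := hG1.differentiableOn
    rw [← ENNReal.coe_one, Metric.eball_coe] at this
    exact this.inv fun w hw => hG w (by simpa using hw)
  set c : ℕ → ℂ := fun n => (n.factorial : ℂ)⁻¹ * iteratedDeriv n (fun w => (G w)⁻¹) 0 with hc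
  have hs : ∀ w : ℂ, ‖w‖ < 1 → HasSum (fun j => c j * w ^ j) (G w)⁻¹ := by
    intro w hw
    have := Complex.hasSum_taylorSeries_on_ball hd (z := w) (by simpa using hw)
    have e : (fun n : ℕ => (n.factorial : ℂ)⁻¹ • (w - 0) ^ n •
        iteratedDeriv n (fun w => (G w)⁻¹) 0) = fun j => c j * w ^ j := by
      funext n
      simp only [sub_zero, smul_eq_mul, hc]
      ring
    rw [e] at this
    exact this
  have hone : ∀ w : ℂ, ‖w‖ < 1 →
      HasSum (fun n => (∑ x ∈ Finset.HasAntidiagonal.antidiagonal n, (p x.1 : ℂ) * c x.2) * w ^ n) 1 := by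
    intro w hw
    have h1 := tsum_mul_tsum_eq_tsum_sum_antidiagonal_of_summable_norm (h w hw).summable.norm
      (hs w hw).summable.norm
    have h2 := (summable_norm_sum_mul_antidiagonal_of_summable_norm (h w hw).summable.norm
      (hs w hw).summable.norm).of_norm.hasSum
    rw [← h1, (h w hw).tsum_eq, (hs w hw).tsum_eq, mul_inv_cancel₀ (hG w hw)] at h2
    have e : (fun n => ∑ x ∈ Finset.HasAntidiagonal.antidiagonal n, (p x.1 : ℂ) * w ^ x.1 * (c x.2 * w ^ x.2)) =
        fun n => (∑ x ∈ Finset.HasAntidiagonal.antidiagonal n, (p x.1 : ℂ) * c x.2) * w ^ n := by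
      funext n
      rw [Finset.sum_mul]
      refine Finset.sum_congr rfl fun x hx => ?_
      rw [← Finset.HasAntidiagonal.mem_antidiagonal.1 hx, pow_add]
      ring
    rw [e] at h2
    exact h2
  have hone' : ∀ w : ℂ, ‖w‖ < 1 → HasSum (fun n => (if n = 0 then (1 : ℂ) else 0) * w ^ n) 1 := by
    intro w _
    have := hasSum_single (f := fun n => (if n = 0 then (1 : ℂ) else 0) * w ^ n) 0
      fun n hn => by simp [hn]
    simpa using this
  have hconv := FormalMultilinearSeries.ofScalars_series_injective ℂ ℂ
    ((hasFPowerSeriesOnBall_of_hasSum (G := fun _ => 1) hone).hasFPowerSeriesAt.eq_formalMultilinearSeries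
    (hasFPowerSeriesOnBall_of_hasSum (G := fun _ => 1) hone').hasFPowerSeriesAt)
  -- The recursion for the coefficients of the inverse divides by `p 0 = 1` only.
  have hint : ∀ n, ∃ d : ℤ, c n = d := by
    intro n
    induction n using Nat.strong_induction_on with
    | _ n ih =>
      have h1 := congrFun hconv n
      rw [← Finset.add_sum_erase _ _ (show (0, n) ∈ Finset.HasAntidiagonal.antidiagonal n by simp), hp] at h1
      choose! d hd using ih
      have h2 : ∑ x ∈ (Finset.HasAntidiagonal.antidiagonal n).erase (0, n), (p x.1 : ℂ) * c x.2 =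
          ((∑ x ∈ (Finset.HasAntidiagonal.antidiagonal n).erase (0, n), p x.1 * d x.2 : ℤ) : ℂ) := by
        push_cast
        refine Finset.sum_congr rfl fun x hx => ?_
        rw [Finset.mem_erase, Finset.HasAntidiagonal.mem_antidiagonal] at hx
        rw [hd x.2]
        rcases Nat.eq_zero_or_pos x.1 with h0 | h0
        · exact absurd (Prod.ext h0 (by omega)) hx.1
        · omega
      refine ⟨(if n = 0 then 1 else 0) - ∑ x ∈ (Finset.HasAntidiagonal.antidiagonal n).erase (0, n), p x.1 * d x.2, ?_⟩
      rw [h2] at h1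
      push_cast at h1 ⊢
      linear_combination h1
  choose d hd using hint
  refine ⟨d, fun w hw => ?_⟩
  simp only [← hd]
  exact hs w hw

/-- The coefficients of `∏ (1 - Qⁿ)` are integers. -/
lemma exists_hasSum_tprod : ∃ p : ℕ → ℤ, p 0 = 1 ∧ ∀ w : ℂ, ‖w‖ < 1 →
    HasSum (fun j => (p j : ℂ) * w ^ j) (∏' n : ℕ, (1 - w ^ (n + 1))) := by
  -- Expanding the product gives a sum over finite sets `s`, with sign `(-1) ^ |s|` and exponent `∑
  -- (i + 1)`.
  set W : Finset ℕ → ℤ := fun s => (-1) ^ s.card with hW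
  set e : Finset ℕ → ℕ := fun s => ∑ i ∈ s, (i + 1) with he
  have hs : ∀ w : ℂ, ‖w‖ < 1 → HasSum (fun s => (W s : ℂ) * w ^ e s) (∏' n : ℕ, (1 - w ^ (n + 1))) := by
    intro w hw
    have hsum : Summable fun n : ℕ => ‖-w ^ (n + 1)‖ := by
      simp only [norm_neg, norm_pow]
      simp only [pow_succ]
      exact (summable_geometric_of_lt_one (norm_nonneg _) hw).mul_right _
    have h1 := (summable_finsetProd_of_summable_norm hsum)
    have h2 := h1.hasSum
    rw [← tprod_one_add h1] at h2
    have e1 : (fun s : Finset ℕ => ∏ i ∈ s, -w ^ (i + 1)) = fun s => (W s : ℂ) * w ^ e s := by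
      funext s
      rw [Finset.prod_neg, Finset.prod_pow_eq_pow_sum]
      simp [hW, he]
    rw [e1] at h2
    simpa only [← sub_eq_add_neg] using h2
  have hfin := finite_fiber_of_summable W (fun s => pow_ne_zero _ (by norm_num)) e
    (Q := 1 / 2) (by norm_num) (hs (1 / 2) (by norm_num)).summable
  have hc := fun w hw => hasSum_collect W e hfin (hs w hw)
  refine ⟨_, ?_, hc⟩
  have h0 := hc 0 (by simp)
  have h1 := h0.unique (hasSum_single 0 fun n hn => by simp [hn])
  simpa using h1.symm

/-! ### Integral Laurent expansions -/

/-- `f` is given by a Laurent series in `exp(2πiz/N)` with integer coefficients. -/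
def IsIntegralLaurent (f : ℂ → ℂ) : Prop :=
  ∃ N : ℕ, 0 < N ∧ ∃ (m : ℤ) (p : ℕ → ℤ), ∀ z : ℂ, 0 < z.im →
    HasSum (fun j => (p j : ℂ) * expTwoPiI (z / N) ^ j) (expTwoPiI (m * (z / N)) * f z)

namespace IsIntegralLaurent

variable {f g : ℂ → ℂ}

lemma congr (hf : IsIntegralLaurent f) (h : ∀ z : ℂ, 0 < z.im → g z = f z) :
    IsIntegralLaurent g := by
  obtain ⟨N, hN, m, p, hp⟩ := hf
  exact ⟨N, hN, m, p, fun z hz => by rw [h z hz]; exact hp z hz⟩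

lemma hasIntegralFourierExpansion (hf : IsIntegralLaurent f) :
    HasIntegralFourierExpansion fun z : ℍ => f z := by
  obtain ⟨N, hN, m, p, hp⟩ := hf
  refine ⟨N, hN, -m, p, fun z => ?_⟩
  have h := (hp z z.im_pos).mul_left (expTwoPiI (-(m * (z / N))))
  rw [← mul_assoc, ← expTwoPiI_add, neg_add_cancel, expTwoPiI_zero, one_mul] at h
  have e : (fun j : ℕ => expTwoPiI (-(m * ((z : ℂ) / N))) * ((p j : ℂ) * expTwoPiI (z / N) ^ j)) =
      fun j : ℕ => (p j : ℂ) *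
        Complex.exp (2 * Real.pi * Complex.I * (((-m + j : ℤ) : ℂ) / N) * (z : ℂ)) := by
    funext j
    rw [mul_left_comm, expTwoPiI_pow, ← expTwoPiI_add, expTwoPiI]
    congr 2
    push_cast
    ring
  rw [e] at h
  exact h

/-- The level may be replaced by a multiple. -/
lemma exists_level {N : ℕ} (hN : 0 < N) {m : ℤ} {p : ℕ → ℤ} (hp : ∀ z : ℂ, 0 < z.im →
    HasSum (fun j => (p j : ℂ) * expTwoPiI (z / N) ^ j) (expTwoPiI (m * (z / N)) * f z))
    {M : ℕ} (hM : 0 < M) : ∃ (m' : ℤ) (p' : ℕ → ℤ), ∀ z : ℂ, 0 < z.im →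
    HasSum (fun j => (p' j : ℂ) * expTwoPiI (z / (N * M : ℕ)) ^ j)
      (expTwoPiI (m' * (z / (N * M : ℕ))) * f z) := by
  have hM' : (M : ℂ) ≠ 0 := by exact_mod_cast hM.ne'
  have hN' : (N : ℂ) ≠ 0 := by exact_mod_cast hN.ne'
  refine ⟨m * M, Function.extend (fun j => M * j) p 0, fun z hz => ?_⟩
  have h := hp z hz
  have e1 : expTwoPiI (z / N) = expTwoPiI (z / (N * M : ℕ)) ^ M := by
    rw [expTwoPiI_pow]
    congr 1
    push_cast
    field_simp
  have e2 : (m : ℂ) * (z / N) = ((m * M : ℤ) : ℂ) * (z / (N * M : ℕ)) := by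
    push_cast
    field_simp
  simp only [e1, e2, ← pow_mul] at h
  exact hasSum_pow_extend (fun i j hij => Nat.eq_of_mul_eq_mul_left hM hij) h

/-- The order of the pole may be replaced by a larger one. -/
lemma exists_shift {N : ℕ} {m : ℤ} {p : ℕ → ℤ} (hp : ∀ z : ℂ, 0 < z.im →
    HasSum (fun j => (p j : ℂ) * expTwoPiI (z / N) ^ j) (expTwoPiI (m * (z / N)) * f z))
    {m' : ℤ} (hm : m ≤ m') : ∃ p' : ℕ → ℤ, ∀ z : ℂ, 0 < z.im →
    HasSum (fun j => (p' j : ℂ) * expTwoPiI (z / N) ^ j) (expTwoPiI (m' * (z / N)) * f z) := by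
  obtain ⟨d, rfl⟩ := Int.le.dest hm
  refine ⟨Function.extend (fun j => j + d) p 0, fun z hz => ?_⟩
  have h := (hp z hz).mul_left (expTwoPiI (z / N) ^ d)
  have e1 : expTwoPiI (z / N) ^ d * (expTwoPiI (m * (z / N)) * f z) =
      expTwoPiI ((m + d : ℤ) * (z / N)) * f z := by
    rw [← mul_assoc, expTwoPiI_pow, ← expTwoPiI_add]
    congr 2
    push_cast
    ring
  have e2 : (fun j => expTwoPiI (z / N) ^ d * ((p j : ℂ) * expTwoPiI (z / N) ^ j)) =
      fun j => (p j : ℂ) * expTwoPiI (z / N) ^ (j + d) := by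
    funext j
    rw [pow_add]; ring
  rw [e1, e2] at h
  exact hasSum_pow_extend (fun i j hij => Nat.add_right_cancel hij) h

lemma mul (hf : IsIntegralLaurent f) (hg : IsIntegralLaurent g) :
    IsIntegralLaurent fun z => f z * g z := by
  obtain ⟨N, hN, m₀, p₀, hp₀⟩ := hf
  obtain ⟨M, hM, m₁, p₁, hp₁⟩ := hg
  obtain ⟨m, p, hp⟩ := exists_level hN hp₀ hM
  obtain ⟨m', p', hp'⟩ := exists_level hM hp₁ hN
  rw [mul_comm M N] at hp'
  refine ⟨N * M, by positivity, m + m',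
    fun n => ∑ x ∈ Finset.HasAntidiagonal.antidiagonal n, p x.1 * p' x.2, fun z hz => ?_⟩
  have h := hasSum_mul_antidiagonal (hp z hz) (hp' z hz)
  rw [mul_mul_mul_comm, ← expTwoPiI_add, ← add_mul, ← Int.cast_add] at h
  exact h

lemma add (hf : IsIntegralLaurent f) (hg : IsIntegralLaurent g) :
    IsIntegralLaurent fun z => f z + g z := by
  obtain ⟨N, hN, m₀, p₀, hp₀⟩ := hf
  obtain ⟨M, hM, m₁, p₁, hp₁⟩ := hg
  obtain ⟨m, p, hp⟩ := exists_level hN hp₀ hM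
  obtain ⟨m', p', hp'⟩ := exists_level hM hp₁ hN
  rw [mul_comm M N] at hp'
  obtain ⟨r, hr⟩ := exists_shift hp (le_max_left m m')
  obtain ⟨r', hr'⟩ := exists_shift hp' (le_max_right m m')
  refine ⟨N * M, by positivity, max m m', fun j => r j + r' j, fun z hz => ?_⟩
  have h := (hr z hz).add (hr' z hz)
  simp only [← add_mul, ← mul_add] at h
  simp only [Int.cast_add]
  exact h

lemma intCast (c : ℤ) : IsIntegralLaurent fun _ => (c : ℂ) := by
  refine ⟨1, one_pos, 0, fun j => if j = 0 then c else 0, fun z _ => ?_⟩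
  have := hasSum_single (f := fun j =>
    (((if j = 0 then c else 0 : ℤ)) : ℂ) * expTwoPiI (z / (1 : ℕ)) ^ j) 0 fun n hn => by simp [hn]
  simpa [expTwoPiI_zero] using this

lemma prod {ι : Type*} (s : Finset ι) {f : ι → ℂ → ℂ} (hf : ∀ i ∈ s, IsIntegralLaurent (f i)) :
    IsIntegralLaurent fun z => ∏ i ∈ s, f i z := by
  classical
  induction s using Finset.induction_on with
  | empty => simpa using intCast 1
  | insert i s hi ih =>
    simp only [Finset.prod_insert hi]
    exact (hf i (Finset.mem_insert_self i s)).mul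
      (ih fun j hj => hf j (Finset.mem_insert_of_mem hj))

lemma sum {ι : Type*} (s : Finset ι) {f : ι → ℂ → ℂ} (hf : ∀ i ∈ s, IsIntegralLaurent (f i)) :
    IsIntegralLaurent fun z => ∑ i ∈ s, f i z := by
  classical
  induction s using Finset.induction_on with
  | empty => simpa using intCast 0
  | insert i s hi ih =>
    simp only [Finset.sum_insert hi]
    exact (hf i (Finset.mem_insert_self i s)).add
      (ih fun j hj => hf j (Finset.mem_insert_of_mem hj))

lemma comp_mul (hf : IsIntegralLaurent f) {l : ℕ} (hl : 0 < l) :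
    IsIntegralLaurent fun z => f (l * z) := by
  obtain ⟨N, hN, m, p, hp⟩ := hf
  refine ⟨N, hN, m * l, Function.extend (fun j => l * j) p 0, fun z hz => ?_⟩
  have h := hp _ (nat_mul_im_pos hl hz)
  have e1 : expTwoPiI (l * z / N) = expTwoPiI (z / N) ^ l := by
    rw [expTwoPiI_pow]
    congr 1
    ring
  have e2 : (m : ℂ) * (l * z / N) = ((m * l : ℤ) : ℂ) * (z / N) := by
    push_cast
    ring
  simp only [e1, e2, ← pow_mul] at h
  exact hasSum_pow_extend (fun i j hij => Nat.eq_of_mul_eq_mul_left hl hij) h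

/-- Pure powers `exp(2πi r z/N)`. -/
lemma expTwoPiI_mul_div (r : ℤ) {N : ℕ} (hN : 0 < N) :
    IsIntegralLaurent fun z => expTwoPiI (r * (z / N)) := by
  refine ⟨N, hN, -r, fun j => if j = 0 then 1 else 0, fun z _ => ?_⟩
  have := hasSum_single (f := fun j =>
    (((if j = 0 then 1 else 0 : ℤ)) : ℂ) * expTwoPiI (z / N) ^ j) 0 fun n hn => by simp [hn]
  rw [← expTwoPiI_add, ← add_mul, ← Int.cast_add, neg_add_cancel, Int.cast_zero, zero_mul,
    expTwoPiI_zero]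
  simpa using this

lemma of_hasSum {G : ℂ → ℂ} {p : ℕ → ℤ}
    (h : ∀ w : ℂ, ‖w‖ < 1 → HasSum (fun j => (p j : ℂ) * w ^ j) (G w)) :
    IsIntegralLaurent fun z => G (expTwoPiI z) := by
  refine ⟨1, one_pos, 0, p, fun z hz => ?_⟩
  simpa [expTwoPiI_zero] using h _ (norm_expTwoPiI_lt_one hz)

end IsIntegralLaurent

lemma isIntegralLaurent_eta : IsIntegralLaurent ModularForm.eta := by
  obtain ⟨p, -, hp⟩ := exists_hasSum_tprod
  refine ((IsIntegralLaurent.expTwoPiI_mul_div 1 (N := 24) (by norm_num)).mul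
    (IsIntegralLaurent.of_hasSum hp)).congr fun z _ => ?_
  rw [eta_eq_tprod]
  simp

lemma isIntegralLaurent_inv_eta : IsIntegralLaurent fun z => (ModularForm.eta z)⁻¹ := by
  obtain ⟨p, hp0, hp⟩ := exists_hasSum_tprod
  obtain ⟨d, hd⟩ := exists_hasSum_inv hp0 hp fun w hw => tprod_one_sub_pow_ne_zero hw
  refine ((IsIntegralLaurent.expTwoPiI_mul_div (-1) (N := 24) (by norm_num)).mul
    (IsIntegralLaurent.of_hasSum hd)).congr fun z _ => ?_
  rw [eta_eq_tprod, mul_inv, ← expTwoPiI_neg]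
  simp

section

variable {ι : Type*} [Fintype ι] {a : ℕ} [NeZero a]

/-- The exponents `a · weightNorm` are integers on a weighted coset. -/
lemma exists_nat_eq_mul_weightNorm (l : ι → ℕ) (c : ι → ZMod a) (k : ZMod a) (n : ℕ)
    (hla : ∑ s, l s = a) (x : weightCoset l c k n) :
    ∃ e : ℕ, (e : ℝ) = a * weightNorm l (n / a) x.1 := by
  have ha : (a : ℝ) ≠ 0 := by exact_mod_cast NeZero.ne a
  have h0 : 0 ≤ weightNorm l (n / a) x.1 := by
    rw [weightNorm]; positivity
  have h1 : (a : ℝ) * weightNorm l (n / a) x.1 = ((a * ∑ s, l s * (x.1 s) ^ 2 - n ^ 2 : ℤ) : ℝ) := by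
    rw [weightNorm_eq l c k n hla x.2]
    push_cast
    field_simp
  have h2 : (0 : ℤ) ≤ a * ∑ s, l s * (x.1 s) ^ 2 - n ^ 2 := by
    have : (0 : ℝ) ≤ a * weightNorm l (n / a) x.1 := by positivity
    rw [h1] at this
    exact_mod_cast this
  obtain ⟨e, he⟩ := Int.eq_ofNat_of_zero_le h2
  refine ⟨e, ?_⟩
  rw [h1, he]
  simp

/-- The coefficients count the vectors of given norm. -/
lemma isIntegralLaurent_weightTheta (l : ι → ℕ) (hl : ∀ s, 0 < l s) (c : ι → ZMod a) (k : ZMod a)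
    (n : ℕ) (hla : ∑ s, l s = a) : IsIntegralLaurent (weightTheta l c k n) := by
  have ha : (a : ℂ) ≠ 0 := by exact_mod_cast NeZero.ne a
  choose e he using exists_nat_eq_mul_weightNorm l c k n hla
  have hterm : ∀ (z : ℂ) x, expTwoPiI (z * (weightNorm l (n / a) x.1 : ℝ)) =
      ((1 : ℤ) : ℂ) * expTwoPiI (z / a) ^ e x := by
    intro z x
    rw [expTwoPiI_pow, Int.cast_one, one_mul]
    congr 1
    have h : (e x : ℂ) = a * (weightNorm l (n / a) x.1 : ℝ) := by
      exact_mod_cast congrArg (fun t : ℝ => (t : ℂ)) (he x)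
    rw [h]
    field_simp
  have hs : ∀ z : ℂ, 0 < z.im → HasSum (fun x => ((1 : ℤ) : ℂ) * expTwoPiI (z / a) ^ e x)
      (weightTheta l c k n z) := by
    intro z hz
    have := (summable_norm_weightTheta l hl c k n hla hz).of_norm.hasSum
    simp only [hterm] at this
    rw [weightTheta]
    simp only [hterm]
    exact this
  -- Convergence at a single point implies that each norm occurs finitely often.
  have hfin := finite_fiber_of_summable (fun _ => 1) (fun _ => one_ne_zero) e
    (expTwoPiI_ne_zero (Complex.I / a)) (hs Complex.I (by simp)).summable
  refine ⟨a, NeZero.pos a, 0, fun j => ∑' _ : e ⁻¹' {j}, 1, fun z hz => ?_⟩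
  rw [Int.cast_zero, zero_mul, expTwoPiI_zero, one_mul]
  exact hasSum_collect (fun _ => 1) e hfin (hs z hz)

lemma isIntegralLaurent_weightForm (l : ι → ℕ) (hl : ∀ s, 0 < l s) (c : ι → ZMod a) (k : ZMod a)
    (n : ℕ) (hla : ∑ s, l s = a) : IsIntegralLaurent (weightForm l c k n) := by
  have h := (isIntegralLaurent_eta.mul (isIntegralLaurent_weightTheta l hl c k n hla)).mul
    (IsIntegralLaurent.prod Finset.univ fun s _ => isIntegralLaurent_inv_eta.comp_mul (hl s))
  simp only [Finset.prod_inv_distrib, ← div_eq_mul_inv] at h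
  exact h

end

/-! ### Modules over a product of fields -/

section

variable {R : Type*} [CommRing R] {ι : Type*}

/-- An automorphism of a product of modules with no homomorphisms between different factors acts
factor by factor. -/
def piLinearEquiv [Fintype ι] [DecidableEq ι] {W : ι → Type*} [∀ s, AddCommGroup (W s)] [∀ s, Module R (W s)]
    (hW : ∀ s t, s ≠ t → ∀ ψ : W s →ₗ[R] W t, ψ = 0) :
    ((∀ s, W s) ≃ₗ[R] ∀ s, W s) ≃ ∀ s, W s ≃ₗ[R] W s := by
  have key : ∀ (φ : (∀ s, W s) →ₗ[R] ∀ s, W s) (v : ∀ s, W s) (t : ι),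
      φ (Pi.single t (v t)) t = φ v t := by
    intro φ v t
    conv_rhs => rw [← Finset.univ_sum_single v, map_sum, Finset.sum_apply]
    rw [Finset.sum_eq_single t]
    · intro s _ hst
      exact LinearMap.congr_fun
        (hW s t hst (LinearMap.proj t ∘ₗ φ ∘ₗ LinearMap.single R W s)) (v s)
    · simp
  refine
    { toFun := fun e s =>
        { toLinearMap := LinearMap.proj s ∘ₗ e.toLinearMap ∘ₗ LinearMap.single R W s
          invFun := fun w => e.symm (Pi.single s w) s
          left_inv := fun w => ?_
          right_inv := fun w => ?_ }
      invFun := fun f => LinearEquiv.piCongrRight f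
      left_inv := fun e => ?_
      right_inv := fun f => ?_ }
  · have := key e.symm.toLinearMap (e (Pi.single s w)) s
    simp only [LinearEquiv.coe_coe, LinearEquiv.symm_apply_apply, Pi.single_eq_same] at this
    exact this
  · have := key e.toLinearMap (e.symm (Pi.single s w)) s
    simp only [LinearEquiv.coe_coe, LinearEquiv.apply_symm_apply, Pi.single_eq_same] at this
    exact this
  · ext v t
    exact key e.toLinearMap v t
  · ext s w
    simp

variable (K : ι → Type*) [∀ s, Field (K s)] [∀ s, Algebra R (K s)] (P : ι → R)

lemma algebraMap_ne_zero_of_isCoprime (hP : ∀ s, algebraMap R (K s) (P s) = 0)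
    (hcop : Pairwise fun s t => IsCoprime (P s) (P t)) {s t : ι} (hst : s ≠ t) :
    algebraMap R (K t) (P s) ≠ 0 := by
  intro h
  obtain ⟨u, v, huv⟩ := hcop hst
  have := congrArg (algebraMap R (K t)) huv
  rw [map_add, map_mul, map_mul, h, hP t, mul_zero, mul_zero, add_zero, map_one] at this
  exact zero_ne_one this

/-- There are no homomorphisms between blocks that belong to different fields, as `P s` kills the
source and is invertible on the target. -/
lemma linearMap_eq_zero_of_isCoprime (hP : ∀ s, algebraMap R (K s) (P s) = 0)
    (hcop : Pairwise fun s t => IsCoprime (P s) (P t)) (x : ι → ℕ) {s t : ι} (hst : s ≠ t)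
    (ψ : (Fin (x s) → K s) →ₗ[R] (Fin (x t) → K t)) : ψ = 0 := by
  refine LinearMap.ext fun v => funext fun i => ?_
  have h1 : P s • ψ v = 0 := by
    rw [← map_smul]
    have : P s • v = 0 := by
      funext j
      rw [Pi.smul_apply, Algebra.smul_def, hP s, zero_mul, Pi.zero_apply]
    rw [this, map_zero]
  have h2 := congrFun h1 i
  rw [Pi.smul_apply, Algebra.smul_def, Pi.zero_apply] at h2
  simpa using (mul_eq_zero.1 h2).resolve_left
    (algebraMap_ne_zero_of_isCoprime K P hP hcop hst)

variable [DecidableEq ι]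

/-- The automorphism group of `⨁ Kₛ ^ xₛ` is `∏ GL_{xₛ}(Kₛ)`. -/
lemma card_linearEquiv_pi [Fintype ι] (hsurj : ∀ s, Function.Surjective (algebraMap R (K s)))
    (hP : ∀ s, algebraMap R (K s) (P s) = 0)
    (hcop : Pairwise fun s t => IsCoprime (P s) (P t)) (x : ι → ℕ) :
    Nat.card ((∀ s, Fin (x s) → K s) ≃ₗ[R] ∀ s, Fin (x s) → K s) =
      ∏ s, Nat.card (GL (Fin (x s)) (K s)) := by
  rw [Nat.card_congr (piLinearEquiv fun s t hst ψ =>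
    linearMap_eq_zero_of_isCoprime K P hP hcop x hst ψ), Nat.card_pi]
  refine Finset.prod_congr rfl fun s _ => ?_
  refine Nat.card_congr ?_
  have e1 : ((Fin (x s) → K s) ≃ₗ[R] (Fin (x s) → K s)) ≃
      ((Fin (x s) → K s) ≃ₗ[K s] (Fin (x s) → K s)) :=
    { toFun := fun e => e.extendScalarsOfSurjective (hsurj s)
      invFun := fun e => e.restrictScalars R
      left_inv := fun e => by ext; rfl
      right_inv := fun e => by ext; rfl }
  exact e1.trans (((LinearMap.GeneralLinearGroup.generalLinearEquiv (K s) _).symm.trans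
    Matrix.GeneralLinearGroup.toLin.symm).toEquiv)

/-- The exponents `xₛ` are determined by the module `⨁ Kₛ ^ xₛ`. -/
lemma eq_of_linearEquiv_pi [∀ s, Finite (K s)] (hP : ∀ s, algebraMap R (K s) (P s) = 0)
    (hcop : Pairwise fun s t => IsCoprime (P s) (P t)) (x y : ι → ℕ)
    (e : (∀ s, Fin (x s) → K s) ≃ₗ[R] ∀ s, Fin (y s) → K s) : x = y := by
  -- The part killed by `P s` has `|K s| ^ x s` elements.
  have hcard : ∀ (x : ι → ℕ) s, Nat.card {v : ∀ s, Fin (x s) → K s // P s • v = 0} =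
      Nat.card (K s) ^ x s := by
    intro x s
    have e1 : {v : ∀ s, Fin (x s) → K s // P s • v = 0} ≃ (Fin (x s) → K s) :=
      { toFun := fun v => v.1 s
        invFun := fun w => ⟨Pi.single s w, by
          rw [← Pi.single_smul]
          have : P s • w = 0 := by
            funext j
            rw [Pi.smul_apply, Algebra.smul_def, hP s, zero_mul, Pi.zero_apply]
          rw [this, Pi.single_zero]⟩
        left_inv := fun v => by
          ext t i
          by_cases hst : s = t
          · subst hst; simp
          · have := congrFun (congrFun v.2 t) i
            rw [Pi.smul_apply, Pi.smul_apply, Algebra.smul_def, Pi.zero_apply, Pi.zero_apply] at this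
            have h0 := (mul_eq_zero.1 this).resolve_left
              (algebraMap_ne_zero_of_isCoprime K P hP hcop hst)
            rw [h0]
            simp [Pi.single_eq_of_ne (Ne.symm hst)]
        right_inv := fun w => by simp }
    rw [Nat.card_congr e1, Nat.card_pi]
    simp
  funext s
  have h : Nat.card (K s) ^ x s = Nat.card (K s) ^ y s := by
    rw [← hcard x s, ← hcard y s]
    refine Nat.card_congr (e.toEquiv.subtypeEquiv fun v => ?_)
    change _ ↔ P s • e v = 0
    rw [← map_smul, LinearEquiv.map_eq_zero_iff]
  exact Nat.pow_right_injective (Finite.one_lt_card (α := K s)) h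

/-- A finite module killed by `∏ Pₛ` is a direct sum of copies of the fields `Kₛ = R / Pₛ`. -/
lemma exists_linearEquiv_pi [Fintype ι] (hsurj : ∀ s, Function.Surjective (algebraMap R (K s)))
    (hker : ∀ s r, algebraMap R (K s) r = 0 ↔ P s ∣ r)
    (hcop : Pairwise fun s t => IsCoprime (P s) (P t)) (M : Type*) [AddCommGroup M] [Module R M]
    [Finite M] (hM : Module.IsTorsionBy R M (∏ s, P s)) :
    ∃ x : ι → ℕ, Nonempty (M ≃ₗ[R] ∀ s, Fin (x s) → K s) := by
  have hint := Submodule.torsionBy_isInternal (S := Finset.univ) (q := P)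
    (fun s _ t _ hst => hcop hst) hM
  have hblock : ∀ s, ∃ n : ℕ, Nonempty (Submodule.torsionBy R M (P s) ≃ₗ[R] (Fin n → K s)) := by
    intro s
    let W := Submodule.torsionBy R M (P s)
    let r : K s → R := Function.surjInv (hsurj s)
    have hr : ∀ c, algebraMap R (K s) (r c) = c := Function.surjInv_eq (hsurj s)
    have hW : ∀ (a b : R) (w : W), algebraMap R (K s) a = algebraMap R (K s) b → a • w = b • w := by
      intro a b w hab
      rw [← sub_eq_zero, ← map_sub, hker] at hab
      obtain ⟨d, hd⟩ := hab
      rw [← sub_eq_zero, ← sub_smul, hd, mul_comm, mul_smul]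
      have : P s • w = 0 := Subtype.ext ((Submodule.mem_torsionBy_iff _ _).1 w.2)
      rw [this, smul_zero]
    -- On the part killed by `P s` the scalars act through the quotient `K s` of `R`.
    let inst : Module (K s) W :=
      { smul := fun c w => r c • w
        one_smul := fun w => (hW _ 1 w (by rw [hr, map_one])).trans (one_smul R w)
        mul_smul := fun c d w => (hW _ (r c * r d) w (by rw [hr, map_mul, hr, hr])).trans
          (mul_smul _ _ w)
        smul_zero := fun c => smul_zero (r c)
        smul_add := fun c v w => smul_add (r c) v w
        add_smul := fun c d w => (hW _ (r c + r d) w (by rw [hr, map_add, hr, hr])).trans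
          (add_smul _ _ w)
        zero_smul := fun w => (hW _ 0 w (by rw [hr, map_zero])).trans (zero_smul R w) }
    have htower : IsScalarTower R (K s) W := ⟨fun a c w => by
      change r (a • c) • w = a • (r c • w)
      rw [← mul_smul]
      refine hW _ _ w ?_
      rw [hr, map_mul, hr, Algebra.smul_def]⟩
    have hfin : Module.Finite (K s) W := Module.Finite.of_finite
    exact ⟨Module.finrank (K s) W, ⟨(Module.finBasis (K s) W).equivFun.restrictScalars R⟩⟩
  choose x hx using hblock
  refine ⟨x, ⟨?_⟩⟩
  let e1 : (DirectSum (Finset.univ : Finset ι) fun s => Submodule.torsionBy R M (P s)) ≃ₗ[R] M :=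
    LinearEquiv.ofBijective (DirectSum.coeLinearMap _) hint
  let e2 := DirectSum.linearEquivFunOnFintype R (Finset.univ : Finset ι)
    fun s => Submodule.torsionBy R M (P s)
  let e3 : (∀ s : (Finset.univ : Finset ι), Submodule.torsionBy R M (P s)) ≃ₗ[R]
      ∀ s, Submodule.torsionBy R M (P s) :=
    LinearEquiv.piCongrLeft R (fun s => Submodule.torsionBy R M (P s))
      (Equiv.subtypeUnivEquiv fun s => Finset.mem_univ s)
  exact e1.symm.trans (e2.trans (e3.trans (LinearEquiv.piCongrRight fun s => (hx s).some)))

end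

/-! ### Counting endomorphisms with a given module structure -/

section

open Polynomial

variable {F : Type*} [Field F] {V : Type*} [AddCommGroup V] [Module F V]
  {M : Type*} [AddCommGroup M] [Module F M] [Module F[X] M] [IsScalarTower F F[X] M]

/-- `F[X]`-linear isomorphisms out of `V`, with `X` acting as `T`, are the `F`-linear isomorphisms
that intertwine `T` with `X`. -/
noncomputable def aevalEquiv (T : Module.End F V) :
    (Module.AEval' T ≃ₗ[F[X]] M) ≃ {φ : V ≃ₗ[F] M // ∀ v, φ (T v) = (X : F[X]) • φ v} where
  toFun e := ⟨(Module.AEval'.of T).trans (e.restrictScalars F), fun v => by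
    change e (Module.AEval'.of T (T v)) = (X : F[X]) • e (Module.AEval'.of T v)
    rw [← Module.AEval'.X_smul_of, map_smul]⟩
  invFun φ := LinearEquiv.ofAEval T φ.1 φ.2
  left_inv e := by ext; rfl
  right_inv φ := by ext; rfl

variable (V M) in
/-- Orbit counting: the endomorphisms `T` of `V` for which `V` becomes isomorphic to `M` are the
conjugates of one of them, and its centralizer is the automorphism group of `M`. -/
lemma card_aeval_mul_card_aut [Finite V] [Finite M] :
    Nat.card {T : Module.End F V // Nonempty (Module.AEval' T ≃ₗ[F[X]] M)} *
      Nat.card (M ≃ₗ[F[X]] M) = Nat.card (V ≃ₗ[F] M) := by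
  have hfinE : Finite (V ≃ₗ[F] M) := DFunLike.finite _
  have hfinT : Finite (Module.End F V) := DFunLike.finite _
  set D := {T : Module.End F V // Nonempty (Module.AEval' T ≃ₗ[F[X]] M)}
  have : Fintype D := Fintype.ofFinite _
  have e1 : (V ≃ₗ[F] M) ≃ {p : Module.End F V × (V ≃ₗ[F] M) // ∀ v, p.2 (p.1 v) = (X : F[X]) • p.2 v} :=
    { toFun := fun φ => ⟨⟨φ.symm.toLinearMap ∘ₗ (LinearMap.lsmul F[X] M X).restrictScalars F ∘ₗ
          φ.toLinearMap, φ⟩, fun v => by simp⟩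
      invFun := fun p => p.1.2
      left_inv := fun φ => rfl
      right_inv := fun p => by
        refine Subtype.ext (Prod.ext (LinearMap.ext fun v => ?_) rfl)
        simp [← p.2 v] }
  have e2 : {p : Module.End F V × (V ≃ₗ[F] M) // ∀ v, p.2 (p.1 v) = (X : F[X]) • p.2 v} ≃
      Σ T : D, {φ : V ≃ₗ[F] M // ∀ v, φ (T.1 v) = (X : F[X]) • φ v} :=
    { toFun := fun p => ⟨⟨p.1.1, ⟨(aevalEquiv p.1.1).symm ⟨p.1.2, p.2⟩⟩⟩, ⟨p.1.2, p.2⟩⟩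
      invFun := fun p => ⟨⟨p.1.1, p.2.1⟩, p.2.2⟩
      left_inv := fun p => rfl
      right_inv := fun p => rfl }
  rw [Nat.card_congr (e1.trans e2), Nat.card_sigma]
  have h : ∀ T : D, Nat.card {φ : V ≃ₗ[F] M // ∀ v, φ (T.1 v) = (X : F[X]) • φ v} =
      Nat.card (M ≃ₗ[F[X]] M) := fun T => by
    rw [← Nat.card_congr (aevalEquiv T.1)]
    let e := T.2.some
    exact Nat.card_congr
      { toFun := fun f => e.symm.trans f
        invFun := fun g => e.trans g
        left_inv := fun f => by ext; simp
        right_inv := fun g => by ext; simp }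
  simp only [h, Finset.sum_const, Finset.card_univ, smul_eq_mul, Nat.card_eq_fintype_card]

/-! ### Determinants on products -/

/-- The blocks are put in an arbitrary linear order, for which the matrix is block triangular. -/
lemma det_blockDiagonal'_eq {ι : Type*} [Fintype ι] [DecidableEq ι] {κ : ι → Type*}
    [∀ s, Fintype (κ s)] [∀ s, DecidableEq (κ s)] (A : ∀ s, Matrix (κ s) (κ s) F) :
    (Matrix.blockDiagonal' A).det = ∏ s, (A s).det := by
  let : LinearOrder ι := LinearOrder.lift' (Fintype.equivFin ι) (Fintype.equivFin ι).injective
  have hbt : (Matrix.blockDiagonal' A).BlockTriangular Sigma.fst := by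
    intro i j hij
    exact Matrix.blockDiagonal'_apply_ne A i.2 j.2 hij.ne'
  rw [hbt.det_fintype]
  refine Finset.prod_congr rfl fun s _ => ?_
  let e : κ s ≃ {σ : Σ s, κ s // σ.1 = s} :=
    { toFun := fun i => ⟨⟨s, i⟩, rfl⟩
      invFun := fun σ => σ.2 ▸ σ.1.2
      left_inv := fun i => rfl
      right_inv := by
        rintro ⟨⟨t, i⟩, rfl⟩
        rfl }
  rw [← Matrix.det_submatrix_equiv_self e]
  congr 1
  ext i j
  simp [Matrix.toSquareBlock, Matrix.toSquareBlockProp, e]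

lemma det_pi_proj {ι : Type*} [Fintype ι] [DecidableEq ι] {W : ι → Type*}
    [∀ s, AddCommGroup (W s)] [∀ s, Module F (W s)] [∀ s, Module.Finite F (W s)]
    (f : ∀ s, W s →ₗ[F] W s) :
    LinearMap.det (LinearMap.pi fun s => f s ∘ₗ LinearMap.proj s) = ∏ s, LinearMap.det (f s) := by
  let b := fun s => Module.finBasis F (W s)
  have h : LinearMap.toMatrix (Pi.basis b) (Pi.basis b)
      (LinearMap.pi fun s => f s ∘ₗ LinearMap.proj s) =
      Matrix.blockDiagonal' fun s => LinearMap.toMatrix (b s) (b s) (f s) := by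
    ext ⟨s, i⟩ ⟨t, j⟩
    rw [LinearMap.toMatrix_apply, Pi.basis_apply, Pi.basis_repr]
    simp only [LinearMap.pi_apply, LinearMap.comp_apply, LinearMap.proj_apply]
    by_cases hst : s = t
    · subst hst
      rw [Matrix.blockDiagonal'_apply_eq, LinearMap.toMatrix_apply, Pi.single_eq_same]
    · rw [Matrix.blockDiagonal'_apply_ne _ _ _ hst, Pi.single_eq_of_ne hst]
      simp
  rw [← LinearMap.det_toMatrix (Pi.basis b), h, det_blockDiagonal'_eq]
  exact Finset.prod_congr rfl fun s _ => LinearMap.det_toMatrix (b s) (f s)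

/-- On `⨁ Kₛ ^ xₛ` the determinant of multiplication by `X` is a product of norms. -/
lemma det_eq_prod_norm {ι : Type*} [Fintype ι] [DecidableEq ι] (K : ι → Type*) [∀ s, Field (K s)]
    [∀ s, Algebra F (K s)] [∀ s, Algebra F[X] (K s)] [∀ s, IsScalarTower F F[X] (K s)]
    [∀ s, Module.Finite F (K s)] (x : ι → ℕ) (T : Module.End F V)
    (e : Module.AEval' T ≃ₗ[F[X]] ∀ s, Fin (x s) → K s) :
    LinearMap.det T = ∏ s, Algebra.norm F (algebraMap F[X] (K s) X) ^ x s := by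
  obtain ⟨φ, hφ⟩ := aevalEquiv T e
  let g : ∀ s, K s →ₗ[F] K s := fun s => Algebra.lmul F (K s) (algebraMap F[X] (K s) X)
  have h : φ.toLinearMap ∘ₗ T ∘ₗ φ.symm.toLinearMap =
      LinearMap.pi fun s => (LinearMap.pi fun i : Fin (x s) => g s ∘ₗ LinearMap.proj i) ∘ₗ
        LinearMap.proj s := by
    refine LinearMap.ext fun v => funext fun s => funext fun i => ?_
    have := congrFun (congrFun (hφ (φ.symm v)) s) i
    rw [LinearEquiv.apply_symm_apply, Pi.smul_apply, Pi.smul_apply, Algebra.smul_def] at this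
    exact this
  rw [← LinearMap.det_conj T φ, h, det_pi_proj]
  refine Finset.prod_congr rfl fun s _ => ?_
  rw [LinearMap.det_pi, Finset.prod_const, Finset.card_univ, Fintype.card_fin]
  rfl

end

/-! ### Factors of `X ^ a - 1` over a finite field -/

section

open Polynomial

/-- A representative of a Frobenius orbit. -/
noncomputable def orbitRep {a : ℕ} {u : ZMod a} (s : frobOrbits u) : ZMod a :=
  (toOrbit_surjective u s).choose

lemma toOrbit_orbitRep {a : ℕ} {u : ZMod a} (s : frobOrbits u) : toOrbit u (orbitRep s) = s :=
  (toOrbit_surjective u s).choose_spec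

lemma toOrbit_mul_eq {a : ℕ} {u : ZMod a} (hu : IsUnit u) (j : ZMod a) : toOrbit u (u * j) = toOrbit u j :=
  Subtype.ext ((mem_frobOrbit_iff hu j (u * j)).1 ⟨1, by rw [pow_one]⟩)

/-- An element of an extension that is fixed by the Frobenius lies in the base field. -/
lemma exists_algebraMap_eq_of_pow_card (F : Type*) [Field F] [Fintype F] {E : Type*} [Field E] [Algebra F E] {x : E}
    (hx : x ^ Fintype.card F = x) : ∃ c : F, algebraMap F E c = x := by
  have h1 : (X ^ Fintype.card F - X : F[X]) = ∏ c : F, (X - C c) := by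
    have hdeg := FiniteField.X_pow_card_sub_X_natDegree_eq F (Fintype.one_lt_card (α := F))
    have hmonic : (X ^ Fintype.card F - X : F[X]).Monic :=
      monic_X_pow_sub (by rw [degree_X]; exact_mod_cast Fintype.one_lt_card (α := F))
    have hroots := FiniteField.roots_X_pow_card_sub_X F
    have := prod_multiset_X_sub_C_of_monic_of_roots_card_eq hmonic
      (by rw [hroots, hdeg]; rfl)
    rw [← this, hroots]
    rfl
  have h2 := congrArg (aeval x) h1
  rw [map_sub, map_pow, aeval_X, hx, sub_self, map_prod] at h2
  obtain ⟨c, -, hc⟩ := Finset.prod_eq_zero_iff.1 h2.symm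
  rw [map_sub, aeval_X, aeval_C, sub_eq_zero] at hc
  exact ⟨c, hc.symm⟩

variable {F : Type*} [Field F] {a : ℕ} [NeZero a] {ζ : AlgebraicClosure F}

/-- The character `j ↦ ζ ^ j` of `ℤ/a`. -/
noncomputable def rootChar (hζ : IsPrimitiveRoot ζ a) : AddChar (ZMod a) (AlgebraicClosure F) :=
  AddChar.zmodChar a hζ.pow_eq_one

variable (hζ : IsPrimitiveRoot ζ a)

lemma rootChar_injective : Function.Injective (rootChar hζ) := by
  intro i j hij
  rw [rootChar, AddChar.zmodChar_apply, AddChar.zmodChar_apply] at hij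
  exact ZMod.val_injective a (hζ.pow_inj (ZMod.val_lt i) (ZMod.val_lt j) hij)

lemma rootChar_sum {κ : Type*} (t : Finset κ) (f : κ → ZMod a) :
    rootChar hζ (∑ i ∈ t, f i) = ∏ i ∈ t, rootChar hζ (f i) := by
  classical
  induction t using Finset.induction_on with
  | empty => simp
  | insert i t hi ih =>
    rw [Finset.sum_insert hi, Finset.prod_insert hi, AddChar.map_add_eq_mul, ih]

lemma rootChar_natCast_mul (m : ℕ) (i : ZMod a) :
    rootChar hζ (m * i) = rootChar hζ i ^ m := by
  rw [← nsmul_eq_mul, AddChar.map_nsmul_eq_pow]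

lemma rootChar_intCast (k : ℤ) : rootChar hζ (k : ZMod a) = ζ ^ k := by
  have h1 : rootChar hζ 1 = ζ := by
    have := AddChar.zmodChar_apply' hζ.pow_eq_one 1
    rw [pow_one, Nat.cast_one] at this
    exact this
  rw [← mul_one (k : ZMod a), ← zsmul_eq_mul, AddChar.map_zsmul_eq_zpow, h1]

lemma prod_X_sub_C_rootChar : ∏ j, (X - C (rootChar hζ j)) = X ^ a - 1 := by
  rw [X_pow_sub_one_eq_prod (NeZero.pos a) hζ]
  refine Finset.prod_bij (fun j _ => rootChar hζ j) ?_ ?_ ?_ ?_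
  · intro j _
    rw [mem_nthRootsFinset (NeZero.pos a), rootChar, AddChar.zmodChar_apply, ← pow_mul, mul_comm,
      pow_mul, hζ.pow_eq_one, one_pow]
  · intro i _ j _ hij
    exact rootChar_injective hζ hij
  · intro η hη
    rw [mem_nthRootsFinset (NeZero.pos a)] at hη
    obtain ⟨i, -, hi⟩ := hζ.eq_pow_of_pow_eq_one hη
    exact ⟨i, Finset.mem_univ _, (AddChar.zmodChar_apply' hζ.pow_eq_one i).trans hi⟩
  · intro j _
    rfl

variable [Fintype F]

/-- The minimal polynomial over `F` of the roots of unity in a Frobenius orbit. -/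
noncomputable def orbitPoly (s : frobOrbits (Fintype.card F : ZMod a)) : F[X] :=
  minpoly F (rootChar hζ (orbitRep s))

open Classical in
/-- The roots of `orbitPoly` are the roots of unity in the orbit: the product of the corresponding
linear factors is fixed by the Frobenius. -/
lemma map_orbitPoly (hq : IsUnit (Fintype.card F : ZMod a))
    (s : frobOrbits (Fintype.card F : ZMod a)) :
    (orbitPoly hζ s).map (algebraMap F (AlgebraicClosure F)) =
      ∏ j with toOrbit (Fintype.card F : ZMod a) j = s, (X - C (rootChar hζ j)) := by
  set Q : (AlgebraicClosure F)[X] := ∏ j with toOrbit (Fintype.card F : ZMod a) j = s, (X - C (rootChar hζ j)) with hQ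
  let Fr := FiniteField.frobeniusAlgHom F (AlgebraicClosure F)
  have hFr : ∀ x, Fr x = x ^ Fintype.card F := fun x => rfl
  have hQmap : Q.map Fr.toRingHom = Q := by
    rw [hQ, Polynomial.map_prod]
    refine Finset.prod_bij (fun j _ => (Fintype.card F : ZMod a) * j) ?_ ?_ ?_ ?_
    · intro j hj
      simp only [Finset.mem_filter, Finset.mem_univ, true_and] at hj ⊢
      rw [toOrbit_mul_eq hq, hj]
    · intro i _ j _ hij
      exact hq.mul_left_cancel hij
    · intro j hj
      obtain ⟨v, hv⟩ := id hq
      have e : (Fintype.card F : ZMod a) * (↑v⁻¹ * j) = j := by rw [← hv, ← mul_assoc, Units.mul_inv, one_mul]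
      refine ⟨↑v⁻¹ * j, ?_, e⟩
      simp only [Finset.mem_filter, Finset.mem_univ, true_and] at hj ⊢
      rw [← toOrbit_mul_eq hq, e, hj]
    · intro j _
      rw [Polynomial.map_sub, map_X, map_C, rootChar_natCast_mul]
      rfl
  have hlift : Q ∈ Polynomial.lifts (algebraMap F (AlgebraicClosure F)) := by
    rw [Polynomial.lifts_iff_coeff_lifts]
    intro n
    refine exists_algebraMap_eq_of_pow_card F ?_
    have := congrArg (fun p => p.coeff n) hQmap
    simp only [coeff_map] at this
    exact this
  have hQmonic : Q.Monic := monic_prod_of_monic _ _ fun j _ => monic_X_sub_C _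
  obtain ⟨P, hP, -, hPm⟩ := Polynomial.lifts_and_degree_eq_and_monic hlift hQmonic
  set m := orbitPoly hζ s with hm
  have hint : IsIntegral F (rootChar hζ (orbitRep s)) := Algebra.IsIntegral.isIntegral _
  have hmm : m.Monic := minpoly.monic hint
  have hdvd1 : m ∣ P := by
    refine minpoly.dvd F _ ?_
    rw [aeval_def, ← eval_map, hP, hQ, eval_prod]
    refine Finset.prod_eq_zero (i := orbitRep s) (by simp [toOrbit_orbitRep]) (by simp)
  have hroot : ∀ r : ℕ, aeval (rootChar hζ ((Fintype.card F : ZMod a) ^ r * orbitRep s)) m = 0 := by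
    intro r
    induction r with
    | zero => rw [pow_zero, one_mul]; exact minpoly.aeval F _
    | succ r ih =>
      rw [pow_succ', mul_assoc, rootChar_natCast_mul, ← hFr, aeval_algHom_apply, ih,
        map_zero]
  have hdvd2 : Q ∣ m.map (algebraMap F (AlgebraicClosure F)) := by
    rw [hQ]
    refine Finset.prod_dvd_of_coprime ?_ ?_
    · intro i _ j _ hij
      exact isCoprime_X_sub_C_of_isUnit_sub
        (sub_ne_zero.2 fun h => hij (rootChar_injective hζ h)).isUnit
    · intro j hj
      rw [Finset.mem_filter, ← toOrbit_orbitRep s] at hj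
      obtain ⟨r, rfl⟩ := (mem_frobOrbit_iff hq _ _).2 (congrArg Subtype.val hj.2)
      rw [dvd_iff_isRoot, IsRoot, eval_map, ← aeval_def]
      exact hroot r
  rw [← hP, Polynomial.map_dvd_map' ] at hdvd2
  rw [← hP, Polynomial.eq_of_monic_of_associated hmm hPm (associated_of_dvd_dvd hdvd1 hdvd2)]

lemma orbitPoly_monic (s : frobOrbits (Fintype.card F : ZMod a)) : (orbitPoly hζ s).Monic :=
  minpoly.monic (Algebra.IsIntegral.isIntegral _)

lemma orbitPoly_irreducible (s : frobOrbits (Fintype.card F : ZMod a)) :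
    Irreducible (orbitPoly hζ s) := minpoly.irreducible (Algebra.IsIntegral.isIntegral _)

lemma natDegree_orbitPoly (hq : IsUnit (Fintype.card F : ZMod a))
    (s : frobOrbits (Fintype.card F : ZMod a)) :
    (orbitPoly hζ s).natDegree = orbitLen (Fintype.card F : ZMod a) s := by
  classical
  rw [← natDegree_map (algebraMap F (AlgebraicClosure F)), map_orbitPoly hζ hq,
    natDegree_prod_of_monic _ _ fun j _ => monic_X_sub_C _, orbitLen_eq_card hq]
  simp

lemma prod_orbitPoly (hq : IsUnit (Fintype.card F : ZMod a)) :
    ∏ s, orbitPoly (F := F) hζ s = X ^ a - 1 := by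
  classical
  refine map_injective (algebraMap F (AlgebraicClosure F)) (algebraMap F _).injective ?_
  rw [Polynomial.map_prod, Polynomial.map_sub, Polynomial.map_pow, map_X, Polynomial.map_one,
    ← prod_X_sub_C_rootChar hζ]
  simp only [map_orbitPoly hζ hq]
  exact Finset.prod_fiberwise_of_maps_to (fun _ _ => Finset.mem_univ _) _

lemma isCoprime_orbitPoly (hq : IsUnit (Fintype.card F : ZMod a)) :
    Pairwise fun s t => IsCoprime (orbitPoly (F := F) hζ s) (orbitPoly hζ t) := by
  classical
  intro s t hst
  rw [(orbitPoly_irreducible hζ s).coprime_iff_not_dvd]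
  intro hdvd
  have h0 : aeval (rootChar hζ (orbitRep s)) (orbitPoly hζ t) = 0 := by
    obtain ⟨r, hr⟩ := hdvd
    rw [hr, map_mul, orbitPoly, minpoly.aeval, zero_mul]
  rw [aeval_def, ← eval_map, map_orbitPoly hζ hq, eval_prod, Finset.prod_eq_zero_iff] at h0
  obtain ⟨j, hj, hj0⟩ := h0
  rw [Finset.mem_filter] at hj
  rw [eval_sub, eval_X, eval_C, sub_eq_zero] at hj0
  rw [← rootChar_injective hζ hj0, toOrbit_orbitRep] at hj
  exact hst hj.2

/-- The norm of a root is the product of its conjugates, which are the powers of `ζ` with exponents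
in the orbit. -/
lemma algebraMap_norm_root (hq : IsUnit (Fintype.card F : ZMod a))
    (s : frobOrbits (Fintype.card F : ZMod a)) :
    algebraMap F (AlgebraicClosure F) (Algebra.norm F (AdjoinRoot.root (orbitPoly hζ s))) =
      rootChar hζ (orbitSum (Fintype.card F : ZMod a) s) := by
  classical
  have hm := orbitPoly_monic hζ s
  have h := Algebra.PowerBasis.norm_gen_eq_prod_roots (F := AlgebraicClosure F)
    (AdjoinRoot.powerBasis hm.ne_zero) (IsAlgClosed.splits _)
  rw [AdjoinRoot.minpoly_powerBasis_gen_of_monic hm, AdjoinRoot.powerBasis_gen, aroots_def,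
    map_orbitPoly hζ hq] at h
  have e : ∀ t : Finset (ZMod a), ∏ j ∈ t, (X - C (rootChar hζ j)) =
      ((t.val.map (rootChar hζ)).map fun b => X - C b).prod := fun t => by
    rw [Multiset.map_map]; rfl
  rw [h, e, roots_multiset_prod_X_sub_C, orbitSum, rootChar_sum]
  rfl

end

/-! ### The counting formula -/

/-- The order of `GL_m` of a field with `Q` elements. -/
noncomputable def glOrder (Q : ℝ) (m : ℕ) : ℝ := ∏ i ∈ Finset.range m, (Q ^ m - Q ^ i)

lemma natCast_card_GL (K : Type*) [Field K] [Finite K] (m : ℕ) :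
    (Nat.card (GL (Fin m) K) : ℝ) = glOrder (Nat.card K) m := by
  have : Fintype K := Fintype.ofFinite K
  rw [Matrix.card_GL_field, glOrder, Nat.cast_prod, Finset.prod_range, Nat.card_eq_fintype_card]
  refine Finset.prod_congr rfl fun i _ => ?_
  rw [Nat.cast_sub (Nat.pow_le_pow_right Fintype.card_pos i.2.le)]
  push_cast
  rfl

open Classical in
/-- The non-negative vectors in a weighted coset. -/
noncomputable def weightVectors {ι : Type*} [Fintype ι] {a : ℕ} (l : ι → ℕ) (c : ι → ZMod a)
    (k : ZMod a) (n : ℕ) : Finset (ι → ℕ) :=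
  {x ∈ Fintype.piFinset fun _ => Finset.range (n + 1) |
    ∑ s, l s * x s = n ∧ ∑ s, c s * (x s : ZMod a) = k}

lemma mem_weightVectors {ι : Type*} [Fintype ι] {a : ℕ} {l : ι → ℕ} (hl : ∀ s, 0 < l s)
    {c : ι → ZMod a} {k : ZMod a} {n : ℕ} {x : ι → ℕ} :
    x ∈ weightVectors l c k n ↔ ∑ s, l s * x s = n ∧ ∑ s, c s * (x s : ZMod a) = k := by
  classical
  rw [weightVectors, Finset.mem_filter, and_iff_right_iff_imp, Fintype.mem_piFinset]
  intro h s
  rw [Finset.mem_range, Nat.lt_succ_iff, ← h.1]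
  exact (Nat.le_mul_of_pos_left _ (hl s)).trans
    (Finset.single_le_sum (f := fun s => l s * x s) (fun _ _ => Nat.zero_le _) (Finset.mem_univ s))

section

open Polynomial

variable {F : Type*} [Field F] [Fintype F] {a : ℕ} [NeZero a] {ζ : AlgebraicClosure F}
  (hζ : IsPrimitiveRoot ζ a)

/-- The field generated by the roots of unity in a Frobenius orbit. -/
abbrev OrbitField (s : frobOrbits (Fintype.card F : ZMod a)) : Type _ :=
  AdjoinRoot (orbitPoly hζ s)

/-! The instances below make `OrbitField` a finite field extension of `F` and a compatible
`F[X]`-module on which `X` acts as multiplication by the root. -/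

instance (s : frobOrbits (Fintype.card F : ZMod a)) : Fact (Irreducible (orbitPoly hζ s)) :=
  ⟨orbitPoly_irreducible hζ s⟩

noncomputable instance (s : frobOrbits (Fintype.card F : ZMod a)) :
    Algebra F[X] (OrbitField hζ s) := (AdjoinRoot.mk (orbitPoly hζ s)).toAlgebra

instance (s : frobOrbits (Fintype.card F : ZMod a)) :
    IsScalarTower F F[X] (OrbitField hζ s) :=
  IsScalarTower.of_algebraMap_eq fun _ => rfl

instance (s : frobOrbits (Fintype.card F : ZMod a)) : Module.Finite F (OrbitField hζ s) :=
  (orbitPoly_monic hζ s).finite_adjoinRoot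

instance (s : frobOrbits (Fintype.card F : ZMod a)) : Finite (OrbitField hζ s) :=
  Module.finite_of_finite F

lemma finrank_orbitField (hq : IsUnit (Fintype.card F : ZMod a))
    (s : frobOrbits (Fintype.card F : ZMod a)) :
    Module.finrank F (OrbitField hζ s) = orbitLen (Fintype.card F : ZMod a) s := by
  rw [(AdjoinRoot.powerBasis (orbitPoly_monic hζ s).ne_zero).finrank, AdjoinRoot.powerBasis_dim,
    natDegree_orbitPoly hζ hq]

lemma natCard_orbitField (hq : IsUnit (Fintype.card F : ZMod a))
    (s : frobOrbits (Fintype.card F : ZMod a)) :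
    Nat.card (OrbitField hζ s) = Fintype.card F ^ orbitLen (Fintype.card F : ZMod a) s := by
  rw [Module.natCard_eq_pow_finrank (K := F), finrank_orbitField hζ hq, Nat.card_eq_fintype_card]

/-- The `F[X]`-module `⨁ Kₛ ^ xₛ`. -/
abbrev OrbitModule (x : frobOrbits (Fintype.card F : ZMod a) → ℕ) : Type _ :=
  ∀ s, Fin (x s) → OrbitField hζ s

lemma finrank_orbitModule (hq : IsUnit (Fintype.card F : ZMod a))
    (x : frobOrbits (Fintype.card F : ZMod a) → ℕ) :
    Module.finrank F (OrbitModule hζ x) = ∑ s, orbitLen (Fintype.card F : ZMod a) s * x s := by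
  rw [Module.finrank_pi_fintype]
  refine Finset.sum_congr rfl fun s _ => ?_
  rw [Module.finrank_pi_fintype, finrank_orbitField hζ hq]
  simp [mul_comm]

variable {n : ℕ}

/-- The determinant of `T` is determined by the multiplicities `xₛ`. -/
lemma algebraMap_det_eq (hq : IsUnit (Fintype.card F : ZMod a)) (T : Module.End F (Fin n → F))
    (x : frobOrbits (Fintype.card F : ZMod a) → ℕ)
    (e : Module.AEval' T ≃ₗ[F[X]] OrbitModule hζ x) :
    algebraMap F (AlgebraicClosure F) (LinearMap.det T) =
      rootChar hζ (∑ s, orbitSum (Fintype.card F : ZMod a) s * (x s : ZMod a)) := by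
  classical
  rw [det_eq_prod_norm _ x T e, map_prod, rootChar_sum]
  refine Finset.prod_congr rfl fun s _ => ?_
  rw [map_pow, mul_comm, rootChar_natCast_mul, ← algebraMap_norm_root hζ hq]
  rfl

lemma pow_eq_one_of_linearEquiv (hq : IsUnit (Fintype.card F : ZMod a))
    (T : Module.End F (Fin n → F)) (x : frobOrbits (Fintype.card F : ZMod a) → ℕ)
    (e : Module.AEval' T ≃ₗ[F[X]] OrbitModule hζ x) : T ^ a = 1 := by
  refine LinearMap.ext fun v => ?_
  have h1 : (X ^ a - 1 : F[X]) • e (Module.AEval'.of T v) = 0 := by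
    rw [← prod_orbitPoly hζ hq]
    funext s i
    rw [Pi.smul_apply, Pi.smul_apply, Algebra.smul_def, map_prod,
      Finset.prod_eq_zero (Finset.mem_univ s) (AdjoinRoot.mk_self), zero_mul]
    rfl
  rw [← map_smul, LinearEquiv.map_eq_zero_iff, sub_smul, one_smul, Module.AEval'.X_pow_smul_of,
    ← map_sub, LinearEquiv.map_eq_zero_iff, sub_eq_zero] at h1
  exact h1

/-- As `X ^ a - 1 = ∏ Pₛ` with pairwise coprime irreducible factors, an endomorphism with `T ^ a =
1` makes the space a direct sum of copies of the fields `Kₛ`. -/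
lemma exists_linearEquiv_orbitModule (hq : IsUnit (Fintype.card F : ZMod a))
    (T : Module.End F (Fin n → F)) (hT : T ^ a = 1) :
    ∃ x, Nonempty (Module.AEval' T ≃ₗ[F[X]] OrbitModule hζ x) := by
  classical
  have : Finite (Module.AEval' T) := inferInstanceAs (Finite (Fin n → F))
  refine exists_linearEquiv_pi (OrbitField hζ) (orbitPoly hζ) (fun s => AdjoinRoot.mk_surjective)
    (fun s r => AdjoinRoot.mk_eq_zero) (isCoprime_orbitPoly hζ hq) _ ?_
  rw [prod_orbitPoly hζ hq]
  intro v
  obtain ⟨w, rfl⟩ := (Module.AEval'.of T).surjective v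
  rw [sub_smul, one_smul, Module.AEval'.X_pow_smul_of, hT]
  exact sub_self _

lemma eq_of_linearEquiv_orbitModule (hq : IsUnit (Fintype.card F : ZMod a))
    (T : Module.End F (Fin n → F)) (x y : frobOrbits (Fintype.card F : ZMod a) → ℕ)
    (e : Module.AEval' T ≃ₗ[F[X]] OrbitModule hζ x)
    (e' : Module.AEval' T ≃ₗ[F[X]] OrbitModule hζ y) : x = y := by
  classical
  exact eq_of_linearEquiv_pi (OrbitField hζ) (orbitPoly hζ) (fun s => AdjoinRoot.mk_self)
    (isCoprime_orbitPoly hζ hq) x y (e.symm.trans e')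

lemma sum_eq_of_linearEquiv (hq : IsUnit (Fintype.card F : ZMod a))
    (T : Module.End F (Fin n → F)) (x : frobOrbits (Fintype.card F : ZMod a) → ℕ)
    (e : Module.AEval' T ≃ₗ[F[X]] OrbitModule hζ x) :
    ∑ s, orbitLen (Fintype.card F : ZMod a) s * x s = n := by
  rw [← finrank_orbitModule hζ hq, ← ((aevalEquiv T) e).1.finrank_eq]
  simp

/-- The size of a conjugacy class: the index of the centralizer `∏ GL_{xₛ}(Kₛ)` in `GL_n(F)`. -/
lemma card_class (hq : IsUnit (Fintype.card F : ZMod a))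
    (x : frobOrbits (Fintype.card F : ZMod a) → ℕ)
    (hx : ∑ s, orbitLen (Fintype.card F : ZMod a) s * x s = n) :
    (Nat.card {T : Module.End F (Fin n → F) //
      Nonempty (Module.AEval' T ≃ₗ[F[X]] OrbitModule hζ x)} : ℝ) =
    glOrder (Fintype.card F) n /
      ∏ s, glOrder ((Fintype.card F : ℝ) ^ orbitLen (Fintype.card F : ZMod a) s) (x s) := by
  classical
  have h1 := card_aeval_mul_card_aut (F := F) (Fin n → F) (OrbitModule hζ x)
  have h2 := card_linearEquiv_pi (R := F[X]) (OrbitField hζ) (orbitPoly hζ)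
    (fun s => AdjoinRoot.mk_surjective) (fun s => AdjoinRoot.mk_self) (isCoprime_orbitPoly hζ hq) x
  rw [h2] at h1
  have hdim : Module.finrank F (Fin n → F) = Module.finrank F (OrbitModule hζ x) := by
    rw [finrank_orbitModule hζ hq, hx]; simp
  have e0 := LinearEquiv.ofFinrankEq _ _ hdim
  have e1 : ((Fin n → F) ≃ₗ[F] OrbitModule hζ x) ≃ GL (Fin n) F :=
    Equiv.trans { toFun := fun f => f.trans e0.symm
                  invFun := fun g => g.trans e0
                  left_inv := fun f => by ext; simp
                  right_inv := fun g => by ext; simp }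
      (((LinearMap.GeneralLinearGroup.generalLinearEquiv F _).symm.trans
        Matrix.GeneralLinearGroup.toLin.symm).toEquiv)
  rw [Nat.card_congr e1] at h1
  have h3 := congrArg (fun m : ℕ => (m : ℝ)) h1
  simp only [Nat.cast_mul, Nat.cast_prod, natCast_card_GL, natCard_orbitField hζ hq,
    Nat.card_eq_fintype_card (α := F), Nat.cast_pow] at h3
  rw [eq_div_iff]
  · exact h3
  · refine Finset.prod_ne_zero_iff.2 fun s _ => ?_
    have := natCast_card_GL (OrbitField hζ s) (x s)
    rw [natCard_orbitField hζ hq, Nat.cast_pow] at this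
    rw [← this]
    exact_mod_cast Nat.card_pos.ne'

/-- Matrices of order dividing `a` are classified by the multiplicities `xₛ` of the Frobenius orbits
of eigenvalues. -/
theorem jCount_eq_sum (hζ : IsPrimitiveRoot ζ a) (hq : IsUnit (Fintype.card F : ZMod a)) (k : ℤ) :
    (jCount F n a ζ k : ℝ) =
      ∑ x ∈ weightVectors (orbitLen (Fintype.card F : ZMod a))
        (orbitSum (Fintype.card F : ZMod a)) (k : ZMod a) n,
        glOrder (Fintype.card F) n /
          ∏ s, glOrder ((Fintype.card F : ℝ) ^ orbitLen (Fintype.card F : ZMod a) s) (x s) := by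
  classical
  set S := weightVectors (orbitLen (Fintype.card F : ZMod a))
    (orbitSum (Fintype.card F : ZMod a)) (k : ZMod a) n with hS
  have hmem : ∀ x, x ∈ S ↔ _ := fun x => mem_weightVectors (orbitLen_pos hq)
  have hfinT : Finite (Module.End F (Fin n → F)) := DFunLike.finite _
  have hpow : ∀ T : Module.End F (Fin n → F), T ^ a = 1 → LinearMap.toMatrix' T ^ a = 1 := by
    intro T hT
    have := map_pow (LinearMap.toMatrixAlgEquiv' (R := F) (n := Fin n)) T a
    rw [hT, map_one] at this
    exact this.symm
  have e1 : {t : GL (Fin n) F // t ^ a = 1 ∧ algebraMap F (AlgebraicClosure F)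
        (t : Matrix (Fin n) (Fin n) F).det = ζ ^ k} ≃
      {T : Module.End F (Fin n → F) // T ^ a = 1 ∧
        algebraMap F (AlgebraicClosure F) (LinearMap.det T) = ζ ^ k} :=
    { toFun := fun t => ⟨Matrix.toLin' t.1, by
        rw [← Matrix.toLin'_pow, ← Units.val_pow_eq_pow_val, t.2.1, Units.val_one,
          Matrix.toLin'_one]
        rfl, by
        rw [LinearMap.det_toLin']
        exact t.2.2⟩
      invFun := fun T => ⟨Units.ofPowEqOne (LinearMap.toMatrix' T.1) a (hpow _ T.2.1) (NeZero.ne a), by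
        refine Units.ext ?_
        rw [Units.val_pow_eq_pow_val, Units.val_ofPowEqOne, hpow _ T.2.1]
        rfl, by
        rw [Units.val_ofPowEqOne, LinearMap.det_toMatrix']
        exact T.2.2⟩
      left_inv := fun t => by
        refine Subtype.ext (Units.ext ?_)
        simp
      right_inv := fun T => by
        refine Subtype.ext ?_
        simp }
  have e2 : (Σ x : S, {T : Module.End F (Fin n → F) //
        Nonempty (Module.AEval' T ≃ₗ[F[X]] OrbitModule hζ x.1)}) ≃
      {T : Module.End F (Fin n → F) // T ^ a = 1 ∧
        algebraMap F (AlgebraicClosure F) (LinearMap.det T) = ζ ^ k} := by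
    refine Equiv.ofBijective (fun p => ⟨p.2.1, ?_, ?_⟩) ⟨?_, ?_⟩
    · exact pow_eq_one_of_linearEquiv hζ hq _ _ p.2.2.some
    · rw [algebraMap_det_eq hζ hq _ _ p.2.2.some, ((hmem _).1 p.1.2).2, rootChar_intCast]
    · rintro ⟨⟨x, hx⟩, ⟨T, hT⟩⟩ ⟨⟨y, hy⟩, ⟨T', hT'⟩⟩ h
      have h1 : T = T' := congrArg Subtype.val h
      subst h1
      obtain rfl := eq_of_linearEquiv_orbitModule hζ hq T x y hT.some hT'.some
      rfl
    · rintro ⟨T, hT1, hT2⟩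
      obtain ⟨x, ⟨e⟩⟩ := exists_linearEquiv_orbitModule hζ hq T hT1
      refine ⟨⟨⟨x, (hmem x).2 ⟨sum_eq_of_linearEquiv hζ hq T x e, ?_⟩⟩, ⟨T, ⟨e⟩⟩⟩, rfl⟩
      rw [algebraMap_det_eq hζ hq T x e, ← rootChar_intCast hζ] at hT2
      exact rootChar_injective hζ hT2
  rw [jCount, Nat.card_congr (e1.trans e2.symm), Nat.card_sigma, Nat.cast_sum]
  rw [← Finset.sum_coe_sort S fun x => glOrder (Fintype.card F) n /
    ∏ s, glOrder ((Fintype.card F : ℝ) ^ orbitLen (Fintype.card F : ZMod a) s) (x s)]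
  exact Finset.sum_congr rfl fun x _ => card_class hζ hq x.1 ((hmem _).1 x.2).1

end

/-! ### Partial Euler products -/

/-- The partial Euler product `(1 - x) ⋯ (1 - xᵐ)` at a real point. -/
def eulerProd (x : ℝ) (m : ℕ) : ℝ := ∏ i ∈ Finset.range m, (1 - x ^ (i + 1))

/-- The infinite Euler product at a real point. -/
noncomputable def eulerInf (x : ℝ) : ℝ := (∏' n : ℕ, (1 - (x : ℂ) ^ (n + 1))).re

lemma ofReal_eulerProd (x : ℝ) (m : ℕ) : (eulerProd x m : ℂ) = qFactorial x m := by
  rw [eulerProd, qFactorial]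
  push_cast
  rfl

lemma tendsto_eulerProd {x : ℝ} (h0 : 0 ≤ x) (h1 : x < 1) :
    Filter.Tendsto (eulerProd x) Filter.atTop (𝓝 (eulerInf x)) := by
  have h := tendsto_qFactorial (Q := (x : ℂ)) (by simpa [abs_of_nonneg h0] using h1)
  have := (Complex.continuous_re.tendsto _).comp h
  refine this.congr fun m => ?_
  rw [Function.comp, ← ofReal_eulerProd, Complex.ofReal_re]

lemma ofReal_eulerInf {x : ℝ} (h0 : 0 ≤ x) (h1 : x < 1) :
    (eulerInf x : ℂ) = ∏' n : ℕ, (1 - (x : ℂ) ^ (n + 1)) := by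
  refine tendsto_nhds_unique ((Complex.continuous_ofReal.tendsto _).comp (tendsto_eulerProd h0 h1))
    ((tendsto_qFactorial (Q := (x : ℂ)) (by simpa [abs_of_nonneg h0] using h1)).congr fun m => ?_)
  rw [Function.comp, ofReal_eulerProd]

lemma eulerProd_nonneg {x : ℝ} (h0 : 0 ≤ x) (h1 : x ≤ 1 / 2) (m : ℕ) : 0 ≤ eulerProd x m :=
  Finset.prod_nonneg fun i _ => sub_nonneg.2 (pow_le_one₀ h0 (by linarith))

lemma eulerProd_le_one {x : ℝ} (h0 : 0 ≤ x) (h1 : x ≤ 1 / 2) (m : ℕ) : eulerProd x m ≤ 1 :=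
  Finset.prod_le_one (fun i _ => sub_nonneg.2 (pow_le_one₀ h0 (by linarith)))
    fun i _ => sub_le_self _ (pow_nonneg h0 _)

lemma exp_neg_two_le_eulerProd {x : ℝ} (h0 : 0 ≤ x) (h1 : x ≤ 1 / 2) (m : ℕ) : Real.exp (-2) ≤ eulerProd x m := by
  have h := exp_neg_two_le_norm_qFactorial (Q := (x : ℂ)) (by simpa [abs_of_nonneg h0] using h1) m
  rwa [← ofReal_eulerProd, Complex.norm_real,
    Real.norm_of_nonneg (eulerProd_nonneg h0 h1 m)] at h

/-- As `x ≤ 1/2`, the factor with index `i` changes the product by at most `xⁱ ≤ xⁱ⁻¹ - xⁱ`, and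
these bounds telescope. -/
lemma eulerProd_sub_le {x : ℝ} (h0 : 0 ≤ x) (h1 : x ≤ 1 / 2) (m j : ℕ) :
    |eulerProd x m - eulerProd x (m + j)| ≤ x ^ m - x ^ (m + j) := by
  induction j with
  | zero => simp
  | succ j ih =>
    have e : eulerProd x (m + (j + 1)) = eulerProd x (m + j) * (1 - x ^ (m + j + 1)) :=
      Finset.prod_range_succ _ _
    have h2 : eulerProd x m - eulerProd x (m + (j + 1)) =
        (eulerProd x m - eulerProd x (m + j)) + eulerProd x (m + j) * x ^ (m + j + 1) := by
      rw [e]; ring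
    have h3 : |eulerProd x (m + j) * x ^ (m + j + 1)| ≤ x ^ (m + j) - x ^ (m + j + 1) := by
      rw [abs_of_nonneg (mul_nonneg (eulerProd_nonneg h0 h1 _) (pow_nonneg h0 _))]
      have h4 : eulerProd x (m + j) * x ^ (m + j + 1) ≤ 1 * x ^ (m + j + 1) := by
        gcongr
        exact eulerProd_le_one h0 h1 _
      have h5 : x ^ (m + j + 1) ≤ x ^ (m + j) * (1 / 2) := by
        rw [pow_succ]; gcongr
      have h6 : 2 * x ^ (m + j + 1) ≤ x ^ (m + j) := by linarith
      linarith
    rw [h2]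
    have := abs_add_le (eulerProd x m - eulerProd x (m + j))
      (eulerProd x (m + j) * x ^ (m + j + 1))
    rw [← add_assoc m j 1]
    linarith

lemma abs_eulerProd_sub_eulerInf_le {x : ℝ} (h0 : 0 ≤ x) (h1 : x ≤ 1 / 2) (m : ℕ) : |eulerProd x m - eulerInf x| ≤ x ^ m := by
  have h := (tendsto_eulerProd h0 (by linarith)).comp (Filter.tendsto_add_atTop_nat m)
  refine le_of_tendsto (h.const_sub (eulerProd x m)).abs (Filter.Eventually.of_forall fun j => ?_)
  rw [Function.comp, add_comm j m]
  exact (eulerProd_sub_le h0 h1 m j).trans (sub_le_self _ (pow_nonneg h0 _))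

lemma exp_neg_two_le_eulerInf {x : ℝ} (h0 : 0 ≤ x) (h1 : x ≤ 1 / 2) : Real.exp (-2) ≤ eulerInf x :=
  ge_of_tendsto (tendsto_eulerProd h0 (by linarith))
    (Filter.Eventually.of_forall (exp_neg_two_le_eulerProd h0 h1))

lemma eulerInf_le_one {x : ℝ} (h0 : 0 ≤ x) (h1 : x ≤ 1 / 2) : eulerInf x ≤ 1 :=
  le_of_tendsto (tendsto_eulerProd h0 (by linarith))
    (Filter.Eventually.of_forall (eulerProd_le_one h0 h1))

/-! ### The count and its main term -/

lemma abs_prod_le_pow {κ : Type*} (t : Finset κ) (f : κ → ℝ) {B : ℝ} (hf : ∀ i ∈ t, |f i| ≤ B) :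
    |∏ i ∈ t, f i| ≤ B ^ t.card := by
  rw [Finset.abs_prod, ← Finset.prod_const]
  exact Finset.prod_le_prod (fun _ _ => abs_nonneg _) hf

lemma abs_prod_sub_prod_le {κ : Type*} (t : Finset κ) (f g : κ → ℝ) {B : ℝ} (hB : 1 ≤ B)
    (hf : ∀ i ∈ t, |f i| ≤ B) (hg : ∀ i ∈ t, |g i| ≤ B) :
    |∏ i ∈ t, f i - ∏ i ∈ t, g i| ≤ B ^ t.card * ∑ i ∈ t, |f i - g i| := by
  classical
  induction t using Finset.induction_on with
  | empty => simp
  | insert i t hi ih =>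
    have ih' := ih (fun j hj => hf j (Finset.mem_insert_of_mem hj))
      (fun j hj => hg j (Finset.mem_insert_of_mem hj))
    rw [Finset.prod_insert hi, Finset.prod_insert hi, Finset.sum_insert hi,
      Finset.card_insert_of_notMem hi]
    have hG : |∏ j ∈ t, g j| ≤ B ^ t.card :=
      abs_prod_le_pow _ _ fun j hj => hg j (Finset.mem_insert_of_mem hj)
    have e : f i * ∏ j ∈ t, f j - g i * ∏ j ∈ t, g j =
        f i * (∏ j ∈ t, f j - ∏ j ∈ t, g j) + (f i - g i) * ∏ j ∈ t, g j := by ring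
    have hBt : (0 : ℝ) ≤ B ^ t.card := by positivity
    have hS : 0 ≤ ∑ j ∈ t, |f j - g j| := Finset.sum_nonneg fun _ _ => abs_nonneg _
    rw [e]
    refine (abs_add_le _ _).trans ?_
    rw [abs_mul, abs_mul, pow_succ]
    have h1 : |f i| * |∏ j ∈ t, f j - ∏ j ∈ t, g j| ≤ B * (B ^ t.card * ∑ j ∈ t, |f j - g j|) :=
      mul_le_mul (hf i (Finset.mem_insert_self i t)) ih' (abs_nonneg _) (by linarith)
    have h2 : |f i - g i| * |∏ j ∈ t, g j| ≤ |f i - g i| * B ^ t.card := by gcongr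
    have h3 : |f i - g i| * B ^ t.card ≤ |f i - g i| * (B ^ t.card * B) := by
      gcongr
      nlinarith
    nlinarith

section

variable {ι : Type*} [Fintype ι] {a : ℕ}

/-- The ratio of partial Euler products in the size of a conjugacy class. -/
noncomputable def eulerRatio (l : ι → ℕ) (q : ℝ) (n : ℕ) (x : ι → ℕ) : ℝ :=
  eulerProd q⁻¹ n * ∏ s, (eulerProd (q⁻¹ ^ l s) (x s))⁻¹

/-- The limit of `eulerRatio`. -/
noncomputable def eulerRatioInf (l : ι → ℕ) (q : ℝ) : ℝ :=
  eulerInf q⁻¹ * ∏ s, (eulerInf (q⁻¹ ^ l s))⁻¹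

lemma abs_inv_le_exp_two {p : ℝ} (hp : Real.exp (-2) ≤ p) : |p⁻¹| ≤ Real.exp 2 := by
  have h0 := Real.exp_pos (-2)
  rw [abs_of_pos (inv_pos.2 (h0.trans_le hp)), ← inv_inv (Real.exp 2), ← Real.exp_neg]
  exact inv_anti₀ h0 hp

lemma abs_inv_sub_inv_le {p p' : ℝ} (hp : Real.exp (-2) ≤ p) (hp' : Real.exp (-2) ≤ p') :
    |p⁻¹ - p'⁻¹| ≤ Real.exp 4 * |p - p'| := by
  have h0 := Real.exp_pos (-2)
  have e : p⁻¹ - p'⁻¹ = p⁻¹ * p'⁻¹ * -(p - p') := by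
    have := (h0.trans_le hp).ne'
    have := (h0.trans_le hp').ne'
    field_simp
    ring
  rw [e, abs_mul, abs_mul, abs_neg]
  gcongr
  calc |p⁻¹| * |p'⁻¹| ≤ Real.exp 2 * Real.exp 2 := by
        gcongr
        · exact abs_inv_le_exp_two hp
        · exact abs_inv_le_exp_two hp'
    _ = Real.exp 4 := by rw [← Real.exp_add]; norm_num

lemma inv_pow_le_half {q : ℝ} (hq : 2 ≤ q) {l : ℕ} (hl : 0 < l) : q⁻¹ ^ l ≤ 1 / 2 := by
  have h1 : q⁻¹ ≤ 1 / 2 := by rw [one_div]; exact inv_anti₀ two_pos hq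
  have h0 : 0 ≤ q⁻¹ := inv_nonneg.2 (by linarith)
  calc q⁻¹ ^ l ≤ q⁻¹ ^ 1 := pow_le_pow_of_le_one h0 (by linarith) hl
    _ ≤ _ := by rw [pow_one]; exact h1

lemma abs_eulerRatio_le {l : ι → ℕ} (hl : ∀ s, 0 < l s) {q : ℝ} (hq : 2 ≤ q) (n : ℕ) (x : ι → ℕ) :
    |eulerRatio l q n x| ≤ Real.exp 2 ^ Fintype.card ι := by
  have h0 : ∀ l : ℕ, 0 ≤ q⁻¹ ^ l := fun l => pow_nonneg (inv_nonneg.2 (by linarith)) l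
  have h1 := inv_pow_le_half hq one_pos
  have h2 := h0 1
  rw [pow_one] at h1 h2
  rw [eulerRatio, abs_mul, ← one_mul (Real.exp 2 ^ Fintype.card ι)]
  refine mul_le_mul ?_ ?_ (abs_nonneg _) zero_le_one
  · rw [abs_of_nonneg (eulerProd_nonneg h2 h1 n)]
    exact eulerProd_le_one h2 h1 n
  · exact abs_prod_le_pow _ _ fun s _ => abs_inv_le_exp_two
      (exp_neg_two_le_eulerProd (h0 _) (inv_pow_le_half hq (hl s)) _)

lemma abs_eulerRatioInf_le {l : ι → ℕ} (hl : ∀ s, 0 < l s) {q : ℝ} (hq : 2 ≤ q) :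
    |eulerRatioInf l q| ≤ Real.exp 2 ^ Fintype.card ι := by
  have h0 : ∀ l : ℕ, 0 ≤ q⁻¹ ^ l := fun l => pow_nonneg (inv_nonneg.2 (by linarith)) l
  have h1 := inv_pow_le_half hq one_pos
  have h2 := h0 1
  rw [pow_one] at h1 h2
  rw [eulerRatioInf, abs_mul, ← one_mul (Real.exp 2 ^ Fintype.card ι)]
  refine mul_le_mul ?_ ?_ (abs_nonneg _) zero_le_one
  · rw [abs_of_nonneg ((Real.exp_pos _).le.trans (exp_neg_two_le_eulerInf h2 h1))]
    exact eulerInf_le_one h2 h1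
  · exact abs_prod_le_pow _ _ fun s _ => abs_inv_le_exp_two
      (exp_neg_two_le_eulerInf (h0 _) (inv_pow_le_half hq (hl s)))

/-- If `n` and all coordinates of `x` are at least `r`, then the Euler products are within `q ^
(-r)` of their limits, up to a constant that does not depend on `q`. -/
lemma abs_eulerRatio_sub_le {l : ι → ℕ} (hl : ∀ s, 0 < l s) {q : ℝ} (hq : 2 ≤ q) (n : ℕ)
    (x : ι → ℕ) {r : ℝ} (hn : r ≤ n) (hx : ∀ s, r ≤ x s) :
    |eulerRatio l q n x - eulerRatioInf l q| ≤
      Real.exp 2 ^ Fintype.card ι * (1 + Real.exp 4 * Fintype.card ι) *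
        Real.exp (-(Real.log q * r)) := by
  have h0 : ∀ l : ℕ, 0 ≤ q⁻¹ ^ l := fun l => pow_nonneg (inv_nonneg.2 (by linarith)) l
  have h1 := inv_pow_le_half hq one_pos
  have h2 := h0 1
  rw [pow_one] at h1 h2
  have hlog : 0 ≤ Real.log q := Real.log_nonneg (by linarith)
  have hqpos : 0 < q := by linarith
  have hpow : ∀ m : ℕ, r ≤ m → q⁻¹ ^ m ≤ Real.exp (-(Real.log q * r)) := by
    intro m hm
    have : q⁻¹ ^ m = Real.exp (-(Real.log q * m)) := by
      rw [Real.exp_neg, mul_comm, Real.exp_nat_mul, Real.exp_log hqpos, inv_pow]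
    rw [this]
    refine Real.exp_le_exp.2 (neg_le_neg ?_)
    gcongr
  set E := Real.exp (-(Real.log q * r))
  set P := ∏ s, (eulerProd (q⁻¹ ^ l s) (x s))⁻¹
  set P' := ∏ s, (eulerInf (q⁻¹ ^ l s))⁻¹ with hP'
  have hA := fun s => exp_neg_two_le_eulerProd (h0 (l s)) (inv_pow_le_half hq (hl s)) (x s)
  have hB := fun s => exp_neg_two_le_eulerInf (h0 (l s)) (inv_pow_le_half hq (hl s))
  have hPP' : |P - P'| ≤ Real.exp 2 ^ Fintype.card ι * (Real.exp 4 * Fintype.card ι * E) := by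
    refine (abs_prod_sub_prod_le Finset.univ _ _ (Real.one_le_exp (by norm_num : (0 : ℝ) ≤ 2))
      (fun s _ => abs_inv_le_exp_two (hA s)) (fun s _ => abs_inv_le_exp_two (hB s))).trans ?_
    rw [Finset.card_univ]
    refine mul_le_mul_of_nonneg_left ?_ (by positivity)
    calc _ ≤ ∑ s : ι, Real.exp 4 * E := by
          refine Finset.sum_le_sum fun s _ => (abs_inv_sub_inv_le (hA s) (hB s)).trans ?_
          gcongr
          refine (abs_eulerProd_sub_eulerInf_le (h0 _) (inv_pow_le_half hq (hl s)) _).trans ?_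
          rw [← pow_mul]
          refine hpow _ ((hx s).trans ?_)
          exact_mod_cast Nat.le_mul_of_pos_left _ (hl s)
      _ = _ := by
          rw [Finset.sum_const, Finset.card_univ, nsmul_eq_mul]; ring
  have hP'le : |P'| ≤ Real.exp 2 ^ Fintype.card ι := by
    rw [hP']
    exact abs_prod_le_pow _ _ fun s _ => abs_inv_le_exp_two (hB s)
  have e : eulerRatio l q n x - eulerRatioInf l q =
      eulerProd q⁻¹ n * (P - P') + (eulerProd q⁻¹ n - eulerInf q⁻¹) * P' := by
    rw [eulerRatio, eulerRatioInf]; ring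
  have h3 : |eulerProd q⁻¹ n| ≤ 1 := by
    rw [abs_of_nonneg (eulerProd_nonneg h2 h1 n)]
    exact eulerProd_le_one h2 h1 n
  have h4 : |eulerProd q⁻¹ n - eulerInf q⁻¹| ≤ E :=
    (abs_eulerProd_sub_eulerInf_le h2 h1 n).trans (hpow n hn)
  rw [e]
  refine (abs_add_le _ _).trans ?_
  rw [abs_mul, abs_mul]
  calc _ ≤ 1 * (Real.exp 2 ^ Fintype.card ι * (Real.exp 4 * Fintype.card ι * E)) +
        E * Real.exp 2 ^ Fintype.card ι := by gcongr
    _ = _ := by ring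

lemma glOrder_eq {Q : ℝ} (hQ : 0 < Q) (m : ℕ) :
    glOrder Q m = Real.exp (Real.log Q * (m : ℝ) ^ 2) * eulerProd Q⁻¹ m := by
  have h1 : glOrder Q m = ∏ i ∈ Finset.range m, Q ^ m * (1 - Q⁻¹ ^ (m - i)) := by
    refine Finset.prod_congr rfl fun i hi => ?_
    have him := (Finset.mem_range.1 hi).le
    have e : Q ^ m = Q ^ i * Q ^ (m - i) := by rw [← pow_add, Nat.add_sub_cancel' him]
    rw [mul_sub, mul_one, inv_pow]
    nth_rewrite 3 [e]
    rw [mul_assoc, mul_inv_cancel₀ (by positivity), mul_one]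
  rw [h1, Finset.prod_mul_distrib, Finset.prod_const, Finset.card_range, eulerProd]
  congr 1
  · rw [← pow_mul, ← Real.rpow_natCast, Real.rpow_def_of_pos hQ]
    push_cast
    ring_nf
  · rw [← Finset.prod_range_reflect]
    refine Finset.prod_congr rfl fun i hi => ?_
    have := Finset.mem_range.1 hi
    congr 2
    omega

variable [NeZero a]

/-- The sizes of the conjugacy classes. -/
lemma glOrder_div_prod_eq {l : ι → ℕ} {c : ι → ZMod a} {k : ZMod a} {n : ℕ}
    (hla : ∑ s, l s = a) {q : ℝ} (hq : 2 ≤ q) {x : ι → ℕ}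
    (hx : (fun s => (x s : ℤ)) ∈ weightCoset l c k n) :
    glOrder q n / ∏ s, glOrder (q ^ l s) (x s) =
      Real.exp (Real.log q * ((1 - 1 / a) * (n : ℝ) ^ 2)) *
        (Real.exp (-(Real.log q * weightNorm l (n / a) fun s => (x s : ℤ))) *
          eulerRatio l q n x) := by
  have hq0 : 0 < q := by linarith
  have h1 := weightNorm_eq l c k n hla hx
  simp only [glOrder_eq hq0, fun s => glOrder_eq (pow_pos hq0 (l s)), Finset.prod_mul_distrib,
    eulerRatio, Finset.prod_inv_distrib]
  rw [← Real.exp_sum, ← mul_assoc, ← Real.exp_add, h1, div_eq_mul_inv, mul_inv, ← Real.exp_neg,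
    mul_mul_mul_comm, ← Real.exp_add]
  simp only [inv_pow]
  congr 2
  have e : ∑ s, Real.log (q ^ l s) * (x s : ℝ) ^ 2 =
      Real.log q * ∑ s, (l s : ℝ) * (((x s : ℤ)) : ℝ) ^ 2 := by
    rw [Finset.mul_sum]
    refine Finset.sum_congr rfl fun s _ => ?_
    rw [Real.log_pow]
    push_cast
    ring
  rw [e]
  ring

end

section

variable {ι : Type*} [Fintype ι] {a : ℕ}

/-- The main term: a theta series divided by Euler products. -/
noncomputable def mainTerm (l : ι → ℕ) (c : ι → ZMod a) (k : ZMod a) (n : ℕ) (q : ℝ) : ℝ :=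
  eulerRatioInf l q * ∑' x : weightCoset l c k n, Real.exp (-(Real.log q * weightNorm l (n / a) x.1))

lemma expTwoPiI_qPoint_mul {q : ℕ} (w : ℝ) :
    expTwoPiI (qPoint q * w) = (Real.exp (-(Real.log q * w)) : ℝ) := by
  have hpi : (Real.pi : ℂ) ≠ 0 := by exact_mod_cast Real.pi_ne_zero
  rw [expTwoPiI, qPoint, Complex.ofReal_exp]
  congr 1
  push_cast
  field_simp
  rw [Complex.I_sq]
  ring

lemma eta_natCast_mul_qPoint {q : ℕ} (hq : 2 ≤ q) {l : ℕ} (hl : 0 < l) :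
    ModularForm.eta (l * qPoint q) =
      ((Real.exp (-(Real.log q * (l / 24))) * eulerInf ((q : ℝ)⁻¹ ^ l) : ℝ) : ℂ) := by
  have hq' : (2 : ℝ) ≤ q := by exact_mod_cast hq
  have h0 : 0 ≤ (q : ℝ)⁻¹ ^ l := by positivity
  have h1 := inv_pow_le_half hq' hl
  have e1 : (l : ℂ) * qPoint q / 24 = qPoint q * ((l / 24 : ℝ) : ℂ) := by push_cast; ring
  have e2 : (l : ℂ) * qPoint q = qPoint q * ((l : ℝ) : ℂ) := by push_cast; ring
  have e3 : Real.exp (-(Real.log q * l)) = (q : ℝ)⁻¹ ^ l := by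
    rw [Real.exp_neg, mul_comm, Real.exp_nat_mul, Real.exp_log (by linarith), inv_pow]
  rw [eta_eq_tprod, e1, e2, expTwoPiI_qPoint_mul, expTwoPiI_qPoint_mul, e3, Complex.ofReal_mul,
    ofReal_eulerInf h0 (by linarith)]

/-- The modular form at `i log q / 2π` is the main term, up to a power of `q`. -/
lemma weightForm_qPoint {l : ι → ℕ} (hl : ∀ s, 0 < l s) (c : ι → ZMod a) (k : ZMod a) (n : ℕ)
    (hla : ∑ s, l s = a) {q : ℕ} (hq : 2 ≤ q) :
    weightForm l c k n (qPoint q) =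
      ((mainTerm l c k n q * Real.exp (Real.log q * ((a - 1) / 24)) : ℝ) : ℂ) := by
  have h1 := eta_natCast_mul_qPoint hq one_pos
  rw [Nat.cast_one, one_mul, Nat.cast_one, pow_one] at h1
  have h2 : weightTheta l c k n (qPoint q) =
      ((∑' x : weightCoset l c k n,
        Real.exp (-(Real.log q * weightNorm l (n / a) x.1)) : ℝ) : ℂ) := by
    rw [weightTheta, Complex.ofReal_tsum]
    exact tsum_congr fun x => expTwoPiI_qPoint_mul _
  have h3 : ∑ s, -(Real.log q * ((l s : ℝ) / 24)) = -(Real.log q * (a / 24)) := by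
    rw [Finset.sum_neg_distrib, ← Finset.mul_sum, ← Finset.sum_div, ← hla]
    push_cast
    rfl
  rw [weightForm, h1, h2, Finset.prod_congr rfl fun s _ => eta_natCast_mul_qPoint hq (hl s),
    ← Complex.ofReal_prod, ← Complex.ofReal_mul, ← Complex.ofReal_div, Complex.ofReal_inj,
    Finset.prod_mul_distrib, ← Real.exp_sum, h3, mainTerm, eulerRatioInf, Finset.prod_inv_distrib]
  have e : Real.exp (Real.log q * (((a : ℝ) - 1) / 24)) =
      Real.exp (-(Real.log q * (1 / 24))) * (Real.exp (-(Real.log q * (a / 24))))⁻¹ := by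
    rw [← Real.exp_neg, ← Real.exp_add]
    congr 1
    ring
  rw [e, div_eq_mul_inv, mul_inv]
  ring

lemma summable_exp_log_mul_and_le {l : ι → ℕ} (hl : ∀ s, 0 < l s) (X : Set (ι → ℤ)) (b : ℝ) {t L : ℝ}
    (ht : 0 < t) (hL : t ≤ L) :
    (Summable fun x : X => Real.exp (-(L * weightNorm l b x.1))) ∧
      ∑' x : X, Real.exp (-(L * weightNorm l b x.1)) ≤ ∏ s, gaussBound (t * l s) := by
  obtain ⟨h1, h2⟩ := summable_exp_weightNorm_subtype_and_le l hl ht b X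
  have hle : ∀ x : X, Real.exp (-(L * weightNorm l b x.1)) ≤ Real.exp (-t * weightNorm l b x.1) := by
    intro x
    refine Real.exp_le_exp.2 ?_
    have : 0 ≤ weightNorm l b x.1 := by rw [weightNorm]; positivity
    nlinarith
  have h3 := Summable.of_nonneg_of_le (fun _ => (Real.exp_pos _).le) hle h1
  exact ⟨h3, (h3.tsum_le_tsum hle h1).trans h2⟩

/-- The main term is bounded uniformly in `q` and `n`. -/
lemma abs_mainTerm_le {l : ι → ℕ} (hl : ∀ s, 0 < l s) (c : ι → ZMod a) (k : ZMod a) (n : ℕ)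
    {q : ℝ} (hq : 2 ≤ q) : |mainTerm l c k n q| ≤
      Real.exp 2 ^ Fintype.card ι * ∏ s, gaussBound (Real.log 2 * l s) := by
  rw [mainTerm, abs_mul]
  refine mul_le_mul (abs_eulerRatioInf_le hl hq) ?_ (abs_nonneg _) (by positivity)
  rw [abs_of_nonneg (tsum_nonneg fun _ => (Real.exp_pos _).le)]
  exact (summable_exp_log_mul_and_le hl _ _ (Real.log_pos one_lt_two)
    (Real.log_le_log two_pos hq)).2

variable [NeZero a]

/-- The count divided by its leading power of `q`. -/
noncomputable def scaledCount (l : ι → ℕ) (c : ι → ZMod a) (k : ZMod a) (n : ℕ) (q : ℝ) : ℝ :=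
  ∑ x ∈ weightVectors l c k n,
    Real.exp (-(Real.log q * weightNorm l (n / a) fun s => (x s : ℤ))) * eulerRatio l q n x

/-- Comparison of the count with the main term, term by term. A vector with a coordinate below
`n / 2a` is far from the centre, so that its contribution is negligible; for the other vectors the
partial Euler products are close to their limits. -/
lemma abs_scaledCount_sub_mainTerm_le {l : ι → ℕ} (hl : ∀ s, 0 < l s) (c : ι → ZMod a) (k : ZMod a)
    {n : ℕ} (hn : 4 * a ≤ n) {q : ℝ} (hq : 2 ≤ q) :
    |scaledCount l c k n q - mainTerm l c k n q| ≤
      2 * Real.exp 2 ^ Fintype.card ι * (1 + Real.exp 4 * Fintype.card ι) *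
        (∏ s, gaussBound (Real.log 2 / 2 * l s)) * Real.exp (-(Real.log q * (n / (2 * a)))) := by
  classical
  have ha : (0 : ℝ) < a := Nat.cast_pos.2 (NeZero.pos a)
  have ha1 : (1 : ℝ) ≤ a := by exact_mod_cast NeZero.pos a
  have hlog2 : 0 < Real.log 2 := Real.log_pos one_lt_two
  have hL : Real.log 2 ≤ Real.log q := Real.log_le_log two_pos hq
  set L := Real.log q
  set w : (ι → ℤ) → ℝ := weightNorm l (n / a) with hw
  set D := Real.exp 2 ^ Fintype.card ι with hD
  set K := 2 * D * (1 + Real.exp 4 * Fintype.card ι) with hK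
  have hD0 : 0 < D := by positivity
  have hK2 : 2 * D ≤ K := by
    rw [hK]
    have : 0 ≤ Real.exp 4 * Fintype.card ι := by positivity
    nlinarith
  set X := weightCoset l c k n
  set y : X → ι → ℕ := fun x s => (x.1 s).toNat
  -- The count and the main term as sums `g` and `h` over the same coset: the vectors with a
  -- negative coordinate contribute zero to `g`.
  set g : X → ℝ := fun x =>
    if ∀ s, 0 ≤ x.1 s then Real.exp (-(L * w x.1)) * eulerRatio l q n (y x) else 0 with hg
  set h : X → ℝ := fun x => Real.exp (-(L * w x.1)) * eulerRatioInf l q with hh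
  obtain ⟨hs1, hs2⟩ := summable_exp_log_mul_and_le hl X (n / a) (half_pos hlog2)
    (by linarith : Real.log 2 / 2 ≤ L / 2)
  have hsh : HasSum h (mainTerm l c k n q) := by
    rw [mainTerm, mul_comm]
    exact (summable_exp_log_mul_and_le hl X (n / a) hlog2 hL).1.hasSum.mul_right _
  have hsg : HasSum g (scaledCount l c k n q) := by
    let emb : weightVectors l c k n → X := fun x => ⟨fun s => (x.1 s : ℤ), by
      have := (mem_weightVectors hl).1 x.2
      exact ⟨by beta_reduce; exact_mod_cast this.1, by simpa using this.2⟩⟩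
    have hinj : Function.Injective emb := by
      intro x x' hxx
      have := congrArg Subtype.val hxx
      refine Subtype.ext (funext fun s => ?_)
      exact Int.ofNat_inj.1 (congrFun this s)
    rw [← hinj.hasSum_iff]
    · have e : g ∘ emb = fun x => Real.exp (-(L * w fun s => (x.1 s : ℤ))) * eulerRatio l q n x.1 := by
        funext x
        simp [hg, emb, y]
      rw [e, scaledCount, ← Finset.sum_coe_sort]
      exact hasSum_fintype _
    · intro x hx
      rw [hg]
      refine if_neg fun hpos => hx ?_
      refine ⟨⟨y x, (mem_weightVectors hl).2 ?_⟩, Subtype.ext (funext fun s => ?_)⟩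
      · have e : ∀ s, ((y x s : ℕ) : ℤ) = x.1 s := fun s => Int.toNat_of_nonneg (hpos s)
        refine ⟨?_, ?_⟩
        · have := x.2.1
          simp only [← e] at this
          exact_mod_cast this
        · have := x.2.2
          simp only [← e] at this
          simpa using this
      · exact Int.toNat_of_nonneg (hpos s)
  have hn4 : (4 : ℝ) * a ≤ n := by exact_mod_cast hn
  set r : ℝ := n / (2 * a) with hr
  have hr2 : 2 ≤ r := by rw [hr, le_div_iff₀ (by positivity)]; linarith
  have hrn : r ≤ n := div_le_self (Nat.cast_nonneg n) (by linarith)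
  -- One half of each Gaussian exponent is kept for summability, the other half provides the decay.
  have hbound : ∀ x, |g x - h x| ≤ K * Real.exp (-(L * r)) * Real.exp (-(L / 2 * w x.1)) := by
    intro x
    have hw0 : 0 ≤ w x.1 := by rw [hw, weightNorm]; positivity
    by_cases hx : ∀ s, r ≤ x.1 s
    · have hpos : ∀ s, 0 ≤ x.1 s := fun s => by
        have := hx s
        have h0 : (0 : ℝ) ≤ (x.1 s : ℝ) := by linarith
        exact_mod_cast h0
      have hy : ∀ s, r ≤ (y x s : ℝ) := fun s => by
        have : ((y x s : ℕ) : ℤ) = x.1 s := Int.toNat_of_nonneg (hpos s)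
        calc r ≤ ((x.1 s : ℤ) : ℝ) := hx s
          _ = ((y x s : ℕ) : ℝ) := by rw [← this, Int.cast_natCast]
      have h1 := abs_eulerRatio_sub_le hl hq n (y x) hrn hy
      have e : g x - h x = Real.exp (-(L * w x.1)) * (eulerRatio l q n (y x) - eulerRatioInf l q) := by
        simp only [hg, hh]
        rw [if_pos hpos]; ring
      rw [e, abs_mul, abs_of_pos (Real.exp_pos _), mul_comm]
      refine mul_le_mul (h1.trans ?_) (Real.exp_le_exp.2 ?_) (Real.exp_pos _).le (by positivity)
      · gcongr
        rw [hK]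
        have : 0 ≤ D * (1 + Real.exp 4 * Fintype.card ι) := by positivity
        linarith
      · nlinarith
    · push Not at hx
      obtain ⟨s, hs⟩ := hx
      have hwr : 2 * r ≤ w x.1 := by
        have h1 : r ^ 2 ≤ ((x.1 s : ℝ) - n / a) ^ 2 := by
          have : (n : ℝ) / a = 2 * r := by rw [hr]; field_simp
          rw [this]
          nlinarith
        have h2 : ((x.1 s : ℝ) - n / a) ^ 2 ≤ w x.1 := by
          rw [hw, weightNorm]
          have hls : (1 : ℝ) ≤ l s := by exact_mod_cast hl s
          refine le_trans ?_ (Finset.single_le_sum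
            (f := fun s => (l s : ℝ) * ((x.1 s : ℝ) - n / a) ^ 2)
            (fun _ _ => by positivity) (Finset.mem_univ s))
          nlinarith [sq_nonneg ((x.1 s : ℝ) - n / a)]
        nlinarith
      have h1 : |g x - h x| ≤ Real.exp (-(L * w x.1)) * (2 * D) := by
        have hh' : |h x| ≤ Real.exp (-(L * w x.1)) * D := by
          simp only [hh]
          rw [abs_mul, abs_of_pos (Real.exp_pos _)]
          gcongr
          exact abs_eulerRatioInf_le hl hq
        have hg' : |g x| ≤ Real.exp (-(L * w x.1)) * D := by
          simp only [hg]
          split_ifs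
          · rw [abs_mul, abs_of_pos (Real.exp_pos _)]
            gcongr
            exact abs_eulerRatio_le hl hq n _
          · rw [abs_zero]; positivity
        have := abs_sub (g x) (h x)
        linarith
      refine h1.trans ?_
      have e : Real.exp (-(L * w x.1)) = Real.exp (-(L / 2 * w x.1)) * Real.exp (-(L / 2 * w x.1)) := by
        rw [← Real.exp_add]; congr 1; ring
      have h2 : Real.exp (-(L / 2 * w x.1)) ≤ Real.exp (-(L * r)) :=
        Real.exp_le_exp.2 (by nlinarith)
      rw [e]
      calc _ ≤ Real.exp (-(L / 2 * w x.1)) * Real.exp (-(L * r)) * K := by gcongr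
        _ = _ := by ring
  have hdiff := hsg.sub hsh
  have hsb := hs1.mul_left (K * Real.exp (-(L * r)))
  have h1 : |scaledCount l c k n q - mainTerm l c k n q| ≤
      ∑' x : X, K * Real.exp (-(L * r)) * Real.exp (-(L / 2 * w x.1)) := by
    rw [← hdiff.tsum_eq, ← Real.norm_eq_abs]
    exact tsum_of_norm_bounded hsb.hasSum hbound
  refine h1.trans ?_
  rw [tsum_mul_left]
  calc _ ≤ K * Real.exp (-(L * r)) * ∏ s, gaussBound (Real.log 2 / 2 * l s) := by gcongr
    _ = _ := by ring

/-- The error is smaller than any fixed power of `q`, uniformly in `q`. -/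
lemma exists_forall_abs_scaledCount_sub_le {l : ι → ℕ} (hl : ∀ s, 0 < l s) (c : ι → ZMod a)
    (k : ZMod a) (M : ℝ) {δ : ℝ} (hδ : 0 < δ) : ∃ n₀ : ℕ, ∀ n, n₀ ≤ n → ∀ q : ℝ, 2 ≤ q →
      |scaledCount l c k n q - mainTerm l c k n q| ≤ δ * Real.exp (-(Real.log q * M)) := by
  have ha : (0 : ℝ) < a := Nat.cast_pos.2 (NeZero.pos a)
  have hlog2 : 0 < Real.log 2 := Real.log_pos one_lt_two
  set K := 2 * Real.exp 2 ^ Fintype.card ι * (1 + Real.exp 4 * Fintype.card ι) *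
        (∏ s, gaussBound (Real.log 2 / 2 * l s)) with hK
  have hK0 : 0 ≤ K := by
    have : 0 ≤ ∏ s, gaussBound (Real.log 2 / 2 * l s) := Finset.prod_nonneg fun s _ =>
      (gaussBound_pos (by have := Nat.cast_pos (α := ℝ).2 (hl s); positivity)).le
    positivity
  have hlim : Filter.Tendsto (fun n : ℕ => K * Real.exp (-(Real.log 2 * (n / (2 * a) - M))))
      Filter.atTop (𝓝 (K * 0)) := by
    refine Filter.Tendsto.const_mul K (Real.tendsto_exp_neg_atTop_nhds_zero.comp ?_)
    refine Filter.Tendsto.const_mul_atTop hlog2 (Filter.tendsto_atTop_add_const_right _ _ ?_)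
    exact tendsto_natCast_atTop_atTop.atTop_div_const (by positivity)
  rw [mul_zero] at hlim
  have hev := (hlim.eventually (gt_mem_nhds hδ)).and
    ((Filter.eventually_ge_atTop (4 * a)).and
      (Filter.eventually_ge_atTop ⌈2 * a * M⌉₊))
  obtain ⟨n₀, hn₀⟩ := Filter.eventually_atTop.1 hev
  refine ⟨n₀, fun n hn q hq => ?_⟩
  obtain ⟨h1, h2, h3⟩ := hn₀ n hn
  have hL : Real.log 2 ≤ Real.log q := Real.log_le_log two_pos hq
  have h4 : M ≤ n / (2 * a) := by
    rw [le_div_iff₀ (by positivity)]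
    have := Nat.ceil_le.1 h3
    linarith
  refine (abs_scaledCount_sub_mainTerm_le hl c k h2 hq).trans ?_
  have e : Real.exp (-(Real.log q * (n / (2 * a)))) =
      Real.exp (-(Real.log q * (n / (2 * a) - M))) * Real.exp (-(Real.log q * M)) := by
    rw [← Real.exp_add]; congr 1; ring
  rw [e, ← mul_assoc]
  refine mul_le_mul_of_nonneg_right (le_trans ?_ h1.le) (Real.exp_pos _).le
  refine mul_le_mul_of_nonneg_left (Real.exp_le_exp.2 ?_) hK0
  nlinarith

end

/-! ### Asymptotics of `jCount` -/

section

variable {a : ℕ} [NeZero a]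

lemma two_le_card_cast (F : Type*) [Field F] [Fintype F] : (2 : ℝ) ≤ Fintype.card F := by
  exact_mod_cast Fintype.one_lt_card (α := F)

/-- The exponent of the leading power of `q` is `(1 - 1/a) n²`, attained at the centre `(n/a, …,
n/a)`. -/
lemma jCount_eq_scaledCount {F : Type*} [Field F] [Fintype F] {ζ : AlgebraicClosure F}
    (hζ : IsPrimitiveRoot ζ a) (hq : IsUnit (Fintype.card F : ZMod a)) (k : ℤ) (n : ℕ) :
    (jCount F n a ζ k : ℝ) =
      Real.exp (Real.log (Fintype.card F) * ((1 - 1 / a) * (n : ℝ) ^ 2)) *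
        scaledCount (orbitLen (Fintype.card F : ZMod a)) (orbitSum (Fintype.card F : ZMod a))
          (k : ZMod a) n (Fintype.card F) := by
  rw [jCount_eq_sum hζ hq, scaledCount, Finset.mul_sum]
  refine Finset.sum_congr rfl fun x hx => ?_
  have hx' := (mem_weightVectors (orbitLen_pos hq)).1 hx
  refine glOrder_div_prod_eq (sum_orbitLen hq) (two_le_card_cast F)
    (c := orbitSum (Fintype.card F : ZMod a)) (k := (k : ZMod a)) ⟨?_, ?_⟩
  · beta_reduce
    exact_mod_cast hx'.1
  · simpa using hx'.2

variable (a) in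
/-- Uniformity in the class of `q` and in `k`, of which there are finitely many. -/
lemma exists_forall_abs_scaledCount_sub_le' (M : ℝ) {δ : ℝ} (hδ : 0 < δ) :
    ∃ n₀ : ℕ, ∀ u k : ZMod a, IsUnit u → ∀ n, n₀ ≤ n → ∀ q : ℝ, 2 ≤ q →
      |scaledCount (orbitLen u) (orbitSum u) k n q - mainTerm (orbitLen u) (orbitSum u) k n q| ≤
        δ * Real.exp (-(Real.log q * M)) := by
  have h : ∀ p : ZMod a × ZMod a, ∃ n₀ : ℕ, IsUnit p.1 → ∀ n, n₀ ≤ n → ∀ q : ℝ, 2 ≤ q →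
      |scaledCount (orbitLen p.1) (orbitSum p.1) p.2 n q -
        mainTerm (orbitLen p.1) (orbitSum p.1) p.2 n q| ≤ δ * Real.exp (-(Real.log q * M)) := by
    intro p
    by_cases hu : IsUnit p.1
    · obtain ⟨n₀, hn₀⟩ := exists_forall_abs_scaledCount_sub_le (orbitLen_pos hu) (orbitSum p.1) p.2
        M hδ
      exact ⟨n₀, fun _ => hn₀⟩
    · exact ⟨0, fun h => absurd h hu⟩
  choose N hN using h
  refine ⟨Finset.univ.sup N, fun u k hu n hn => hN (u, k) hu n (le_trans ?_ hn)⟩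
  exact Finset.le_sup (f := N) (Finset.mem_univ (u, k))

variable (a) in
lemma exists_forall_abs_mainTerm_le : ∃ B : ℝ, 0 ≤ B ∧ ∀ u k : ZMod a, IsUnit u → ∀ (n : ℕ) (q : ℝ),
    2 ≤ q → |mainTerm (orbitLen u) (orbitSum u) k n q| ≤ B := by
  have h : ∀ u : ZMod a, ∃ B : ℝ, 0 ≤ B ∧ (IsUnit u → ∀ (k : ZMod a) (n : ℕ) (q : ℝ), 2 ≤ q →
      |mainTerm (orbitLen u) (orbitSum u) k n q| ≤ B) := by
    intro u
    by_cases hu : IsUnit u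
    · have h := fun k n q hq => abs_mainTerm_le (orbitLen_pos hu) (orbitSum u) k n (q := q) hq
      exact ⟨_, (abs_nonneg _).trans (h 0 0 2 le_rfl), fun _ k n q hq => h k n q hq⟩
    · exact ⟨0, le_rfl, fun h => absurd h hu⟩
  choose B hB0 hB using h
  refine ⟨∑ u, B u, Finset.sum_nonneg fun u _ => hB0 u, fun u k hu n q hq => ?_⟩
  exact (hB u hu k n q hq).trans (Finset.single_le_sum (fun u _ => hB0 u) (Finset.mem_univ u))

/-- The modular form at `i log q / 2π` is the main term, up to a power of `q`. -/
lemma fForm_qPoint {u : ZMod a} (hu : IsUnit u) (k : ZMod a) (n : ℕ) {q : ℕ} (hq : 2 ≤ q) :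
    fForm u k n (qPoint q) =
      ((mainTerm (orbitLen u) (orbitSum u) k n q * Real.exp (Real.log q * ((a - 1) / 24)) : ℝ) : ℂ) := by
  rw [fForm_eq_weightForm hu]
  exact weightForm_qPoint (orbitLen_pos hu) _ k n (sum_orbitLen hu) hq

end

/-- The decay of the error beyond every power of `q` absorbs the factor `q ^ ((a - 1) / 24)`, so
that `ε` is small uniformly in `q`. -/
theorem jCount_asymptotics (a : ℕ) [NeZero a] (k : ℤ) (δ : ℝ) (hδ : 0 < δ) : ∃ n₀ : ℕ,
    ∀ (F : Type*) [Field F] [Fintype F] (ζ : AlgebraicClosure F) (q n : ℕ), n₀ ≤ n →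
      Fintype.card F = q → q.Coprime a → IsPrimitiveRoot ζ a →
      ∃ ε : ℝ, |ε| < δ ∧
        (jCount F n a ζ k : ℂ) =
          (fForm (q : ZMod a) (k : ZMod a) n (qPoint q) + (ε : ℂ)) *
            (((q : ℝ) ^ ((1 - (a : ℝ)) / 24) *
              (q : ℝ) ^ ((1 - 1 / (a : ℝ)) * (n : ℝ) ^ 2) : ℝ) : ℂ) := by
  obtain ⟨n₀, hn₀⟩ := exists_forall_abs_scaledCount_sub_le' a ((a - 1) / 24) (half_pos hδ)
  refine ⟨n₀, fun F _ _ ζ q n hn hFq hcop hζ => ?_⟩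
  subst hFq
  set q := Fintype.card F
  have hq2 : (2 : ℝ) ≤ q := two_le_card_cast F
  have hq2' : 2 ≤ q := Fintype.one_lt_card (α := F)
  have hu : IsUnit (q : ZMod a) := (ZMod.isUnit_iff_coprime q a).2 hcop
  have hq0 : (0 : ℝ) < q := by linarith
  set S := scaledCount (orbitLen (q : ZMod a)) (orbitSum (q : ZMod a)) (k : ZMod a) n q with hS
  set m := mainTerm (orbitLen (q : ZMod a)) (orbitSum (q : ZMod a)) (k : ZMod a) n q with hm
  set L := Real.log q
  have hSm : |S - m| ≤ δ / 2 * Real.exp (-(L * ((a - 1) / 24))) := hn₀ q k hu n hn q hq2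
  refine ⟨(S - m) * Real.exp (L * ((a - 1) / 24)), ?_, ?_⟩
  · rw [abs_mul, abs_of_pos (Real.exp_pos _)]
    calc _ ≤ δ / 2 * Real.exp (-(L * ((a - 1) / 24))) * Real.exp (L * ((a - 1) / 24)) := by gcongr
      _ = δ / 2 := by rw [mul_assoc, ← Real.exp_add, neg_add_cancel, Real.exp_zero, mul_one]
      _ < δ := by linarith
  · have hj := jCount_eq_scaledCount hζ hu k n
    rw [fForm_qPoint hu _ n hq2', ← hm]
    have e : (jCount F n a ζ k : ℂ) = ((jCount F n a ζ k : ℝ) : ℂ) := by simp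
    rw [e, hj, ← Complex.ofReal_add, ← Complex.ofReal_mul, Complex.ofReal_inj,
      Real.rpow_def_of_pos hq0, Real.rpow_def_of_pos hq0, ← add_mul, add_sub_cancel, mul_assoc,
      ← mul_assoc (Real.exp _) (Real.exp _), ← Real.exp_add]
    have e2 : L * (((a : ℝ) - 1) / 24) + L * ((1 - (a : ℝ)) / 24) = 0 := by ring
    rw [e2, Real.exp_zero, one_mul, mul_comm]

/-! ### Modularity of `fForm` -/

section

variable {a : ℕ} [NeZero a]

/-- The properties that make a function on the upper half plane a modular form of weight zero with
integral Fourier coefficients, in a form that is stable under sums and products. -/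
structure IsIntegralModular (f : ℂ → ℂ) : Prop where
  differentiableAt : ∀ z : ℂ, 0 < z.im → DifferentiableAt ℂ f z
  invariant : IsLevelInvariant f
  growth : HasExpGrowth f
  integral : IsIntegralLaurent f

namespace IsIntegralModular

variable {f : ℂ → ℂ}

lemma isHalfIntegralWeightForm (hf : IsIntegralModular f) :
    IsHalfIntegralWeightForm 0 fun z : ℍ => f z :=
  hf.growth.isHalfIntegralWeightForm hf.invariant hf.differentiableAt

lemma hasIntegralFourierExpansion (hf : IsIntegralModular f) :
    HasIntegralFourierExpansion fun z : ℍ => f z := hf.integral.hasIntegralFourierExpansion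

lemma sum {κ : Type*} (s : Finset κ) {f : κ → ℂ → ℂ} (hf : ∀ i ∈ s, IsIntegralModular (f i)) :
    IsIntegralModular fun z => ∑ i ∈ s, f i z where
  differentiableAt z hz := DifferentiableAt.fun_sum fun i hi => (hf i hi).differentiableAt z hz
  invariant := IsLevelInvariant.sum s fun i hi => (hf i hi).invariant
  growth := HasExpGrowth.sum s fun i hi => (hf i hi).growth
  integral := IsIntegralLaurent.sum s fun i hi => (hf i hi).integral

lemma prod {κ : Type*} (s : Finset κ) {f : κ → ℂ → ℂ} (hf : ∀ i ∈ s, IsIntegralModular (f i)) :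
    IsIntegralModular fun z => ∏ i ∈ s, f i z where
  differentiableAt z hz := DifferentiableAt.fun_finsetProd fun i hi =>
    (hf i hi).differentiableAt z hz
  invariant := IsLevelInvariant.prod s fun i hi => (hf i hi).invariant
  growth := HasExpGrowth.prod s fun i hi => (hf i hi).growth
  integral := IsIntegralLaurent.prod s fun i hi => (hf i hi).integral

end IsIntegralModular

lemma isIntegralModular_fForm {u : ZMod a} (hu : IsUnit u) (k : ZMod a) (n : ℕ) :
    IsIntegralModular (fForm u k n) := by
  rw [fForm_eq_weightForm hu]
  have hl := orbitLen_pos hu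
  have hla := sum_orbitLen hu
  have hc := two_mul_sum_orbitSum u
  exact
    { differentiableAt := fun z hz => differentiableAt_weightForm _ hl _ k n hla hc hz
      invariant := isLevelInvariant_weightForm _ hl _ k n hla hc
      growth := hasExpGrowth_weightForm _ hl _ k n
      integral := isIntegralLaurent_weightForm _ hl _ k n hla }

lemma fForm_add_two_mul {u : ZMod a} (hu : IsUnit u) (k : ZMod a) (n : ℕ) :
    fForm u k (n + 2 * a) = fForm u k n := by
  rw [fForm_eq_weightForm hu, fForm_eq_weightForm hu]
  exact weightForm_add_two_mul _ _ k n (sum_orbitLen hu) (two_mul_sum_orbitSum u)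

end

/-! ### Several elements with product of determinants one -/

section

variable {r : ℕ} (a : Fin r → ℕ) [∀ i, NeZero (a i)] (A : ℕ)

/-- The exponents `κ` for which elements `t_i` with `det t_i = ζ ^ ((A / a_i) κ_i)` have determinants
of product one, where `ζ` is a primitive `A`-th root of unity. -/
def detExponents : Finset (∀ i, ZMod (a i)) :=
  {κ | A ∣ ∑ i, A / a i * (κ i).val}

open Classical in
/-- The modular form that describes the number of tuples `t` with `t_i ^ a_i = 1` and determinants of
product one, for `q` in the class `u` modulo `A`. It is zero if `u` is not a unit, in which case
there is no `q` to be considered. -/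
noncomputable def productForm (u : ZMod A) (n : ℕ) (z : ℂ) : ℂ :=
  ∑ κ ∈ if IsUnit u then detExponents a A else ∅,
    ∏ i, fForm (u.cast : ZMod (a i)) (κ i) n z

variable {a A}

lemma isUnit_cast {m : ℕ} (h : m ∣ A) {u : ZMod A} (hu : IsUnit u) : IsUnit (u.cast : ZMod m) := by
  simpa using hu.map (ZMod.castHom h (ZMod m))

lemma productForm_add_two_mul (ha : ∀ i, a i ∣ A) (u : ZMod A) (n : ℕ) :
    productForm a A u (n + 2 * A) = productForm a A u n := by
  funext z
  by_cases hu : IsUnit u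
  · refine Finset.sum_congr rfl fun κ _ => Finset.prod_congr rfl fun i _ => ?_
    obtain ⟨c, hc⟩ := ha i
    have hp : Function.Periodic (fun n => fForm (u.cast : ZMod (a i)) (κ i) n) (2 * a i) :=
      fun n => fForm_add_two_mul (isUnit_cast (ha i) hu) (κ i) n
    have h := hp.nat_mul c n
    have e : 2 * A = c * (2 * a i) := by rw [hc]; ring
    rw [e]
    exact congrFun h z
  · simp [productForm, hu]

lemma isIntegralModular_productForm (ha : ∀ i, a i ∣ A) (u : ZMod A) (n : ℕ) :
    IsIntegralModular (productForm a A u n) := by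
  refine IsIntegralModular.sum _ fun κ hκ => IsIntegralModular.prod _ fun i _ => ?_
  by_cases hu : IsUnit u
  · exact isIntegralModular_fForm (isUnit_cast (ha i) hu) (κ i) n
  · simp [hu] at hκ

/-- Each `det t_i` is a power of the primitive `a_i`-th root of unity `ζ ^ (A / a_i)`. Sorting the
tuples by the exponents turns the count into a sum of products. -/
lemma JCount_eq_sum {F : Type*} [Field F] [Finite F] {ζ : AlgebraicClosure F}
    (hζ : IsPrimitiveRoot ζ A) (hA : 0 < A) (ha : ∀ i, a i ∣ A) (n : ℕ) :
    JCount F n a =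
      ∑ κ ∈ detExponents a A, ∏ i, jCount F n (a i) (ζ ^ (A / a i)) ((κ i).val : ℤ) := by
  have hζi : ∀ i, IsPrimitiveRoot (ζ ^ (A / a i)) (a i) := fun i =>
    hζ.pow hA (Nat.div_mul_cancel (ha i)).symm
  have key : ∀ (κ : ∀ i, ZMod (a i)) (t : Fin r → GL (Fin n) F),
      (∀ i, algebraMap F (AlgebraicClosure F) (t i : Matrix (Fin n) (Fin n) F).det =
        (ζ ^ (A / a i)) ^ ((κ i).val : ℤ)) →
      (∏ i, (t i : Matrix (Fin n) (Fin n) F).det = 1 ↔ κ ∈ detExponents a A) := by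
    intro κ t h
    rw [← (algebraMap F (AlgebraicClosure F)).injective.eq_iff, map_prod, map_one,
      Finset.prod_congr rfl fun i _ => h i]
    simp only [zpow_natCast, ← pow_mul, Finset.prod_pow_eq_pow_sum, hζ.pow_eq_one_iff_dvd,
      detExponents, Finset.mem_filter, Finset.mem_univ, true_and]
  let φ : (Σ κ : detExponents a A, ∀ i, {t : GL (Fin n) F // t ^ a i = 1 ∧
        algebraMap F (AlgebraicClosure F) (t : Matrix (Fin n) (Fin n) F).det =
          (ζ ^ (A / a i)) ^ ((κ.1 i).val : ℤ)}) →
      {t : Fin r → GL (Fin n) F //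
        (∀ i, t i ^ a i = 1) ∧ ∏ i, (t i : Matrix (Fin n) (Fin n) F).det = 1} := fun x =>
    ⟨fun i => (x.2 i).1, fun i => (x.2 i).2.1,
      (key x.1.1 (fun i => (x.2 i).1) fun i => (x.2 i).2.2).2 x.1.2⟩
  have hφ : Function.Bijective φ := by
    constructor
    · rintro ⟨⟨κ, hκ⟩, s⟩ ⟨⟨κ', hκ'⟩, s'⟩ h
      have hs : ∀ i, (s i).1 = (s' i).1 := fun i => congrFun (congrArg Subtype.val h) i
      obtain rfl : κ = κ' := by
        funext i
        have e := (s i).2.2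
        rw [hs i, (s' i).2.2, zpow_natCast, zpow_natCast] at e
        exact ZMod.val_injective _ ((hζi i).pow_inj (ZMod.val_lt _) (ZMod.val_lt _) e.symm)
      obtain rfl : s = s' := funext fun i => Subtype.ext (hs i)
      rfl
    · rintro ⟨t, ht, hdet⟩
      have h : ∀ i, ∃ k : ZMod (a i), algebraMap F (AlgebraicClosure F)
          (t i : Matrix (Fin n) (Fin n) F).det = (ζ ^ (A / a i)) ^ (k.val : ℤ) := by
        intro i
        have e : (algebraMap F (AlgebraicClosure F) (t i : Matrix (Fin n) (Fin n) F).det) ^ a i =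
            1 := by
          rw [← map_pow, ← Matrix.det_pow, ← Units.val_pow_eq_pow_val, ht i]
          simp
        obtain ⟨j, hj, hje⟩ := (hζi i).eq_pow_of_pow_eq_one e
        exact ⟨j, by rw [ZMod.val_cast_of_lt hj, zpow_natCast, hje]⟩
      choose κ hκ using h
      exact ⟨⟨⟨κ, (key κ t hκ).1 hdet⟩, fun i => ⟨t i, ht i, hκ i⟩⟩, rfl⟩
  rw [JCount, ← Nat.card_congr (Equiv.ofBijective φ hφ), Nat.card_sigma,
    ← Finset.sum_coe_sort (detExponents a A)]
  exact Finset.sum_congr rfl fun κ _ => Nat.card_pi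

variable (a) in
/-- The main terms are bounded and the individual errors decay, so that products of counts are close
to the products of the main terms. -/
lemma exists_forall_abs_sum_prod_sub_le (T : Finset (∀ i, ZMod (a i))) {M : ℝ} (hM : 0 ≤ M) {δ : ℝ}
    (hδ : 0 < δ) : ∃ n₀ : ℕ, ∀ u : ∀ i, ZMod (a i), (∀ i, IsUnit (u i)) → ∀ n, n₀ ≤ n →
      ∀ q : ℝ, 2 ≤ q →
      |∑ κ ∈ T, ∏ i, scaledCount (orbitLen (u i)) (orbitSum (u i)) (κ i) n q -
        ∑ κ ∈ T, ∏ i, mainTerm (orbitLen (u i)) (orbitSum (u i)) (κ i) n q| ≤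
      δ * Real.exp (-(Real.log q * M)) := by
  choose B hB0 hB using fun i => exists_forall_abs_mainTerm_le (a i)
  set C : ℝ := ∑ i, B i + 1
  have hBC : ∀ i, B i + 1 ≤ C := fun i => by
    have := Finset.single_le_sum (fun i _ => hB0 i) (Finset.mem_univ i)
    simp only [C]
    linarith
  have hC : 1 ≤ C := by
    have := Finset.sum_nonneg fun i (_ : i ∈ Finset.univ) => hB0 i
    simp only [C]
    linarith
  set K : ℝ := T.card * (C ^ r * r) with hK
  have hK0 : 0 ≤ K := by positivity
  -- The bound `η ≤ 1` keeps the scaled counts below `C`. The summand `1` in `K + 1` avoids division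
  -- by zero when `T` or `Fin r` is empty.
  set η : ℝ := min 1 (δ / (K + 1)) with hη
  have hη0 : 0 < η := by positivity
  choose N hN using fun i => exists_forall_abs_scaledCount_sub_le' (a i) M hη0
  refine ⟨Finset.univ.sup N, fun u hu n hn q hq => ?_⟩
  set E := Real.exp (-(Real.log q * M)) with hE
  have hE0 : 0 < E := Real.exp_pos _
  have hE1 : E ≤ 1 := Real.exp_le_one_iff.2
    (neg_nonpos.2 (mul_nonneg (Real.log_nonneg (by linarith)) hM))
  have hdiff : ∀ i k, |scaledCount (orbitLen (u i)) (orbitSum (u i)) k n q -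
      mainTerm (orbitLen (u i)) (orbitSum (u i)) k n q| ≤ η * E := fun i k =>
    hN i (u i) k (hu i) n ((Finset.le_sup (Finset.mem_univ i)).trans hn) q hq
  have hmain : ∀ i k, |mainTerm (orbitLen (u i)) (orbitSum (u i)) k n q| ≤ B i := fun i k =>
    hB i (u i) k (hu i) n q hq
  have hscaled : ∀ i k, |scaledCount (orbitLen (u i)) (orbitSum (u i)) k n q| ≤ C := by
    intro i k
    have h1 : η * E ≤ 1 := mul_le_one₀ (min_le_left _ _) hE0.le hE1
    have h2 := abs_sub_abs_le_abs_sub (scaledCount (orbitLen (u i)) (orbitSum (u i)) k n q)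
      (mainTerm (orbitLen (u i)) (orbitSum (u i)) k n q)
    linarith [hdiff i k, hmain i k, hBC i]
  rw [← Finset.sum_sub_distrib]
  calc _ ≤ ∑ κ ∈ T, |∏ i, scaledCount (orbitLen (u i)) (orbitSum (u i)) (κ i) n q -
        ∏ i, mainTerm (orbitLen (u i)) (orbitSum (u i)) (κ i) n q| := Finset.abs_sum_le_sum_abs _ _
    _ ≤ ∑ κ ∈ T, C ^ r * (r * (η * E)) := by
      refine Finset.sum_le_sum fun κ _ => ?_
      refine (abs_prod_sub_prod_le Finset.univ _ _ hC (fun i _ => hscaled i _)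
        fun i _ => (hmain i _).trans (by linarith [hBC i])).trans ?_
      rw [Finset.card_univ, Fintype.card_fin]
      gcongr
      refine (Finset.sum_le_sum fun i _ => hdiff i (κ i)).trans (le_of_eq ?_)
      simp
    _ = K * η * E := by rw [Finset.sum_const, nsmul_eq_mul, hK]; ring
    _ ≤ δ * E := by
      gcongr
      calc K * η ≤ (K + 1) * (δ / (K + 1)) := by
            gcongr
            · linarith
            · exact min_le_right _ _
        _ = δ := by field_simp

lemma JCount_asymptotics (hA : 0 < A) (ha : ∀ i, a i ∣ A) {δ : ℝ} (hδ : 0 < δ) : ∃ n₀ : ℕ,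
    ∀ (F : Type*) [Field F] [Fintype F] (q n : ℕ), n₀ ≤ n →
      Fintype.card F = q → q.Coprime A →
      ∃ ε : ℝ, |ε| < δ ∧
        (JCount F n a : ℂ) =
          (productForm a A (q : ZMod A) n (qPoint q) + (ε : ℂ)) *
            (((q : ℝ) ^ (((r : ℝ) - ∑ i, (a i : ℝ)) / 24) *
              (q : ℝ) ^ (((r : ℝ) - ∑ i, 1 / (a i : ℝ)) * (n : ℝ) ^ 2) : ℝ) : ℂ) := by
  have hM0 : 0 ≤ ∑ i, ((a i : ℝ) - 1) / 24 := Finset.sum_nonneg fun i _ => by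
    have : (1 : ℝ) ≤ a i := by exact_mod_cast NeZero.one_le
    linarith
  obtain ⟨n₀, hn₀⟩ := exists_forall_abs_sum_prod_sub_le a (detExponents a A) hM0 (half_pos hδ)
  refine ⟨n₀, fun F _ _ q n hn hFq hcop => ?_⟩
  subst hFq
  set q := Fintype.card F with hq
  set M : ℝ := ∑ i, ((a i : ℝ) - 1) / 24 with hM
  have hq2 : (2 : ℝ) ≤ q := two_le_card_cast F
  have hq2' : 2 ≤ q := Fintype.one_lt_card (α := F)
  have hq0 : (0 : ℝ) < q := by linarith
  have huA : IsUnit (q : ZMod A) := (ZMod.isUnit_iff_coprime q A).2 hcop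
  have hu : ∀ i, IsUnit (q : ZMod (a i)) := fun i =>
    (ZMod.isUnit_iff_coprime q (a i)).2 (hcop.coprime_dvd_right (ha i))
  obtain ⟨ζ, hζ⟩ : ∃ ζ : AlgebraicClosure F, IsPrimitiveRoot ζ A := by
    have : NeZero A := ⟨hA.ne'⟩
    have : NeZero ((A : ℕ) : AlgebraicClosure F) := by
      refine ⟨fun h => ?_⟩
      obtain ⟨p, hp⟩ := CharP.exists F
      have hpF : p ∣ q := (CharP.cast_eq_zero_iff F p q).1 (by simp [hq])
      have hpA : p ∣ A := (CharP.cast_eq_zero_iff F p A).1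
        ((algebraMap F (AlgebraicClosure F)).injective (by simpa using h))
      have := Nat.dvd_gcd hpF hpA
      rw [hcop.gcd_eq_one, Nat.dvd_one] at this
      exact CharP.char_ne_one F p this
    exact HasEnoughRootsOfUnity.exists_primitiveRoot (AlgebraicClosure F) A
  set L := Real.log q with hL
  set S := ∑ κ ∈ detExponents a A, ∏ i,
    scaledCount (orbitLen (q : ZMod (a i))) (orbitSum (q : ZMod (a i))) (κ i) n q with hS
  set m := ∑ κ ∈ detExponents a A, ∏ i,
    mainTerm (orbitLen (q : ZMod (a i))) (orbitSum (q : ZMod (a i))) (κ i) n q with hm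
  have hSm : |S - m| ≤ δ / 2 * Real.exp (-(L * M)) := hn₀ (fun i => q) hu n hn q hq2
  have hform : productForm a A (q : ZMod A) n (qPoint q) = ((m * Real.exp (L * M) : ℝ) : ℂ) := by
    rw [productForm, if_pos huA, hm, Finset.sum_mul, Complex.ofReal_sum]
    refine Finset.sum_congr rfl fun κ _ => ?_
    rw [hM, Finset.mul_sum, Real.exp_sum, ← Finset.prod_mul_distrib, Complex.ofReal_prod]
    refine Finset.prod_congr rfl fun i _ => ?_
    rw [ZMod.cast_natCast (ha i), fForm_qPoint (hu i) _ n hq2']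
  have hcount : (JCount F n a : ℝ) =
      Real.exp (L * (((r : ℝ) - ∑ i, 1 / (a i : ℝ)) * (n : ℝ) ^ 2)) * S := by
    rw [JCount_eq_sum hζ hA ha, hS, Finset.mul_sum, Nat.cast_sum]
    refine Finset.sum_congr rfl fun κ _ => ?_
    have e : L * (((r : ℝ) - ∑ i, 1 / (a i : ℝ)) * (n : ℝ) ^ 2) =
        ∑ i, L * ((1 - 1 / (a i : ℝ)) * (n : ℝ) ^ 2) := by
      rw [← Finset.mul_sum, ← Finset.sum_mul, Finset.sum_sub_distrib]
      simp
    rw [e, Real.exp_sum, ← Finset.prod_mul_distrib, Nat.cast_prod]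
    refine Finset.prod_congr rfl fun i _ => ?_
    rw [jCount_eq_scaledCount (hζ.pow hA (Nat.div_mul_cancel (ha i)).symm) (hu i), Int.cast_natCast,
      ZMod.natCast_zmod_val]
  refine ⟨(S - m) * Real.exp (L * M), ?_, ?_⟩
  · rw [abs_mul, abs_of_pos (Real.exp_pos _)]
    calc _ ≤ δ / 2 * Real.exp (-(L * M)) * Real.exp (L * M) := by gcongr
      _ = δ / 2 := by rw [mul_assoc, ← Real.exp_add, neg_add_cancel, Real.exp_zero, mul_one]
      _ < δ := by linarith
  · have e : (JCount F n a : ℂ) = ((JCount F n a : ℝ) : ℂ) := by simp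
    rw [e, hform, hcount, ← Complex.ofReal_add, ← Complex.ofReal_mul, Complex.ofReal_inj,
      Real.rpow_def_of_pos hq0, Real.rpow_def_of_pos hq0, ← add_mul, add_sub_cancel, mul_assoc,
      ← mul_assoc (Real.exp _) (Real.exp _), ← Real.exp_add]
    have e1 : M = -(((r : ℝ) - ∑ i, (a i : ℝ)) / 24) := by
      rw [hM, ← Finset.sum_div, Finset.sum_sub_distrib]
      simp
      ring
    have e2 : L * M + L * (((r : ℝ) - ∑ i, (a i : ℝ)) / 24) = 0 := by rw [e1]; ring
    rw [e2, Real.exp_zero, one_mul, mul_comm]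

end

end FuchsianCount

theorem proposition4p1 :
    -- the sequence `f_n`, and the asymptotics of `j_{q,n,k}(a)`, uniform in `q`
    (∀ (a : ℕ) [NeZero a] (k : ℤ),
      (∀ u : ZMod a, IsUnit u → ∀ n : ℕ,
        fForm u (k : ZMod a) (n + 2 * a) = fForm u (k : ZMod a) n ∧
        IsHalfIntegralWeightForm 0 (fun z : UpperHalfPlane => fForm u (k : ZMod a) n z) ∧
        HasIntegralFourierExpansion (fun z : UpperHalfPlane => fForm u (k : ZMod a) n z)) ∧
      ∀ δ : ℝ, 0 < δ → ∃ n₀ : ℕ,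
        ∀ (F : Type*) [Field F] [Fintype F] (ζ : AlgebraicClosure F) (q n : ℕ), n₀ ≤ n →
          Fintype.card F = q → q.Coprime a → IsPrimitiveRoot ζ a →
          ∃ ε : ℝ, |ε| < δ ∧
            (jCount F n a ζ k : ℂ) =
              (fForm (q : ZMod a) (k : ZMod a) n (qPoint q) + (ε : ℂ)) *
                (((q : ℝ) ^ ((1 - (a : ℝ)) / 24) *
                  (q : ℝ) ^ ((1 - 1 / (a : ℝ)) * (n : ℝ) ^ 2) : ℝ) : ℂ)) ∧
    -- the asymptotics of `J_{q,n}(a_1, …, a_r)`, uniform in `q`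
    (∀ (r : ℕ) (a : Fin r → ℕ) (A : ℕ), (∀ i, 0 < a i) → A = Finset.univ.lcm a →
      ∃ f : ZMod A → ℕ → ℂ → ℂ,
        (∀ (u : ZMod A) (n : ℕ),
          f u (n + 2 * A) = f u n ∧
          IsHalfIntegralWeightForm 0 (fun z : UpperHalfPlane => f u n z) ∧
          HasIntegralFourierExpansion (fun z : UpperHalfPlane => f u n z)) ∧
        ∀ δ : ℝ, 0 < δ → ∃ n₀ : ℕ,
          ∀ (F : Type*) [Field F] [Fintype F] (q n : ℕ), n₀ ≤ n →
            Fintype.card F = q → q.Coprime A →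
            ∃ ε : ℝ, |ε| < δ ∧
              (JCount F n a : ℂ) =
                (f (q : ZMod A) n (qPoint q) + (ε : ℂ)) *
                  (((q : ℝ) ^ (((r : ℝ) - ∑ i, (a i : ℝ)) / 24) *
                    (q : ℝ) ^ (((r : ℝ) - ∑ i, 1 / (a i : ℝ)) * (n : ℝ) ^ 2) : ℝ) : ℂ)) := by
  refine ⟨fun a _ k => ⟨fun u hu n => ?_, fun δ hδ => jCount_asymptotics a k δ hδ⟩,
    fun r a A ha hA => ?_⟩
  · have h := isIntegralModular_fForm hu (k : ZMod a) n
    exact ⟨fForm_add_two_mul hu k n, h.isHalfIntegralWeightForm, h.hasIntegralFourierExpansion⟩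
  · have (i : Fin r) : NeZero (a i) := ⟨(ha i).ne'⟩
    have haA (i : Fin r) : a i ∣ A := hA ▸ Finset.dvd_lcm (Finset.mem_univ i)
    have hA0 : 0 < A := by
      rw [hA, Nat.pos_iff_ne_zero, Ne, Finset.lcm_eq_zero_iff]
      simpa using fun i => (ha i).ne'
    refine ⟨productForm a A, fun u n => ?_, fun δ hδ => JCount_asymptotics hA0 haA hδ⟩
    have h := isIntegralModular_productForm haA u n
    exact ⟨productForm_add_two_mul haA u n, h.isHalfIntegralWeightForm,
      h.hasIntegralFourierExpansion⟩
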